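/- Let $N\ge 1$, let $H=(H_1,\dots,H_N)\in(0,1)^N$, and put $Q=\sum_{j=1}^N H_j^{-1}$ and $\rho(s,t)=\sum_{j=1}^N|s_j-t_j|^{H_j}$ for $s,t\in\mathbb R^N$. For $x\in\mathbb R^N$ and $r>0$ let $C(x,r)=\{y\in\mathbb R^N: |y_j-x_j|\le r,\ j=1,\dots,N\}$. Let $X_0=\{X_0(t),t\in\mathbb R^N\}$ be a real-valued centered Gaussian random field with stationary increments and $X_0(0)=0$ almost surely. Let $F$ be the spectral measure of $X_0$, that is, a nonnegative symmetric Borel measure on $\mathbb R^N\setminus\{0\}$ with $$\int_{\mathbb R^N}\frac{\|\lambda\|^2}{1+\|\lambda\|^2}\,F(d\lambda)<\infty$$ such that, for some nonnegative definite $N\times N$ matrix $M$ and all $s,t\in\mathbb R^N$, $$\mathbb E[X_0(s)X_0(t)]=\int_{\mathbb R^N}\big(e^{i\langle s,\lambda\rangle}-1\big)\big(e^{-i\langle t,\lambda\rangle}-1\big)\,F(d\lambda)+\langle s,Mt\rangle .$$ ($F$ need not be absolutely continuous; it may be discrete or of mixed type.) **Theorem 2.1.** Suppose that for some constant $h>0$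 $$0<\liminf_{\|\lambda\|\to\infty}\rho(0,\lambda)^{Q+2}F(C(\lambda,h))\le\limsup_{\|\lambda\|\to\infty}\rho(0,\lambda)^{Q+2}F(C(\lambda,h))<\infty .$$ Then for every $T>0$ with $ThN<\log 2$, $X_0$ satisfies the following two conditions on $C(0,T)$. (C1) There is a constant $c\ge1$ such that for all $s,t\in C(0,T)$ $$c^{-1}\rho(s,t)^2\le\mathbb E\big(X_0(s)-X_0(t)\big)^2\le c\,\rho(s,t)^2 .$$ (C2) There is a constant $c'>0$ such that for all integers $n\ge1$ and all $u,t^1,\dots,t^n\in C(0,T)$, almost surely, with $t^0=0$, $$\operatorname{Var}\big(X_0(u)\mid X_0(t^1),\dots,X_0(t^n)\big)\ge c'\min_{0\le k\le n}\rho(u,t^k)^2 .$$ That is, $X_0$ is strongly locally nondeterministic in the metric $\rho$ on $C(0,T)$. -/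

import Mathlib

open MeasureTheory ProbabilityTheory

namespace SLND

noncomputable section

/-- The anisotropic metric `ρ(s,t) = ∑ⱼ |sⱼ - tⱼ|^{Hⱼ}` on `ℝ^N`. -/
def rho {N : ℕ} (H : Fin N → ℝ) (s t : EuclideanSpace ℝ (Fin N)) : ℝ :=
  ∑ j, |s j - t j| ^ H j

/-- `Q = ∑ⱼ 1 / Hⱼ`. -/
def homDim {N : ℕ} (H : Fin N → ℝ) : ℝ := ∑ j, (H j)⁻¹

/-- The closed cube `C(x,h)` with centre `x` and side length `2h`. -/
def cube {N : ℕ} (x : EuclideanSpace ℝ (Fin N)) (h : ℝ) : Set (EuclideanSpace ℝ (Fin N)) :=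
  {y | ∀ j, |y j - x j| ≤ h}

/-- Stationary increments: for every `h`, the fields `X(t + h) - X(h)` and `X(t) - X(0)`
(indexed by `t`) have the same finite-dimensional distributions. -/
def HasStationaryIncrements {Ω : Type*} [MeasurableSpace Ω] {N : ℕ}
    (X : EuclideanSpace ℝ (Fin N) → Ω → ℝ) (P : Measure Ω) : Prop :=
  ∀ (h : EuclideanSpace ℝ (Fin N)) (n : ℕ) (t : Fin n → EuclideanSpace ℝ (Fin N)),
    IdentDistrib (fun ω i ↦ X (t i + h) ω - X h ω) (fun ω i ↦ X (t i) ω - X 0 ω) P P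

/-- `X` is a real-valued, centered Gaussian random field on `ℝ^N` with stationary increments
and `X(0) = 0` almost surely. -/
structure IsCenteredGaussianFieldSI {Ω : Type*} [MeasurableSpace Ω] {N : ℕ}
    (X : EuclideanSpace ℝ (Fin N) → Ω → ℝ) (P : Measure Ω) : Prop where
  measurable : ∀ t, Measurable (X t)
  gaussian : IsGaussianProcess X P
  centered : ∀ t, ∫ ω, X t ω ∂P = 0
  stationary_increments : HasStationaryIncrements X P
  zero_at_origin : ∀ᵐ ω ∂P, X 0 ω = 0

/-- `F` is the spectral measure of the field `X` (Yaglom's representation): `F` is a symmetric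
measure on `ℝ^N ∖ {0}` (that is, a measure on `ℝ^N` which does not charge the origin) with
`∫ ‖ξ‖² / (1 + ‖ξ‖²) F(dξ) < ∞`, and for some non-negative definite matrix `M`
`E[X(s) X(t)] = ∫ (e^{i⟨s,ξ⟩} - 1) (e^{-i⟨t,ξ⟩} - 1) F(dξ) + ⟨s, M t⟩` for all `s, t`. -/
structure IsSpectralMeasure {Ω : Type*} [MeasurableSpace Ω] {N : ℕ}
    (X : EuclideanSpace ℝ (Fin N) → Ω → ℝ) (P : Measure Ω)
    (F : Measure (EuclideanSpace ℝ (Fin N))) : Prop where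
  no_mass_origin : F {0} = 0
  symmetric : F.map (fun ξ ↦ -ξ) = F
  finite_integral : ∫⁻ ξ, ENNReal.ofReal (‖ξ‖ ^ 2 / (1 + ‖ξ‖ ^ 2)) ∂F < ⊤
  representation : ∃ M : Matrix (Fin N) (Fin N) ℝ, M.PosSemidef ∧
    ∀ s t : EuclideanSpace ℝ (Fin N),
      ((∫ ω, X s ω * X t ω ∂P : ℝ) : ℂ) =
        (∫ ξ, (Complex.exp (Complex.I * (inner ℝ s ξ : ℝ)) - 1) *
            (Complex.exp (-(Complex.I * (inner ℝ t ξ : ℝ))) - 1) ∂F) +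
          ((s.ofLp ⬝ᵥ M.mulVec t.ofLp : ℝ) : ℂ)

/-- The spectral condition
`0 < liminf ρ(0,ξ)^{Q+2} F(C(ξ,h)) ≤ limsup ρ(0,ξ)^{Q+2} F(C(ξ,h)) < ∞` as `‖ξ‖ → ∞`. -/
def SpectralCondition {N : ℕ} (H : Fin N → ℝ) (F : Measure (EuclideanSpace ℝ (Fin N)))
    (h : ℝ) : Prop :=
  0 < Filter.liminf (fun ξ : EuclideanSpace ℝ (Fin N) ↦
      ENNReal.ofReal (rho H 0 ξ ^ (homDim H + 2)) * F (cube ξ h))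
      (Filter.comap (fun ξ ↦ ‖ξ‖) Filter.atTop) ∧
  Filter.limsup (fun ξ : EuclideanSpace ℝ (Fin N) ↦
      ENNReal.ofReal (rho H 0 ξ ^ (homDim H + 2)) * F (cube ξ h))
      (Filter.comap (fun ξ ↦ ‖ξ‖) Filter.atTop) < ⊤

/-- The variogram of `X` is comparable to `ρ²` on `A`:
`c⁻¹ ρ(s,t)² ≤ E (X(s) - X(t))² ≤ c ρ(s,t)²` for all `s, t ∈ A`. -/
def ConditionC1 {Ω : Type*} [MeasurableSpace Ω] {N : ℕ} (H : Fin N → ℝ)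
    (X : EuclideanSpace ℝ (Fin N) → Ω → ℝ) (P : Measure Ω)
    (A : Set (EuclideanSpace ℝ (Fin N))) : Prop :=
  ∃ c : ℝ, 1 ≤ c ∧ ∀ s ∈ A, ∀ t ∈ A,
    c⁻¹ * rho H s t ^ 2 ≤ ∫ ω, (X s ω - X t ω) ^ 2 ∂P ∧
    ∫ ω, (X s ω - X t ω) ^ 2 ∂P ≤ c * rho H s t ^ 2

/-- Strong local nondeterminism of `X` in the metric `ρ` on `A`. The conditional
variance given `X(t¹), …, X(tⁿ)` is the one given the σ-algebra they generate, and
`Fin.cons 0 t` is the list `t⁰ = 0, t¹, …, tⁿ`. -/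
def ConditionC2 {Ω : Type*} [MeasurableSpace Ω] {N : ℕ} (H : Fin N → ℝ)
    (X : EuclideanSpace ℝ (Fin N) → Ω → ℝ) (P : Measure Ω)
    (A : Set (EuclideanSpace ℝ (Fin N))) : Prop :=
  ∃ c : ℝ, 0 < c ∧ ∀ n : ℕ, 1 ≤ n → ∀ u ∈ A,
    ∀ t : Fin n → EuclideanSpace ℝ (Fin N), (∀ i, t i ∈ A) →
      ∀ᵐ ω ∂P,
        c * (⨅ k : Fin (n + 1),
            rho H u ((Fin.cons 0 t : Fin (n + 1) → EuclideanSpace ℝ (Fin N)) k) ^ 2) ≤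
          condVar (⨆ i, MeasurableSpace.comap (X (t i)) inferInstance) (X u) P ω

end

end SLND

/-!
# Strong local nondeterminism from a condition on the spectral measure of cubes

By the spectral representation, `E (∑ bₖ X(vₖ))²` is the `L²(F)`-norm of the exponential sum
`∑ bₖ (e^{i⟨·,vₖ⟩} - 1)`, plus a nonnegative quadratic term
(`IsSpectralMeasure.exists_ofReal_integral_sq_eq`). For a Gaussian field the conditional variance
of `X(u)` given `X(t¹), …, X(tⁿ)` is the constant `E (X(u) - ∑ aₖ X(tᵏ))²` for the best linear
predictor (`exists_condVar_ae_eq`), so both conditions become statements on the distance in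
`L²(F)` from `e^{i⟨·,u⟩}` to combinations of the exponentials at the points `t⁰ = 0, t¹, …, tⁿ`.

*Lower bound* (`exists_le_lintegral_expSum`). Let `r` be a small multiple of `min ρ(u,tᵏ)` and let
`δ` be a bump supported in the box with half-sides `r^{1/Hⱼ}`. The transform `G` of
`δ(· - u) - ∑ cₖ δ(· - tᵏ)` is the exponential sum times the transform of `δ`. As the bump at `u`
meets none of the others, Plancherel's identity gives `‖G‖₂² ≥ const · r^Q`. The step that replaces
Lebesgue measure by `F`, which may be discrete, is the sampling inequality
`exists_energy_le_sampleMean`: if `G` has frequencies in `C(0,R)` and `R h N < log 2`, then `‖G‖₂²`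
is at most a constant times the integral, over centres `x` far from the origin, of the `F`-mean of
`|G|²` over `C(x,h)`. Indeed Taylor's formula and Bernstein's inequality bound the oscillation of
`G` on these cubes by `(e^{NhR} - 1) ‖G‖₂`, and `e^{NhR} - 1 < 1`. Near the origin nothing is known
about `F`; this region is removed by a high-pass multiplier of arbitrarily small band
(`exists_highPass`) together with the fact that a band-limited function carries a fixed proportion
of its energy outside any given ball (`exists_energy_le_outside_ball`). Finally the lower spectral
bound turns the means into `∫ |G|² ρ(0,·)^{Q+2} dF`, in which the decay of the transform of `δ`
leaves `const · r^{Q-2}` times the `L²(F)`-norm of the exponential sum.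

*Upper bound* (`exists_lintegral_exp_sub_le`). The upper spectral bound shows that the shell
`{R ≤ ρ(0,·) < 2R}` has `F`-mass at most `const · R⁻²`; summing `min(1, |⟨x,u-t⟩|²)` over dyadic
shells gives `const · ρ(u,t)²`.
-/

namespace SLND

section Spectral

open scoped FourierTransform ContDiff NNReal

/-! ### Band-limited functions and Plancherel's identity -/

/-- The Fourier transform `x ↦ ∫ e^{i⟨x,ξ⟩} ψ(ξ) dξ`, normalised without the factor `2π` so that
it matches the exponentials of the spectral representation. -/
noncomputable def ft {N : ℕ} (ψ : EuclideanSpace ℝ (Fin N) → ℂ) (x : EuclideanSpace ℝ (Fin N)) :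
    ℂ :=
  ∫ ξ, Complex.exp (Complex.I * (inner ℝ x ξ : ℝ)) * ψ ξ

/-- Smooth functions supported in the cube `C(0,R)`; their transforms `ft ψ` are the
band-limited functions with frequencies in `C(0,R)`. -/
structure IsBand {N : ℕ} (R : ℝ) (ψ : EuclideanSpace ℝ (Fin N) → ℂ) : Prop where
  contDiff : ContDiff ℝ ∞ ψ
  supp : ∀ ξ, ψ ξ ≠ 0 → ξ ∈ cube 0 R

variable {N : ℕ}

lemma mem_cube_zero {R : ℝ} {x : EuclideanSpace ℝ (Fin N)} :
    x ∈ cube 0 R ↔ ∀ j, |x j| ≤ R := by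
  simp [cube]

lemma cube_eq_preimage (x : EuclideanSpace ℝ (Fin N)) (h : ℝ) :
    cube x h = (MeasurableEquiv.toLp 2 (Fin N → ℝ)).symm ⁻¹'
      (Set.univ.pi fun j ↦ Set.Icc (x j - h) (x j + h)) := by
  ext y
  simp only [cube, Set.mem_ofPred_eq, Set.mem_preimage, Set.mem_pi, Set.mem_univ, true_imp_iff,
    Set.mem_Icc, MeasurableEquiv.coe_toLp_symm]
  refine forall_congr' fun j ↦ ?_
  rw [abs_le]
  constructor <;> rintro ⟨h1, h2⟩ <;> constructor <;> linarith

lemma isClosed_cube (x : EuclideanSpace ℝ (Fin N)) (h : ℝ) : IsClosed (cube x h) := by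
  simp only [cube, Set.ofPred_forall]
  exact isClosed_iInter fun j ↦ isClosed_le (by fun_prop) continuous_const

lemma mem_cube_comm {x y : EuclideanSpace ℝ (Fin N)} {h : ℝ} : y ∈ cube x h ↔ x ∈ cube y h := by
  simp only [cube, Set.mem_ofPred_eq, abs_sub_comm]

lemma measurableSet_mem_cube (h : ℝ) :
    MeasurableSet {p : EuclideanSpace ℝ (Fin N) × EuclideanSpace ℝ (Fin N) |
      p.2 ∈ cube p.1 h} := by
  have : {p : EuclideanSpace ℝ (Fin N) × EuclideanSpace ℝ (Fin N) | p.2 ∈ cube p.1 h} =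
      ⋂ j, {p | |p.2 j - p.1 j| ≤ h} := by
    ext p; simp [cube]
  rw [this]
  exact MeasurableSet.iInter fun j ↦ measurableSet_le (by fun_prop) measurable_const

lemma measurableSet_cube (x : EuclideanSpace ℝ (Fin N)) (h : ℝ) : MeasurableSet (cube x h) :=
  (isClosed_cube x h).measurableSet

/-- This includes `h < 0`: the cube is then empty if `N > 0`, and all of `ℝ⁰` if `N = 0`. -/
lemma volume_cube (x : EuclideanSpace ℝ (Fin N)) (h : ℝ) :
    volume (cube x h) = ENNReal.ofReal (2 * h) ^ N := by
  rw [cube_eq_preimage,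
    (EuclideanSpace.volume_preserving_symm_measurableEquiv_toLp (Fin N)).measure_preimage_equiv,
    volume_pi_pi]
  have (j : Fin N) : x j + h - (x j - h) = 2 * h := by ring
  simp [Real.volume_Icc, this]

lemma isCompact_cube (x : EuclideanSpace ℝ (Fin N)) (h : ℝ) : IsCompact (cube x h) := by
  have : cube x h = (EuclideanSpace.equiv (Fin N) ℝ).toHomeomorph ⁻¹'
      (Set.univ.pi fun j ↦ Set.Icc (x j - h) (x j + h)) := by
    rw [cube_eq_preimage]; rfl
  rw [this, Homeomorph.isCompact_preimage]
  exact isCompact_univ_pi fun j ↦ isCompact_Icc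

lemma IsBand.hasCompactSupport {R : ℝ} {ψ : EuclideanSpace ℝ (Fin N) → ℂ} (hψ : IsBand R ψ) :
    HasCompactSupport ψ :=
  HasCompactSupport.intro (isCompact_cube 0 R) fun x hx ↦ by
    by_contra h; exact hx (hψ.supp x h)

lemma IsBand.continuous {R : ℝ} {ψ : EuclideanSpace ℝ (Fin N) → ℂ} (hψ : IsBand R ψ) :
    Continuous ψ := hψ.contDiff.continuous

lemma IsBand.integrable {R : ℝ} {ψ : EuclideanSpace ℝ (Fin N) → ℂ} (hψ : IsBand R ψ) :
    Integrable ψ := hψ.continuous.integrable_of_hasCompactSupport hψ.hasCompactSupport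

lemma norm_exp_I_mul_ofReal (t : ℝ) : ‖Complex.exp (Complex.I * t)‖ = 1 := by
  rw [mul_comm]; exact Complex.norm_exp_ofReal_mul_I t

lemma IsBand.mul {R : ℝ} {ψ m : EuclideanSpace ℝ (Fin N) → ℂ} (hψ : IsBand R ψ)
    (hm : ContDiff ℝ ∞ m) : IsBand R (fun ξ ↦ m ξ * ψ ξ) :=
  ⟨hm.mul hψ.contDiff, fun ξ h ↦ hψ.supp ξ (right_ne_zero_of_mul h)⟩

lemma IsBand.mono {R R' : ℝ} {ψ : EuclideanSpace ℝ (Fin N) → ℂ} (hψ : IsBand R ψ) (h : R ≤ R') :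
    IsBand R' ψ :=
  ⟨hψ.contDiff, fun ξ hξ j ↦ (hψ.supp ξ hξ j).trans h⟩

lemma contDiff_expInner (x : EuclideanSpace ℝ (Fin N)) :
    ContDiff ℝ ∞ (fun ξ : EuclideanSpace ℝ (Fin N) ↦
      Complex.exp (Complex.I * (inner ℝ x ξ : ℝ))) := by
  have h : ContDiff ℝ ∞ (fun ξ : EuclideanSpace ℝ (Fin N) ↦ ((inner ℝ x ξ : ℝ) : ℂ)) :=
    Complex.ofRealCLM.contDiff.comp (contDiff_const.inner ℝ contDiff_id)
  exact (contDiff_const.mul h).cexp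

lemma integrable_expInner_mul {ψ : EuclideanSpace ℝ (Fin N) → ℂ} (hψ : Integrable ψ)
    (x : EuclideanSpace ℝ (Fin N)) :
    Integrable fun ξ ↦ Complex.exp (Complex.I * (inner ℝ x ξ : ℝ)) * ψ ξ := by
  refine hψ.bdd_mul (c := 1) (contDiff_expInner x).continuous.aestronglyMeasurable ?_
  exact Filter.Eventually.of_forall fun ξ ↦ (norm_exp_I_mul_ofReal _).le

lemma ft_eq_fourier (ψ : EuclideanSpace ℝ (Fin N) → ℂ) (x : EuclideanSpace ℝ (Fin N)) :
    ft ψ x = 𝓕 ψ (-(2 * Real.pi)⁻¹ • x) := by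
  rw [Real.fourier_eq', ft]
  congr 1 with ξ
  rw [smul_eq_mul, inner_smul_right, real_inner_comm]
  congr 2
  push_cast
  have : (Real.pi : ℂ) ≠ 0 := by exact_mod_cast Real.pi_ne_zero
  field_simp

/-- The total energy of `ft ψ`. -/
noncomputable def energy (ψ : EuclideanSpace ℝ (Fin N) → ℂ) : ENNReal := ∫⁻ x, ‖ft ψ x‖ₑ ^ 2

lemma IsBand.continuous_ft {R : ℝ} {ψ : EuclideanSpace ℝ (Fin N) → ℂ} (hψ : IsBand R ψ) :
    Continuous (ft ψ) := by
  have : ft ψ = fun x ↦ 𝓕 (hψ.hasCompactSupport.toSchwartzMap hψ.contDiff)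
      (-(2 * Real.pi)⁻¹ • x) := by
    ext x; rw [ft_eq_fourier, SchwartzMap.fourier_coe]; rfl
  rw [this]
  exact (SchwartzMap.continuous _).comp (by fun_prop)

lemma lintegral_comp_smul (f : EuclideanSpace ℝ (Fin N) → ENNReal) {c : ℝ} (hc : c ≠ 0) :
    ∫⁻ x, f (c • x) = ENNReal.ofReal (|c|⁻¹ ^ N) * ∫⁻ x, f x := by
  have := (Homeomorph.smulOfNeZero c hc).measurableEmbedding (γ := EuclideanSpace ℝ (Fin N))
  have h2 := this.lintegral_map (μ := volume) f
  simp only [Homeomorph.smulOfNeZero_apply] at h2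
  rw [← h2]
  rw [Measure.map_addHaar_smul _ hc, lintegral_smul_measure, finrank_euclideanSpace_fin]
  simp [abs_inv, abs_pow]

/-- Plancherel's identity. -/
lemma IsBand.energy_eq {R : ℝ} {ψ : EuclideanSpace ℝ (Fin N) → ℂ} (hψ : IsBand R ψ) :
    energy ψ = ENNReal.ofReal ((2 * Real.pi) ^ N) * ∫⁻ ξ, ‖ψ ξ‖ₑ ^ 2 := by
  set f := hψ.hasCompactSupport.toSchwartzMap hψ.contDiff with hf
  have hf' : (f : EuclideanSpace ℝ (Fin N) → ℂ) = ψ := rfl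
  have key (g : SchwartzMap (EuclideanSpace ℝ (Fin N)) ℂ) :
      ∫⁻ x, ‖g x‖ₑ ^ 2 = ENNReal.ofReal (∫ x, ‖g x‖ ^ 2) := by
    have hg : Integrable (fun x ↦ ‖g x‖ ^ 2) := (g.memLp 2).integrable_norm_pow (by norm_num)
    rw [ofReal_integral_eq_lintegral_ofReal hg (Filter.Eventually.of_forall fun x ↦ by positivity)]
    congr 1 with x
    rw [ENNReal.ofReal_pow (norm_nonneg _), ofReal_norm]
  have h1 : energy ψ = ∫⁻ x, (fun y ↦ ‖𝓕 f y‖ₑ ^ 2) ((-(2 * Real.pi)⁻¹) • x) := by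
    unfold energy
    congr 1 with x
    simp only [ft_eq_fourier, SchwartzMap.fourier_coe, hf']
  rw [h1, lintegral_comp_smul (fun y ↦ ‖𝓕 f y‖ₑ ^ 2) (by simp [Real.pi_ne_zero]), key,
    SchwartzMap.integral_norm_sq_fourier,
    ← key, hf', abs_neg, abs_inv, inv_inv, abs_of_pos (by positivity)]

lemma IsBand.energy_ne_top {R : ℝ} {ψ : EuclideanSpace ℝ (Fin N) → ℂ} (hψ : IsBand R ψ) :
    energy ψ ≠ ⊤ := by
  rw [hψ.energy_eq]
  refine ENNReal.mul_ne_top ENNReal.ofReal_ne_top ?_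
  have h2 : MemLp ψ 2 := hψ.continuous.memLp_of_hasCompactSupport hψ.hasCompactSupport
  have := h2.eLpNorm_lt_top
  rw [eLpNorm_lt_top_iff_lintegral_rpow_enorm_lt_top (by norm_num) (by norm_num)] at this
  simpa using this.ne

/-- A Fourier multiplier bounded by `c` on the band multiplies the energy by at most `c²`. -/
lemma IsBand.energy_mul_le {R : ℝ} {ψ m : EuclideanSpace ℝ (Fin N) → ℂ} (hψ : IsBand R ψ)
    (hm : ContDiff ℝ ∞ m) {c : ℝ} (hc : ∀ ξ ∈ cube 0 R, ‖m ξ‖ ≤ c) :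
    energy (fun ξ ↦ m ξ * ψ ξ) ≤ ENNReal.ofReal c ^ 2 * energy ψ := by
  have hmeas := hψ.continuous.measurable
  rw [(hψ.mul hm).energy_eq, hψ.energy_eq, mul_left_comm,
    ← lintegral_const_mul (ENNReal.ofReal c ^ 2) (by fun_prop)]
  refine mul_le_mul_right (lintegral_mono fun ξ ↦ ?_) _
  by_cases h : ψ ξ = 0
  · simp [h]
  · rw [enorm_mul, mul_pow]
    gcongr
    rw [← ofReal_norm]
    exact ENNReal.ofReal_le_ofReal (hc ξ (hψ.supp ξ h))

/-! ### Approximation of a band-limited function on small cubes -/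

/-- Minkowski's inequality in `L²` for a countable family. -/
lemma lintegral_tsum_sq_le {α ι : Type*} [MeasurableSpace α] [Countable ι] {μ : Measure α}
    {f : ι → α → ENNReal} (hf : ∀ i, Measurable (f i)) {B : ι → ENNReal}
    (hB : ∀ i, ∫⁻ x, f i x ^ 2 ∂μ ≤ B i ^ 2) :
    ∫⁻ x, (∑' i, f i x) ^ 2 ∂μ ≤ (∑' i, B i) ^ 2 := by
  have hcs (i j : ι) : ∫⁻ x, f i x * f j x ∂μ ≤ B i * B j := by
    have hroot (i : ι) : (∫⁻ x, f i x ^ (2 : ℝ) ∂μ) ^ (1 / 2 : ℝ) ≤ B i := by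
      have h := hB i
      simp_rw [← ENNReal.rpow_two] at h
      calc _ ≤ (B i ^ (2 : ℝ)) ^ (1 / 2 : ℝ) := ENNReal.rpow_le_rpow h (by norm_num)
        _ = B i := by rw [← ENNReal.rpow_mul]; norm_num
    calc _ ≤ _ := ENNReal.lintegral_mul_le_Lp_mul_Lq μ Real.HolderConjugate.two_two
          (hf i).aemeasurable (hf j).aemeasurable
      _ ≤ _ := mul_le_mul' (hroot i) (hroot j)
  simp_rw [sq, ← ENNReal.tsum_mul_left, ← ENNReal.tsum_mul_right]
  rw [lintegral_tsum fun i ↦ by fun_prop]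
  refine ENNReal.tsum_le_tsum fun i ↦ ?_
  rw [lintegral_tsum fun j ↦ by fun_prop]
  exact ENNReal.tsum_le_tsum fun j ↦ hcs _ _

/-- The monomial `∏ₗ ξ_{w l}` indexed by a word `w` in the coordinates. -/
noncomputable def wordMonomial {n : ℕ} (w : Fin n → Fin N) (ξ : EuclideanSpace ℝ (Fin N)) : ℂ :=
  ((∏ l, ξ (w l) : ℝ) : ℂ)

lemma contDiff_wordMonomial {n : ℕ} (w : Fin n → Fin N) : ContDiff ℝ ∞ (wordMonomial w) := by
  have : ContDiff ℝ ∞ fun ξ : EuclideanSpace ℝ (Fin N) ↦ ∏ l, ξ (w l) :=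
    contDiff_prod fun l _ ↦ by fun_prop
  exact Complex.ofRealCLM.contDiff.comp this

lemma norm_wordMonomial_le {n : ℕ} (w : Fin n → Fin N) {R : ℝ} {ξ : EuclideanSpace ℝ (Fin N)}
    (hξ : ξ ∈ cube 0 R) : ‖wordMonomial w ξ‖ ≤ R ^ n := by
  rw [wordMonomial, Complex.norm_real, Real.norm_eq_abs, Finset.abs_prod]
  calc _ ≤ ∏ _l : Fin n, R := Finset.prod_le_prod (fun _ _ ↦ abs_nonneg _)
        fun l _ ↦ mem_cube_zero.1 hξ (w l)
    _ = R ^ n := by simp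

lemma inner_pow_eq_sum_words (d ξ : EuclideanSpace ℝ (Fin N)) (n : ℕ) :
    ((inner ℝ d ξ : ℝ) : ℂ) ^ n =
      ∑ w : Fin n → Fin N, ((∏ l, d (w l) : ℝ) : ℂ) * wordMonomial w ξ := by
  have : (inner ℝ d ξ : ℝ) = ∑ j, d j * ξ j := by
    simp [PiLp.inner_apply, mul_comm]
  rw [this, ← Complex.ofReal_pow, Fintype.sum_pow, Complex.ofReal_sum]
  refine Finset.sum_congr rfl fun w _ ↦ ?_
  rw [wordMonomial, ← Complex.ofReal_mul, Finset.prod_mul_distrib]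

/-- The oscillation of `ft ψ` on cubes of half-side `h`, majorised by its Taylor series. -/
noncomputable def taylorMajorant (h : ℝ) (ψ : EuclideanSpace ℝ (Fin N) → ℂ)
    (x : EuclideanSpace ℝ (Fin N)) : ENNReal :=
  ∑' i : Σ n : ℕ, Fin (n + 1) → Fin N,
    ENNReal.ofReal (h ^ (i.1 + 1) / (i.1 + 1).factorial) *
      ‖ft (fun ξ ↦ wordMonomial i.2 ξ * ψ ξ) x‖ₑ

lemma IsBand.measurable_taylorMajorant {R h : ℝ} {ψ : EuclideanSpace ℝ (Fin N) → ℂ}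
    (hψ : IsBand R ψ) : Measurable (taylorMajorant h ψ) :=
  Measurable.tsum fun i ↦
    ((hψ.mul (contDiff_wordMonomial i.2)).continuous_ft.measurable.enorm).const_mul _

/-- Bernstein's inequality `‖∂ʷ G‖₂ ≤ R^{|w|} ‖G‖₂`, summed over the Taylor series. -/
lemma IsBand.lintegral_taylorMajorant_sq_le {R h : ℝ} (hR : 0 ≤ R) (hh : 0 ≤ h)
    {ψ : EuclideanSpace ℝ (Fin N) → ℂ} (hψ : IsBand R ψ) :
    ∫⁻ x, taylorMajorant h ψ x ^ 2 ≤ ENNReal.ofReal (Real.exp (N * h * R) - 1) ^ 2 * energy ψ := by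
  have hle := lintegral_tsum_sq_le (μ := volume)
    (f := fun (i : Σ n : ℕ, Fin (n + 1) → Fin N) (x : EuclideanSpace ℝ (Fin N)) ↦
      ENNReal.ofReal (h ^ (i.1 + 1) / (i.1 + 1).factorial) *
        ‖ft (fun ξ ↦ wordMonomial i.2 ξ * ψ ξ) x‖ₑ)
    (B := fun i ↦ ENNReal.ofReal ((h * R) ^ (i.1 + 1) / (i.1 + 1).factorial) *
      energy ψ ^ (1 / 2 : ℝ))
    (fun i ↦ ((hψ.mul (contDiff_wordMonomial i.2)).continuous_ft.measurable.enorm).const_mul _)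
    (fun i ↦ by
      have hm := (hψ.mul (contDiff_wordMonomial i.2)).continuous_ft.measurable
      have h1 : ENNReal.ofReal ((h * R) ^ (i.1 + 1) / (i.1 + 1).factorial) =
          ENNReal.ofReal (h ^ (i.1 + 1) / (i.1 + 1).factorial) *
            ENNReal.ofReal (R ^ (i.1 + 1)) := by
        rw [← ENNReal.ofReal_mul (by positivity)]; congr 1; rw [mul_pow]; ring
      have h2 : (energy ψ ^ (1 / 2 : ℝ)) ^ 2 = energy ψ := by
        rw [← ENNReal.rpow_two, ← ENNReal.rpow_mul]; norm_num
      rw [mul_pow, h2, h1, mul_pow, mul_assoc]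
      simp_rw [mul_pow]
      rw [lintegral_const_mul _ (by fun_prop)]
      gcongr
      exact hψ.energy_mul_le (contDiff_wordMonomial i.2) fun ξ hξ ↦ norm_wordMonomial_le _ hξ)
  refine hle.trans (le_of_eq ?_)
  rw [ENNReal.tsum_mul_right, mul_pow, ← ENNReal.rpow_two (energy ψ ^ _), ← ENNReal.rpow_mul]
  norm_num
  congr 2
  rw [ENNReal.tsum_sigma']
  have hsum : HasSum (fun n : ℕ ↦ (N * h * R) ^ (n + 1) / (n + 1).factorial)
      (Real.exp (N * h * R) - 1) := by
    have := NormedSpace.exp_series_hasSum_exp' (𝕂 := ℝ) (N * h * R : ℝ)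
    have h3 := (hasSum_nat_add_iff' 1).2 this
    rw [← Real.exp_eq_exp_ℝ] at h3
    simpa [div_eq_inv_mul] using h3
  rw [← hsum.tsum_eq, ENNReal.ofReal_tsum_of_nonneg (fun n ↦ by positivity) hsum.summable]
  congr 1 with n
  rw [tsum_fintype]
  dsimp only
  rw [Finset.sum_const, Finset.card_univ, Fintype.card_fun, Fintype.card_fin,
    Fintype.card_fin, nsmul_eq_mul, Nat.cast_pow, ← ENNReal.ofReal_natCast,
    ← ENNReal.ofReal_pow (by positivity), ← ENNReal.ofReal_mul (by positivity)]
  congr 1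
  simp only [mul_pow]
  ring

/-- The oscillation of `ft ψ` over a cube is bounded by a quantity at the centre `x` alone: expand
`e^{i⟨y-x,ξ⟩}` under the integral. -/
lemma IsBand.enorm_ft_sub_le {R h : ℝ} {ψ : EuclideanSpace ℝ (Fin N) → ℂ} (hψ : IsBand R ψ)
    {x y : EuclideanSpace ℝ (Fin N)} (hxy : y ∈ cube x h) :
    ‖ft ψ y - ft ψ x‖ₑ ≤ taylorMajorant h ψ x := by
  set d := y - x with hd
  set s : EuclideanSpace ℝ (Fin N) → ℂ := fun ξ ↦ ((inner ℝ d ξ : ℝ) : ℂ) with hs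
  have hband (n : ℕ) (w : Fin n → Fin N) := hψ.mul (contDiff_wordMonomial w)
  set Fn : ℕ → EuclideanSpace ℝ (Fin N) → ℂ := fun n ξ ↦
    Complex.exp (Complex.I * (inner ℝ x ξ : ℝ)) *
      ((Complex.I ^ n / n.factorial) * (s ξ ^ n * ψ ξ)) with hFn
  have hscont : ContDiff ℝ ∞ s :=
    Complex.ofRealCLM.contDiff.comp (contDiff_const.inner ℝ contDiff_id)
  have hint (n : ℕ) : Integrable (Fn n) :=
    integrable_expInner_mul ((hψ.mul (hscont.pow n)).integrable.const_mul _) x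
  obtain ⟨M, hM⟩ : ∃ M, ∀ ξ ∈ cube 0 R, ‖s ξ‖ ≤ M :=
    (isCompact_cube 0 R).exists_bound_of_continuousOn hscont.continuous.continuousOn
  have hbound (n : ℕ) (ξ) : ‖Fn n ξ‖ ≤ |M| ^ n / n.factorial * ‖ψ ξ‖ := by
    simp only [hFn, norm_mul, norm_exp_I_mul_ofReal, one_mul, norm_div, norm_pow, Complex.norm_I,
      one_pow, Complex.norm_natCast]
    by_cases h0 : ψ ξ = 0
    · simp [h0]
    have := (hM ξ (hψ.supp ξ h0)).trans (le_abs_self M)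
    calc _ ≤ 1 / (n.factorial : ℝ) * (|M| ^ n * ‖ψ ξ‖) := by gcongr
      _ = _ := by ring
  have hsummable : Summable fun n ↦ ∫ ξ, ‖Fn n ξ‖ := by
    refine Summable.of_nonneg_of_le (fun n ↦ integral_nonneg fun _ ↦ norm_nonneg _)
      (f := fun n : ℕ ↦ |M| ^ n / n.factorial * ∫ ξ, ‖ψ ξ‖) (fun n ↦ ?_)
      ((Real.summable_pow_div_factorial _).mul_right _)
    rw [← integral_const_mul]
    exact integral_mono (hint n).norm (hψ.integrable.norm.const_mul _) (hbound n)
  have hsum := hasSum_integral_of_summable_integral_norm hint hsummable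
  have htot : ∫ ξ, ∑' n, Fn n ξ = ft ψ y := by
    unfold ft
    congr 1 with ξ
    have hexp : HasSum (fun n : ℕ ↦ Complex.I ^ n / n.factorial * s ξ ^ n)
        (Complex.exp (Complex.I * s ξ)) := by
      have := NormedSpace.exp_series_hasSum_exp' (𝕂 := ℂ) (Complex.I * s ξ)
      rw [← Complex.exp_eq_exp_ℂ] at this
      simpa [mul_pow, div_eq_inv_mul, mul_assoc] using this
    have h2 := (hexp.mul_right (ψ ξ)).mul_left (Complex.exp (Complex.I * (inner ℝ x ξ : ℝ)))
    have h3 : (fun n ↦ Fn n ξ) = fun n : ℕ ↦ Complex.exp (Complex.I * (inner ℝ x ξ : ℝ)) *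
        (Complex.I ^ n / n.factorial * s ξ ^ n * ψ ξ) := by
      ext n; simp only [hFn]; ring
    rw [h3, h2.tsum_eq, ← mul_assoc, ← Complex.exp_add]
    congr 2
    simp only [hs, hd, inner_sub_left, Complex.ofReal_sub]
    ring
  rw [htot] at hsum
  have h0 : ∫ ξ, Fn 0 ξ = ft ψ x := by simp [hFn, ft]
  have hsum' := (hasSum_nat_add_iff' 1).2 hsum
  simp only [Finset.sum_range_one, h0] at hsum'
  have hterm (n : ℕ) : ‖∫ ξ, Fn n ξ‖ₑ ≤ ∑ w : Fin n → Fin N,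
      ENNReal.ofReal (h ^ n / n.factorial) * ‖ft (fun ξ ↦ wordMonomial w ξ * ψ ξ) x‖ₑ := by
    have hrw : ∫ ξ, Fn n ξ = ∑ w : Fin n → Fin N, (Complex.I ^ n / n.factorial *
        ((∏ l, d (w l) : ℝ) : ℂ)) * ft (fun ξ ↦ wordMonomial w ξ * ψ ξ) x := by
      simp only [ft]
      simp_rw [← integral_const_mul]
      rw [← integral_finsetSum _ fun w _ ↦
        (integrable_expInner_mul (hband n w).integrable x).const_mul _]
      congr 1 with ξ
      simp only [hFn, hs]
      rw [inner_pow_eq_sum_words, Finset.sum_mul, Finset.mul_sum, Finset.mul_sum]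
      refine Finset.sum_congr rfl fun w _ ↦ ?_
      ring
    rw [hrw]
    refine (enorm_sum_le _ _).trans (Finset.sum_le_sum fun w _ ↦ ?_)
    rw [enorm_mul]
    gcongr
    rw [← ofReal_norm]
    refine ENNReal.ofReal_le_ofReal ?_
    rw [norm_mul, norm_div, norm_pow, Complex.norm_I, one_pow, Complex.norm_natCast,
      Complex.norm_real, Real.norm_eq_abs, Finset.abs_prod]
    have : ∏ l, |d (w l)| ≤ h ^ n := by
      calc _ ≤ ∏ _l : Fin n, h := Finset.prod_le_prod (fun _ _ ↦ abs_nonneg _)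
            fun l _ ↦ hxy (w l)
        _ = h ^ n := by simp
    calc _ ≤ 1 / (n.factorial : ℝ) * h ^ n := by gcongr
      _ = _ := by ring
  calc ‖ft ψ y - ft ψ x‖ₑ = ‖∑' n, ∫ ξ, Fn (n + 1) ξ‖ₑ := by rw [hsum'.tsum_eq]
    _ ≤ ∑' n, ‖∫ ξ, Fn (n + 1) ξ‖ₑ := enorm_tsum_le_tsum_enorm
    _ ≤ ∑' n, ∑ w : Fin (n + 1) → Fin N, ENNReal.ofReal (h ^ (n + 1) / (n + 1).factorial) *
        ‖ft (fun ξ ↦ wordMonomial w ξ * ψ ξ) x‖ₑ := ENNReal.tsum_le_tsum fun n ↦ hterm (n + 1)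
    _ = taylorMajorant h ψ x := by
      rw [taylorMajorant, ENNReal.tsum_sigma']
      congr 1 with n
      rw [tsum_fintype]

/-! ### Band-limited functions do not concentrate on balls -/

lemma ennreal_add_sq_le (x y : ENNReal) {κ : ℝ} (hκ : 0 < κ) :
    (x + y) ^ 2 ≤ ENNReal.ofReal (1 + κ⁻¹) * x ^ 2 + ENNReal.ofReal (1 + κ) * y ^ 2 := by
  have h1 : ENNReal.ofReal (1 + κ⁻¹) ≠ 0 := by simp; positivity
  have h2 : ENNReal.ofReal (1 + κ) ≠ 0 := by simp; positivity
  rcases eq_or_ne x ⊤ with rfl | hx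
  · simp [ENNReal.mul_top h1]
  rcases eq_or_ne y ⊤ with rfl | hy
  · simp [ENNReal.mul_top h2]
  rw [← ENNReal.ofReal_toReal hx, ← ENNReal.ofReal_toReal hy]
  set a := x.toReal with ha
  set b := y.toReal with hb
  have ha0 : 0 ≤ a := ENNReal.toReal_nonneg
  have hb0 : 0 ≤ b := ENNReal.toReal_nonneg
  rw [← ENNReal.ofReal_add ha0 hb0, ← ENNReal.ofReal_pow (by positivity),
    ← ENNReal.ofReal_pow ha0, ← ENNReal.ofReal_pow hb0, ← ENNReal.ofReal_mul (by positivity),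
    ← ENNReal.ofReal_mul (by positivity), ← ENNReal.ofReal_add (by positivity) (by positivity)]
  refine ENNReal.ofReal_le_ofReal ?_
  have : 0 ≤ κ⁻¹ * (a - κ * b) ^ 2 := by positivity
  have h3 : κ⁻¹ * (a - κ * b) ^ 2 = κ⁻¹ * a ^ 2 - 2 * a * b + κ * b ^ 2 := by
    field_simp; ring
  nlinarith

lemma ennreal_add_sq_le_two (x y : ENNReal) : (x + y) ^ 2 ≤ 2 * x ^ 2 + 2 * y ^ 2 := by
  have := ennreal_add_sq_le x y one_pos
  norm_num at this
  exact this

/-- Absorption of a finite quantity. -/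
lemma ennreal_le_of_le_mul_self_add {e b : ENNReal} (he : e ≠ ⊤) {θ : ℝ} (hθ0 : 0 ≤ θ)
    (hθ : θ < 1) (h : e ≤ ENNReal.ofReal θ * e + b) : e ≤ ENNReal.ofReal (1 - θ)⁻¹ * b := by
  rcases eq_or_ne b ⊤ with rfl | hb
  · rw [ENNReal.mul_top (by simp; linarith)]; exact le_top
  rw [← ENNReal.ofReal_toReal he, ← ENNReal.ofReal_toReal hb] at h ⊢
  rw [← ENNReal.ofReal_mul hθ0, ← ENNReal.ofReal_add (by positivity) (by positivity),
    ENNReal.ofReal_le_ofReal_iff (by positivity)] at h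
  rw [← ENNReal.ofReal_mul (by rw [inv_nonneg]; linarith)]
  refine ENNReal.ofReal_le_ofReal ?_
  rw [inv_mul_eq_div, le_div_iff₀ (by linarith)]
  linarith

/-- The energy of `ft ψ` on the half-space `{x | s < x j}`. -/
noncomputable def halfEnergy (j : Fin N) (s : ℝ) (ψ : EuclideanSpace ℝ (Fin N) → ℂ) : ENNReal :=
  ∫⁻ x in {x | s < x j}, ‖ft ψ x‖ₑ ^ 2

lemma measurableSet_halfSpace (j : Fin N) (s : ℝ) :
    MeasurableSet {x : EuclideanSpace ℝ (Fin N) | s < x j} :=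
  measurableSet_lt measurable_const (by fun_prop)

lemma lintegral_halfSpace_shift (j : Fin N) (s η : ℝ) (f : EuclideanSpace ℝ (Fin N) → ENNReal) :
    ∫⁻ x in {x | s < x j}, f (x + EuclideanSpace.single j η) =
      ∫⁻ x in {x | s + η < x j}, f x := by
  rw [← lintegral_indicator (measurableSet_halfSpace j s),
    ← lintegral_indicator (measurableSet_halfSpace j (s + η)),
    ← lintegral_add_right_eq_self (Set.indicator {x | s + η < x j} f) (EuclideanSpace.single j η)]
  congr 1 with x
  simp [Set.indicator]

/-- The symbol of the difference operator `G ↦ G - G(· + η eⱼ)`. -/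
noncomputable def diffSymbol (j : Fin N) (η : ℝ) (ξ : EuclideanSpace ℝ (Fin N)) : ℂ :=
  1 - Complex.exp (Complex.I * (inner ℝ (EuclideanSpace.single j η) ξ : ℝ))

lemma contDiff_diffSymbol (j : Fin N) (η : ℝ) : ContDiff ℝ ∞ (diffSymbol j η) :=
  contDiff_const.sub (contDiff_expInner _)

lemma norm_diffSymbol_le (j : Fin N) {η R : ℝ} (hη : 0 ≤ η) (hηR : η * R ≤ 1 / 4)
    {ξ : EuclideanSpace ℝ (Fin N)} (hξ : ξ ∈ cube 0 R) : ‖diffSymbol j η ξ‖ ≤ 1 / 4 := by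
  rw [diffSymbol, norm_sub_rev]
  refine (Real.norm_exp_I_mul_ofReal_sub_one_le (x := _)).trans ?_
  have : (inner ℝ (EuclideanSpace.single j η) ξ : ℝ) = η * ξ j := by
    simp [EuclideanSpace.inner_single_left]
  rw [this, Real.norm_eq_abs, abs_mul, abs_of_nonneg hη]
  exact (mul_le_mul_of_nonneg_left (mem_cube_zero.1 hξ j) hη).trans hηR

lemma IsBand.ft_diffSymbol_mul {R : ℝ} {ψ : EuclideanSpace ℝ (Fin N) → ℂ} (hψ : IsBand R ψ)
    (j : Fin N) (η : ℝ) (x : EuclideanSpace ℝ (Fin N)) :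
    ft (fun ξ ↦ diffSymbol j η ξ * ψ ξ) x = ft ψ x - ft ψ (x + EuclideanSpace.single j η) := by
  rw [ft, ft, ft, ← integral_sub (integrable_expInner_mul hψ.integrable _)
    (integrable_expInner_mul hψ.integrable _)]
  congr 1 with ξ
  rw [diffSymbol, inner_add_left, Complex.ofReal_add, mul_add, Complex.exp_add]
  ring

/-- On a half-space, the energy is controlled by the energy on a slightly smaller half-space, up
to an arbitrarily small fraction of the total: a high power of the difference operator is tiny on
band-limited functions. -/
lemma exists_halfEnergy_le_shift (j : Fin N) {η R : ℝ} (hη : 0 ≤ η) (hηR : η * R ≤ 1 / 4) (n : ℕ) :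
    ∃ C : ℝ≥0, ∀ ψ, IsBand R ψ → ∀ s,
      halfEnergy j s ψ ≤ (8⁻¹ : ℝ≥0) ^ n * energy ψ + C * halfEnergy j (s + η) ψ := by
  induction n with
  | zero =>
    refine ⟨0, fun ψ _ s ↦ ?_⟩
    simpa using! setLIntegral_le_lintegral _ _
  | succ n ih =>
    obtain ⟨C, hC⟩ := ih
    refine ⟨8 * C + 2, fun ψ hψ s ↦ ?_⟩
    set ψ' := fun ξ ↦ diffSymbol j η ξ * ψ ξ with hψ'
    have hb' : IsBand R ψ' := hψ.mul (contDiff_diffSymbol j η)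
    have hft := hψ.ft_diffSymbol_mul j η
    have hm := hψ.continuous_ft.measurable
    have hm' := hb'.continuous_ft.measurable
    have h1 : halfEnergy j s ψ ≤ 2 * halfEnergy j s ψ' + 2 * halfEnergy j (s + η) ψ := by
      rw [halfEnergy, halfEnergy, halfEnergy,
        ← lintegral_halfSpace_shift j s η fun x ↦ ‖ft ψ x‖ₑ ^ 2,
        ← lintegral_const_mul _ (by fun_prop), ← lintegral_const_mul _ (by fun_prop),
        ← lintegral_add_left (by fun_prop)]
      refine lintegral_mono fun x ↦ ?_
      have : ft ψ x = ft ψ' x + ft ψ (x + EuclideanSpace.single j η) := by rw [hft]; ring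
      rw [this]
      exact (pow_le_pow_left' (enorm_add_le _ _) 2).trans (ennreal_add_sq_le_two _ _)
    have h2 : halfEnergy j (s + η) ψ' ≤ 4 * halfEnergy j (s + η) ψ := by
      have h3 : halfEnergy j (s + η) ψ' ≤
          2 * halfEnergy j (s + η) ψ + 2 * halfEnergy j (s + η + η) ψ := by
        rw [halfEnergy, halfEnergy, halfEnergy,
          ← lintegral_halfSpace_shift j (s + η) η fun x ↦ ‖ft ψ x‖ₑ ^ 2,
          ← lintegral_const_mul _ (by fun_prop), ← lintegral_const_mul _ (by fun_prop),
          ← lintegral_add_left (by fun_prop)]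
        refine lintegral_mono fun x ↦ ?_
        rw [hft]
        exact (pow_le_pow_left' enorm_sub_le 2).trans (ennreal_add_sq_le_two _ _)
      have h4 : halfEnergy j (s + η + η) ψ ≤ halfEnergy j (s + η) ψ :=
        lintegral_mono_set fun x (hx : s + η + η < x j) ↦ (by
          show s + η < x j
          linarith)
      calc _ ≤ 2 * halfEnergy j (s + η) ψ + 2 * halfEnergy j (s + η) ψ := h3.trans (by gcongr)
        _ = _ := by rw [← add_mul]; norm_num
    have h5 : energy ψ' ≤ (16⁻¹ : ℝ≥0) * energy ψ := by
      have := hψ.energy_mul_le (contDiff_diffSymbol j η) (c := 1 / 4)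
        fun ξ hξ ↦ norm_diffSymbol_le j hη hηR hξ
      refine this.trans (le_of_eq ?_)
      congr 1
      rw [← ENNReal.ofReal_pow (by norm_num), ENNReal.ofReal, ENNReal.coe_inj]
      ext; norm_num
    calc halfEnergy j s ψ ≤ 2 * halfEnergy j s ψ' + 2 * halfEnergy j (s + η) ψ := h1
      _ ≤ 2 * ((8⁻¹ : ℝ≥0) ^ n * ((16⁻¹ : ℝ≥0) * energy ψ) + C * (4 * halfEnergy j (s + η) ψ)) +
          2 * halfEnergy j (s + η) ψ := by
        gcongr
        exact (hC ψ' hb' s).trans (by gcongr)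
      _ = ((2 * 8⁻¹ ^ n * 16⁻¹ : ℝ≥0) : ENNReal) * energy ψ +
          ((2 * C * 4 + 2 : ℝ≥0) : ENNReal) * halfEnergy j (s + η) ψ := by
        push_cast; ring
      _ = _ := by
        have e1 : (2 * 8⁻¹ ^ n * 16⁻¹ : ℝ≥0) = 8⁻¹ ^ (n + 1) := by
          rw [pow_succ]; ext; push_cast; ring
        have e2 : (2 * C * 4 + 2 : ℝ≥0) = 8 * C + 2 := by ring
        rw [e1, e2, ENNReal.coe_pow]

/-- Iterating the shift moves the half-space arbitrarily far; the constant may depend on `ε`. -/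
lemma exists_halfEnergy_le_add (j : Fin N) {η R : ℝ} (hη : 0 ≤ η) (hηR : η * R ≤ 1 / 4) (J : ℕ) :
    ∀ ε : ℝ≥0, 0 < ε → ∃ C : ℝ≥0, ∀ ψ, IsBand R ψ → ∀ s,
      halfEnergy j s ψ ≤ ε * energy ψ + C * halfEnergy j (s + J * η) ψ := by
  induction J with
  | zero => exact fun ε _ ↦ ⟨1, fun ψ _ s ↦ by simp⟩
  | succ J ih =>
    intro ε hε
    obtain ⟨C, hC⟩ := ih (ε / 2) (by positivity)
    obtain ⟨n, hn⟩ : ∃ n : ℕ, C * (8⁻¹ : ℝ≥0) ^ n ≤ ε / 2 := by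
      obtain ⟨n, hn⟩ := exists_pow_lt_of_lt_one (show (0 : ℝ≥0) < ε / 2 / (C + 1) by positivity)
        (show (8⁻¹ : ℝ≥0) < 1 by
          rw [← NNReal.coe_lt_coe]; push_cast; norm_num)
      refine ⟨n, ?_⟩
      calc C * (8⁻¹ : ℝ≥0) ^ n ≤ (C + 1) * (ε / 2 / (C + 1)) := by
            gcongr; exact le_self_add
        _ = ε / 2 := by field_simp
    obtain ⟨C', hC'⟩ := exists_halfEnergy_le_shift j hη hηR n
    refine ⟨C * C', fun ψ hψ s ↦ ?_⟩
    have h1 := hC' ψ hψ (s + J * η)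
    have h2 : s + J * η + η = s + (J + 1 : ℕ) * η := by push_cast; ring
    rw [h2] at h1
    calc _ ≤ _ := hC ψ hψ s
      _ ≤ ((ε / 2 : ℝ≥0) : ENNReal) * energy ψ + C * ((8⁻¹ : ℝ≥0) ^ n * energy ψ +
          C' * halfEnergy j (s + (J + 1 : ℕ) * η) ψ) := by gcongr
      _ = ((ε / 2 + C * 8⁻¹ ^ n : ℝ≥0) : ENNReal) * energy ψ +
          ((C * C' : ℝ≥0) : ENNReal) * halfEnergy j (s + (J + 1 : ℕ) * η) ψ := by
        push_cast; ring
      _ ≤ _ := by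
        gcongr
        calc _ ≤ ε / 2 + ε / 2 := by gcongr
          _ = ε := add_halves ε

/-- The energy of a band-limited function is controlled by its energy outside a given ball. -/
lemma exists_energy_le_outside_ball (j : Fin N) {R : ℝ} (hR : 0 < R) (K : ℝ) :
    ∃ C : ℝ≥0, ∀ ψ : EuclideanSpace ℝ (Fin N) → ℂ, IsBand R ψ →
      energy ψ ≤ C * ∫⁻ x in {x | K < ‖x‖}, ‖ft ψ x‖ₑ ^ 2 := by
  set η := 1 / (4 * R) with hη
  have hη0 : 0 < η := by positivity
  have hηR : η * R ≤ 1 / 4 := by rw [hη]; apply le_of_eq; field_simp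
  obtain ⟨J, hJ⟩ := exists_nat_ge ((2 * K + 1) / η)
  obtain ⟨C, hC⟩ := exists_halfEnergy_le_add j hη0.le hηR J 2⁻¹ (by norm_num)
  refine ⟨2 * (C + 1), fun ψ hψ ↦ ?_⟩
  set B := ∫⁻ x in {x | K < ‖x‖}, ‖ft ψ x‖ₑ ^ 2 with hB
  have hmeas : MeasurableSet {x : EuclideanSpace ℝ (Fin N) | K < ‖x‖} :=
    measurableSet_lt measurable_const measurable_norm
  have h1 : ∫⁻ x in {x | K < ‖x‖}ᶜ, ‖ft ψ x‖ₑ ^ 2 ≤ halfEnergy j (-K - 1) ψ := by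
    refine lintegral_mono_set fun x hx ↦ ?_
    have hx' : ‖x‖ ≤ K := not_lt.1 hx
    have := (abs_le.1 ((PiLp.norm_apply_le x j).trans hx')).1
    show -K - 1 < x j
    linarith
  have h2 : halfEnergy j (-K - 1 + J * η) ψ ≤ B := by
    refine lintegral_mono_set fun x (hx : _ < x j) ↦ ?_
    rw [div_le_iff₀ hη0] at hJ
    show K < ‖x‖
    have := (le_abs_self _).trans (PiLp.norm_apply_le x j)
    linarith
  have h3 : energy ψ = B + ∫⁻ x in {x | K < ‖x‖}ᶜ, ‖ft ψ x‖ₑ ^ 2 :=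
    (lintegral_add_compl _ hmeas).symm
  have h4 : energy ψ ≤ ENNReal.ofReal 2⁻¹ * energy ψ + (C + 1) * B := by
    calc energy ψ = B + ∫⁻ x in {x | K < ‖x‖}ᶜ, ‖ft ψ x‖ₑ ^ 2 := h3
      _ ≤ B + ((2⁻¹ : ℝ≥0) * energy ψ + C * B) := by
        gcongr
        exact h1.trans ((hC ψ hψ _).trans (by gcongr))
      _ = _ := by
        have : ENNReal.ofReal 2⁻¹ = ((2⁻¹ : ℝ≥0) : ENNReal) := by
          rw [ENNReal.ofReal, ENNReal.coe_inj]; ext; norm_num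
        rw [this]; ring
  have h5 := ennreal_le_of_le_mul_self_add hψ.energy_ne_top (by norm_num) (by norm_num) h4
  norm_num at h5
  push_cast
  rw [mul_assoc]
  exact h5

/-! ### A high-pass multiplier with small band -/

/-- The bump function from which `density` is obtained by normalisation. -/
noncomputable def bump (N : ℕ) : ContDiffBump (0 : EuclideanSpace ℝ (Fin N)) :=
  ⟨1 / 2, 1, by norm_num, by norm_num⟩

/-- A smooth even probability density on `ℝ^N`, supported in the closed unit ball. -/
noncomputable def density (ξ : EuclideanSpace ℝ (Fin N)) : ℝ := (bump N).normed volume ξ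

lemma contDiff_density : ContDiff ℝ ∞ (density (N := N)) := (bump N).contDiff_normed

lemma density_nonneg (ξ : EuclideanSpace ℝ (Fin N)) : 0 ≤ density ξ := (bump N).nonneg_normed ξ

lemma hasCompactSupport_density : HasCompactSupport (density (N := N)) :=
  (bump N).hasCompactSupport_normed

lemma integrable_density : Integrable (density (N := N)) := (bump N).integrable_normed

lemma integral_density : ∫ ξ, density (N := N) ξ = 1 := (bump N).integral_normed

lemma density_ne_zero_iff (ξ : EuclideanSpace ℝ (Fin N)) : density ξ ≠ 0 ↔ ‖ξ‖ < 1 := by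
  have := (bump N).support_normed_eq (μ := volume)
  have h := Set.ext_iff.1 this ξ
  simpa [bump, density] using h

/-- `∫ (1 - cos⟨y,ξ⟩) χ(ξ) dξ`, which is `1 - ft χ y` for the bump density `χ`. -/
noncomputable def osc (y : EuclideanSpace ℝ (Fin N)) : ℝ :=
  ∫ ξ, (1 - Real.cos (inner ℝ y ξ)) * density ξ

lemma integrable_osc (y : EuclideanSpace ℝ (Fin N)) :
    Integrable fun ξ ↦ (1 - Real.cos (inner ℝ y ξ)) * density ξ := by
  refine integrable_density.bdd_mul (c := 2) (by fun_prop) (Filter.Eventually.of_forall fun ξ ↦ ?_)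
  rw [Real.norm_eq_abs, abs_le]
  constructor <;> linarith [Real.cos_le_one (inner ℝ y ξ), Real.neg_one_le_cos (inner ℝ y ξ)]

lemma isBand_density : IsBand 1 (fun ξ : EuclideanSpace ℝ (Fin N) ↦ (density ξ : ℂ)) :=
  ⟨Complex.ofRealCLM.contDiff.comp contDiff_density, fun ξ h ↦ mem_cube_zero.2 fun j ↦
    (PiLp.norm_apply_le ξ j).trans ((density_ne_zero_iff ξ).1 (by simpa using h)).le⟩

lemma ft_density (y : EuclideanSpace ℝ (Fin N)) :
    ft (fun ξ ↦ (density ξ : ℂ)) y = 1 - osc y := by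
  have hint (y : EuclideanSpace ℝ (Fin N)) :=
    integrable_expInner_mul (ψ := fun ξ ↦ (density ξ : ℂ)) integrable_density.ofReal y
  have hneg : ft (fun ξ ↦ (density ξ : ℂ)) y = ft (fun ξ ↦ (density ξ : ℂ)) (-y) := by
    rw [ft, ← integral_neg_eq_self, ft]
    congr 1 with ξ
    rw [inner_neg_left, inner_neg_right, density, ContDiffBump.normed_neg, density]
  have h2 : 2 * ft (fun ξ ↦ (density ξ : ℂ)) y = 2 * (1 - osc y) := by
    nth_rw 1 [two_mul]
    nth_rw 2 [hneg]
    have hcos : 1 - osc y = ∫ ξ, Real.cos (inner ℝ y ξ) * density ξ := by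
      nth_rw 1 [osc, ← integral_density (N := N)]
      rw [← integral_sub integrable_density (integrable_osc y)]
      congr 1 with ξ
      ring
    rw [ft, ft, ← integral_add (hint _) (hint _), ← Complex.ofReal_one, ← Complex.ofReal_sub, hcos,
      ← integral_complex_ofReal, ← integral_const_mul]
    congr 1 with ξ
    rw [inner_neg_left]
    push_cast
    rw [← add_mul, ← mul_assoc, Complex.two_cos]
    ring_nf
  exact mul_left_cancel₀ two_ne_zero h2

lemma continuous_osc : Continuous (osc (N := N)) := by
  have h : osc (N := N) = fun y ↦ (1 - ft (fun ξ ↦ (density ξ : ℂ)) y).re := by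
    ext y; rw [ft_density]; simp
  rw [h]
  have := isBand_density (N := N).continuous_ft
  fun_prop

lemma osc_nonneg (y : EuclideanSpace ℝ (Fin N)) : 0 ≤ osc y :=
  integral_nonneg fun ξ ↦ mul_nonneg (by linarith [Real.cos_le_one (inner ℝ y ξ)])
    (density_nonneg ξ)

lemma osc_le_two (y : EuclideanSpace ℝ (Fin N)) : osc y ≤ 2 := by
  calc osc y ≤ ∫ ξ, 2 * density (N := N) ξ :=
        integral_mono (integrable_osc y) (integrable_density.const_mul 2) fun ξ ↦
          mul_le_mul_of_nonneg_right (by linarith [Real.neg_one_le_cos (inner ℝ y ξ)])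
            (density_nonneg ξ)
    _ = 2 := by rw [integral_const_mul, integral_density]; norm_num

lemma osc_le_sq (y : EuclideanSpace ℝ (Fin N)) : osc y ≤ ‖y‖ ^ 2 / 2 := by
  calc osc y ≤ ∫ ξ, ‖y‖ ^ 2 / 2 * density (N := N) ξ := by
        refine integral_mono (integrable_osc y) (integrable_density.const_mul _) fun ξ ↦ ?_
        by_cases h : density ξ = 0
        · simp [h]
        have h1 := ((density_ne_zero_iff ξ).1 h).le
        refine mul_le_mul_of_nonneg_right ?_ (density_nonneg ξ)
        have h2 := Real.one_sub_sq_div_two_le_cos (x := inner ℝ y ξ)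
        have h3 : |(inner ℝ y ξ : ℝ)| ≤ ‖y‖ := (abs_real_inner_le_norm y ξ).trans
          (by nlinarith [norm_nonneg y])
        have h4 := sq_le_sq' (by linarith [(abs_le.1 h3).1]) (abs_le.1 h3).2
        linarith
    _ = _ := by rw [integral_const_mul, integral_density, mul_one]

/-- From `1 - cos 2θ ≤ 4 (1 - cos θ)`. -/
lemma osc_two_smul_le (y : EuclideanSpace ℝ (Fin N)) : osc ((2 : ℝ) • y) ≤ 4 * osc y := by
  rw [osc, osc, ← integral_const_mul]
  refine integral_mono (integrable_osc _) ((integrable_osc y).const_mul _) fun ξ ↦ ?_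
  dsimp only
  rw [← mul_assoc]
  refine mul_le_mul_of_nonneg_right ?_ (density_nonneg ξ)
  rw [real_inner_smul_left, Real.cos_two_mul]
  nlinarith [sq_nonneg (1 - Real.cos (inner ℝ y ξ))]

lemma osc_pos {y : EuclideanSpace ℝ (Fin N)} (hy : y ≠ 0) : 0 < osc y := by
  have hy0 : 0 < ‖y‖ := norm_pos_iff.2 hy
  set δ : ℝ := (‖y‖ * (1 + ‖y‖))⁻¹ with hδ
  have hδ0 : 0 < δ := by positivity
  refine Continuous.integral_pos_of_hasCompactSupport_nonneg_nonzero (x := δ • y)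
    (Continuous.mul (by fun_prop) contDiff_density.continuous)
    hasCompactSupport_density.mul_left
    (fun ξ ↦ mul_nonneg (by linarith [Real.cos_le_one (inner ℝ y ξ)]) (density_nonneg ξ))
    (mul_ne_zero ?_ ?_)
  · rw [real_inner_smul_right, real_inner_self_eq_norm_sq]
    have h1 : δ * ‖y‖ ^ 2 = ‖y‖ / (1 + ‖y‖) := by rw [hδ]; field_simp
    have h2 : 0 < δ * ‖y‖ ^ 2 := by positivity
    have h3 : δ * ‖y‖ ^ 2 < 1 := by rw [h1, div_lt_one (by positivity)]; linarith
    intro h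
    have := (Real.cos_eq_one_iff_of_lt_of_lt (by linarith [Real.pi_gt_three])
      (by linarith [Real.pi_gt_three])).1 (by linarith : Real.cos (δ * ‖y‖ ^ 2) = 1)
    linarith
  · rw [density_ne_zero_iff, norm_smul, Real.norm_of_nonneg hδ0.le, hδ]
    rw [mul_inv, mul_assoc, mul_comm, mul_assoc, mul_inv_cancel₀ hy0.ne', mul_one]
    exact inv_lt_one_of_one_lt₀ (by linarith)

/-- By the Riemann–Lebesgue lemma and positivity, `osc` is bounded below away from the origin. -/
lemma exists_le_osc_of_one_le : ∃ c : ℝ, 0 < c ∧ c ≤ 1 ∧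
    ∀ y : EuclideanSpace ℝ (Fin N), 1 ≤ ‖y‖ → c ≤ osc y := by
  have hRL : Filter.Tendsto (fun y : EuclideanSpace ℝ (Fin N) ↦ ft (fun ξ ↦ (density ξ : ℂ)) y)
      (Filter.cocompact _) (nhds 0) := by
    have h1 := tendsto_integral_exp_inner_smul_cocompact
      (fun ξ : EuclideanSpace ℝ (Fin N) ↦ (density ξ : ℂ))
    have h2 : Filter.Tendsto (fun y : EuclideanSpace ℝ (Fin N) ↦ -(2 * Real.pi)⁻¹ • y)
        (Filter.cocompact _) (Filter.cocompact _) :=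
      (Homeomorph.smulOfNeZero (-(2 * Real.pi)⁻¹)
        (by simp [Real.pi_ne_zero])).isClosedEmbedding.tendsto_cocompact
    refine (h1.comp h2).congr fun y ↦ ?_
    rw [ft_eq_fourier, Function.comp, Real.fourier_eq]
  have hev := (Metric.tendsto_nhds.1 hRL) (1 / 2) (by norm_num)
  rw [Filter.eventually_iff, Filter.mem_cocompact] at hev
  obtain ⟨t, ht, hsub⟩ := hev
  have hcl : IsCompact (t ∩ {y | 1 ≤ ‖y‖}) :=
    ht.inter_right (isClosed_le continuous_const continuous_norm)
  have hfar (y : EuclideanSpace ℝ (Fin N)) (hy : y ∉ t) : 1 / 2 ≤ osc y := by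
    have h := hsub hy
    simp only [Set.mem_ofPred_eq, dist_zero_right, ft_density] at h
    rw [← Complex.ofReal_one, ← Complex.ofReal_sub, Complex.norm_real, Real.norm_eq_abs,
      abs_lt] at h
    linarith
  rcases (t ∩ {y | 1 ≤ ‖y‖}).eq_empty_or_nonempty with he | hne
  · refine ⟨1 / 2, by norm_num, by norm_num, fun y hy ↦ hfar y fun hyt ↦ ?_⟩
    exact (he ▸ (⟨hyt, hy⟩ : y ∈ t ∩ {y | 1 ≤ ‖y‖}) : y ∈ (∅ : Set _))
  · obtain ⟨y₀, hy₀, hmin⟩ := hcl.exists_isMinOn hne continuous_osc.continuousOn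
    have hpos : 0 < osc y₀ := osc_pos fun h ↦ by
      have := hy₀.2
      rw [h] at this
      simp at this
      linarith
    refine ⟨min (1 / 2) (osc y₀), by positivity, (min_le_left _ _).trans (by norm_num),
      fun y hy ↦ ?_⟩
    by_cases hyt : y ∈ t
    · exact (min_le_right _ _).trans (hmin ⟨hyt, hy⟩)
    · exact (min_le_left _ _).trans (hfar y hyt)

/-- The doubling inequality carries the lower bound for `1 ≤ ‖y‖` to small `y`, with
quadratic rate. -/
lemma exists_mul_min_le_osc : ∃ c : ℝ, 0 < c ∧
    ∀ y : EuclideanSpace ℝ (Fin N), c * min (‖y‖ ^ 2) 1 ≤ osc y := by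
  obtain ⟨c, hc, -, h⟩ := exists_le_osc_of_one_le (N := N)
  refine ⟨c / 4, by positivity, fun y ↦ ?_⟩
  rcases le_total 1 ‖y‖ with hy | hy
  · calc _ ≤ c / 4 * 1 := by gcongr; exact min_le_right _ _
      _ ≤ c := by linarith
      _ ≤ _ := h y hy
  · rcases eq_or_ne y 0 with rfl | hy0
    · simp [osc_nonneg]
    have hypos : 0 < ‖y‖ := norm_pos_iff.2 hy0
    obtain ⟨n, hn1, hn2⟩ := exists_nat_pow_near (one_le_inv_iff₀.2 ⟨hypos, hy⟩)
      (show (1 : ℝ) < 2 by norm_num)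
    have hiter (n : ℕ) : osc ((2 : ℝ) ^ n • y) ≤ 4 ^ n * osc y := by
      induction n with
      | zero => simp
      | succ n ih =>
        rw [pow_succ', mul_smul, pow_succ', mul_assoc]
        exact (osc_two_smul_le _).trans (by gcongr)
    have h1 : 1 ≤ ‖(2 : ℝ) ^ (n + 1) • y‖ := by
      rw [norm_smul, Real.norm_of_nonneg (by positivity)]
      calc 1 = ‖y‖⁻¹ * ‖y‖ := by field_simp
        _ ≤ _ := by gcongr
    have h2 := (h _ h1).trans (hiter (n + 1))
    have h3 : (2 : ℝ) ^ n * ‖y‖ ≤ 1 := by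
      calc _ ≤ ‖y‖⁻¹ * ‖y‖ := by gcongr
        _ = 1 := by field_simp
    have h4 : (4 : ℝ) ^ n * ‖y‖ ^ 2 ≤ 1 := by
      calc (4 : ℝ) ^ n * ‖y‖ ^ 2 = (2 ^ n * ‖y‖) ^ 2 := by
            rw [mul_pow, ← pow_mul, mul_comm n 2, pow_mul]; norm_num
        _ ≤ 1 := pow_le_one₀ (by positivity) h3
    have h5 : ‖y‖ ^ 2 * c ≤ 4 * osc y := by
      calc ‖y‖ ^ 2 * c ≤ ‖y‖ ^ 2 * (4 ^ (n + 1) * osc y) := by gcongr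
        _ = 4 * (4 ^ n * ‖y‖ ^ 2) * osc y := by ring
        _ ≤ 4 * 1 * osc y := by gcongr; exact osc_nonneg y
        _ = _ := by ring
    calc _ ≤ c / 4 * ‖y‖ ^ 2 := by gcongr; exact min_le_left _ _
      _ ≤ _ := by linarith

/-- Multiplication of a band-limited function by `x ↦ osc (b x)` enlarges the band by `b`. -/
lemma IsBand.exists_osc_mul {R b : ℝ} (hb : 0 < b) {ψ : EuclideanSpace ℝ (Fin N) → ℂ}
    (hψ : IsBand R ψ) : ∃ ψ', IsBand (R + b) ψ' ∧ ∀ x, ft ψ' x = osc (b • x) * ft ψ x := by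
  set χ : EuclideanSpace ℝ (Fin N) → ℂ := fun ξ ↦ ((b⁻¹ ^ N * density (b⁻¹ • ξ) : ℝ) : ℂ) with hχ
  have hχband : IsBand b χ := by
    constructor
    · refine Complex.ofRealCLM.contDiff.comp (contDiff_const.mul (contDiff_density.comp ?_))
      exact contDiff_const_smul b⁻¹
    · intro ξ h j
      have h1 : density (b⁻¹ • ξ) ≠ 0 := by
        intro h0; apply h; simp [hχ, h0]
      rw [density_ne_zero_iff, norm_smul, norm_inv, Real.norm_of_nonneg hb.le,
        inv_mul_lt_one₀ hb] at h1
      simpa using (PiLp.norm_apply_le ξ j).trans h1.le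
  have hχft (x : EuclideanSpace ℝ (Fin N)) : ft χ x = 1 - osc (b • x) := by
    rw [← ft_density, ft, ft]
    have := Measure.integral_comp_smul (volume : Measure (EuclideanSpace ℝ (Fin N)))
      (fun ξ ↦ Complex.exp (Complex.I * (inner ℝ (b • x) ξ : ℝ)) * (density ξ : ℂ)) b⁻¹
    rw [finrank_euclideanSpace_fin, ← inv_pow, inv_inv, abs_of_pos (by positivity)] at this
    rw [← inv_smul_eq_iff₀ (pow_ne_zero N hb.ne'), ← integral_smul] at this
    rw [← this]
    congr 1 with ξ
    rw [real_inner_smul_left, real_inner_smul_right, mul_inv_cancel_left₀ hb.ne', hχ,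
      Complex.real_smul]
    push_cast
    ring
  refine ⟨fun ξ ↦ ψ ξ - convolution χ ψ (ContinuousLinearMap.mul ℂ ℂ) volume ξ, ⟨?_, ?_⟩, ?_⟩
  · refine hψ.contDiff.sub ?_
    exact hχband.hasCompactSupport.contDiff_convolution_left (ContinuousLinearMap.mul ℝ ℂ) (n := ⊤)
      hχband.contDiff
      hψ.integrable.locallyIntegrable
  · intro ξ hξ
    by_cases h0 : ψ ξ = 0
    · have h1 : ξ ∈ Function.support (convolution χ ψ (ContinuousLinearMap.mul ℂ ℂ) volume) := by
        intro h; apply hξ; simp [h0, h]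
      obtain ⟨u, hu, v, hv, rfl⟩ := support_convolution_subset _ h1
      refine mem_cube_zero.2 fun j ↦ ?_
      have h2 := mem_cube_zero.1 (hχband.supp u hu) j
      have h3 := mem_cube_zero.1 (hψ.supp v hv) j
      simp only [PiLp.add_apply]
      linarith [abs_add_le (u j) (v j)]
    · exact (hψ.mono (by linarith)).supp ξ h0
  · intro x
    have h1 : ft (convolution χ ψ (ContinuousLinearMap.mul ℂ ℂ) volume) x = ft χ x * ft ψ x := by
      simp only [ft_eq_fourier]
      exact Real.fourier_mul_convolution_eq hχband.integrable hψ.integrable _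
    have h2 : osc (b • x) * ft ψ x = ft ψ x - ft χ x * ft ψ x := by rw [hχft]; ring
    rw [h2, ← h1, ft, ft, ft, ← integral_sub (integrable_expInner_mul hψ.integrable _)
      (integrable_expInner_mul (hχband.integrable.integrable_convolution _ hψ.integrable) _)]
    congr 1 with ξ
    ring

/-- High-pass multipliers: at most `1` on the ball of radius `K`, at least `2ᵐ` outside the ball of
radius `K₂`, bounded, and of arbitrarily small band `b`. The radius `K₂` does not depend on `m` and
`b`. -/
lemma exists_highPass {K : ℝ} (hK : 0 < K) : ∃ K₂ ≥ K, ∀ b > 0, ∀ m : ℕ,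
    ∃ (P : EuclideanSpace ℝ (Fin N) → ℝ) (A : ℝ), 0 ≤ A ∧ (∀ x, 0 ≤ P x ∧ P x ≤ A) ∧
      (∀ x, ‖x‖ ≤ K → P x ≤ 1) ∧ (∀ x, K₂ < ‖x‖ → 2 ^ m ≤ P x) ∧
      ∀ (R : ℝ) (ψ : EuclideanSpace ℝ (Fin N) → ℂ), IsBand R ψ →
        ∃ ψ', IsBand (R + b) ψ' ∧ ∀ x, ft ψ' x = P x * ft ψ x := by
  obtain ⟨c, hc, hosc⟩ := exists_mul_min_le_osc (N := N)
  -- the multiplier is `(a osc(β x))ᵐ`, where `β` is small enough for the band and `a` normalises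
  -- it to be at most `1` on the ball of radius `K`
  set κ := max 1 (1 / c) with hκ
  have hκ1 : 1 ≤ κ := le_max_left _ _
  have hκc : 1 ≤ c * κ := by
    calc 1 = c * (1 / c) := by field_simp
      _ ≤ _ := by gcongr; exact le_max_right _ _
  refine ⟨κ * K, by nlinarith, fun b hb m ↦ ?_⟩
  set β := min (b / (m + 1)) (1 / (κ * K)) with hβ
  have hβ0 : 0 < β := by positivity
  have hβκ : β * (κ * K) ≤ 1 := by
    calc _ ≤ 1 / (κ * K) * (κ * K) := by gcongr; exact min_le_right _ _
      _ = 1 := by field_simp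
  have hβb : m * β ≤ b := by
    calc m * β ≤ m * (b / (m + 1)) := by gcongr; exact min_le_left _ _
      _ ≤ b := by rw [mul_div_assoc', div_le_iff₀ (by positivity)]; nlinarith
  set a := 2 / (β * K) ^ 2 with ha
  have ha0 : 0 < a := by positivity
  have hS0 (x : EuclideanSpace ℝ (Fin N)) : 0 ≤ a * osc (β • x) := mul_nonneg ha0.le (osc_nonneg _)
  refine ⟨fun x ↦ (a * osc (β • x)) ^ m, (2 * a) ^ m, by positivity,
    fun x ↦ ⟨pow_nonneg (hS0 x) m, pow_le_pow_left₀ (hS0 x) ?_ m⟩, fun x hx ↦ ?_, fun x hx ↦ ?_,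
    fun R ψ hψ ↦ ?_⟩
  · nlinarith [osc_le_two (β • x)]
  · refine pow_le_one₀ (hS0 x) ?_
    calc a * osc (β • x) ≤ a * (‖β • x‖ ^ 2 / 2) := by gcongr; exact osc_le_sq _
      _ ≤ a * ((β * K) ^ 2 / 2) := by
        gcongr
        rw [norm_smul, Real.norm_of_nonneg hβ0.le]
        gcongr
      _ = 1 := by rw [ha]; field_simp
  · refine pow_le_pow_left₀ (by norm_num) ?_ m
    have h1 : (β * (κ * K)) ^ 2 ≤ min (‖β • x‖ ^ 2) 1 := by
      refine le_min ?_ (pow_le_one₀ (by positivity) hβκ)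
      rw [norm_smul, Real.norm_of_nonneg hβ0.le]
      gcongr
    calc 2 ≤ 2 * (c * κ) * κ := by nlinarith
      _ = a * (c * (β * (κ * K)) ^ 2) := by rw [ha]; field_simp
      _ ≤ a * (c * min (‖β • x‖ ^ 2) 1) := by gcongr
      _ ≤ a * osc (β • x) := by gcongr; exact hosc _
  · have hiter (m : ℕ) : ∃ ψ', IsBand (R + m * β) ψ' ∧
        ∀ x, ft ψ' x = ((a * osc (β • x)) ^ m : ℝ) * ft ψ x := by
      induction m with
      | zero => exact ⟨ψ, by simpa using hψ, fun x ↦ by simp⟩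
      | succ m ih =>
        obtain ⟨ψ₁, h1, h1'⟩ := ih
        obtain ⟨ψ₂, h2, h2'⟩ := h1.exists_osc_mul hβ0
        refine ⟨fun ξ ↦ (a : ℂ) * ψ₂ ξ, ?_, fun x ↦ ?_⟩
        · have := h2.mul (m := fun _ ↦ (a : ℂ)) contDiff_const
          convert this using 1
          push_cast; ring
        · have : ft (fun ξ ↦ (a : ℂ) * ψ₂ ξ) x = a * ft ψ₂ x := by
            simp only [ft]
            rw [← integral_const_mul]
            congr 1 with ξ
            ring
          rw [this, h2', h1']
          push_cast; ring
    obtain ⟨ψ', h1, h2⟩ := hiter m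
    exact ⟨ψ', h1.mono (by linarith), h2⟩

/-! ### The sampling inequality -/

/-- The mean of `‖G‖²` over the cube `C(x,h)` with respect to `F`. -/
noncomputable def sampleMean (F : Measure (EuclideanSpace ℝ (Fin N))) (h : ℝ)
    (G : EuclideanSpace ℝ (Fin N) → ℂ) (x : EuclideanSpace ℝ (Fin N)) : ENNReal :=
  (F (cube x h))⁻¹ * ∫⁻ y in cube x h, ‖G y‖ₑ ^ 2 ∂F

lemma IsBand.enorm_sq_le_sampleMean {R h : ℝ} {ψ : EuclideanSpace ℝ (Fin N) → ℂ}
    (hψ : IsBand R ψ) {F : Measure (EuclideanSpace ℝ (Fin N))} {x : EuclideanSpace ℝ (Fin N)}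
    (h0 : F (cube x h) ≠ 0) (h1 : F (cube x h) ≠ ⊤) {κ : ℝ} (hκ : 0 < κ) :
    ‖ft ψ x‖ₑ ^ 2 ≤ ENNReal.ofReal (1 + κ⁻¹) * sampleMean F h (ft ψ) x +
      ENNReal.ofReal (1 + κ) * taylorMajorant h ψ x ^ 2 := by
  have hm := hψ.continuous_ft.measurable
  have key : ‖ft ψ x‖ₑ ^ 2 * F (cube x h) ≤
      ENNReal.ofReal (1 + κ⁻¹) * ∫⁻ y in cube x h, ‖ft ψ y‖ₑ ^ 2 ∂F +
      ENNReal.ofReal (1 + κ) * taylorMajorant h ψ x ^ 2 * F (cube x h) := by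
    rw [← setLIntegral_const, ← setLIntegral_const, ← lintegral_const_mul _ (by fun_prop),
      ← lintegral_add_left (by fun_prop)]
    refine setLIntegral_mono' (measurableSet_cube x h) fun y hy ↦ ?_
    refine le_trans (pow_le_pow_left' ?_ 2) (ennreal_add_sq_le _ _ hκ)
    calc ‖ft ψ x‖ₑ = ‖ft ψ y - (ft ψ y - ft ψ x)‖ₑ := by rw [sub_sub_cancel]
      _ ≤ _ := enorm_sub_le.trans (by gcongr; exact hψ.enorm_ft_sub_le hy)
  calc ‖ft ψ x‖ₑ ^ 2 = (‖ft ψ x‖ₑ ^ 2 * F (cube x h)) * (F (cube x h))⁻¹ := by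
        rw [mul_assoc, ENNReal.mul_inv_cancel h0 h1, mul_one]
    _ ≤ _ := mul_le_mul_left key _
    _ = _ := by
      rw [add_mul, mul_assoc _ (F _), ENNReal.mul_inv_cancel h0 h1, mul_one, sampleMean]
      ring

/-- If every cube `C(x,h)` far from the origin has positive finite `F`-mass and
`R h N < log 2`, then the energy of a function with band `R` is controlled by its `F`-means over
these cubes. -/
theorem exists_energy_le_sampleMean (j : Fin N) {F : Measure (EuclideanSpace ℝ (Fin N))}
    {h R K : ℝ} (hh : 0 < h) (hR : 0 < R) (hK : 0 < K) (hRh : R * h * N < Real.log 2)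
    (hF : ∀ x : EuclideanSpace ℝ (Fin N), K < ‖x‖ → F (cube x h) ≠ 0 ∧ F (cube x h) ≠ ⊤) :
    ∃ C : ℝ≥0, ∀ ψ : EuclideanSpace ℝ (Fin N) → ℂ, IsBand R ψ →
      energy ψ ≤ C * ∫⁻ x in {x | K < ‖x‖}, sampleMean F h (ft ψ) x := by
  have hN : (0 : ℝ) < N := by exact_mod_cast j.pos
  -- the high-pass multiplier needs a slightly larger band `R'`
  obtain ⟨R', hRR', hR'⟩ : ∃ R' > R, R' * h * N < Real.log 2 := by
    refine ⟨(R + Real.log 2 / (h * N)) / 2, ?_, ?_⟩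
    · have : R < Real.log 2 / (h * N) := by rw [lt_div_iff₀ (by positivity)]; linarith
      show R < _
      linarith
    · have : (R + Real.log 2 / (h * N)) / 2 * h * N = (R * h * N + Real.log 2) / 2 := by
        field_simp
      rw [this]; linarith
  set q := Real.exp (N * h * R') - 1 with hq
  have hq0 : 0 ≤ q := by
    have : 0 ≤ N * h * R' := by have : 0 < R' := hR.trans hRR'; positivity
    linarith [Real.one_le_exp this]
  have hq1 : q < 1 := by
    have : Real.exp (N * h * R') < 2 := by
      rw [← Real.lt_log_iff_exp_lt (by norm_num)]
      linarith [mul_comm (R' * h) N, mul_comm R' h, mul_assoc (N : ℝ) h R']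
    linarith
  -- low frequencies will cost `ε`, the oscillation on cubes `(1 + κ) q²`; together they stay
  -- below `1` and are absorbed
  obtain ⟨κ, hκ0, ε, hε0, hθ⟩ : ∃ κ > 0, ∃ ε > 0, ε + (1 + κ) * q ^ 2 < 1 := by
    have : q ^ 2 < 1 := by nlinarith
    refine ⟨(1 - q ^ 2) / 4, by linarith, (1 - q ^ 2) / 4, by linarith, ?_⟩
    nlinarith
  obtain ⟨K₂, hK₂, hP⟩ := exists_highPass (N := N) hK
  obtain ⟨C₀, hC₀⟩ := exists_energy_le_outside_ball j hR K₂
  obtain ⟨m, hm⟩ : ∃ m : ℕ, C₀ * (1 / 4 : ℝ) ^ m ≤ ε := by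
    obtain ⟨m, hm⟩ := exists_pow_lt_of_lt_one (show 0 < ε / (C₀ + 1) by positivity)
      (show (1 / 4 : ℝ) < 1 by norm_num)
    refine ⟨m, ?_⟩
    calc C₀ * (1 / 4 : ℝ) ^ m ≤ (C₀ + 1) * (ε / (C₀ + 1)) := by gcongr; linarith
      _ = ε := by field_simp
  obtain ⟨P, A, hA, hPA, hPlow, hPhigh, hPmul⟩ := hP (R' - R) (by linarith) m
  set θ := ε + (1 + κ) * q ^ 2 with hθdef
  refine ⟨C₀ * ((1 - θ)⁻¹ * ((1 + κ⁻¹) * A ^ 2)).toNNReal, fun ψ hψ ↦ ?_⟩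
  obtain ⟨ψ', hψ', hft⟩ := hPmul R ψ hψ
  rw [add_sub_cancel] at hψ'
  have hmeasψ := hψ.continuous_ft.measurable
  have hmeasψ' := hψ'.continuous_ft.measurable
  have hmeas (r : ℝ) : MeasurableSet {x : EuclideanSpace ℝ (Fin N) | r < ‖x‖} :=
    measurableSet_lt measurable_const measurable_norm
  have hnorm (x) : ‖ft ψ' x‖ₑ ^ 2 = ENNReal.ofReal (P x ^ 2) * ‖ft ψ x‖ₑ ^ 2 := by
    rw [hft, enorm_mul, mul_pow, ENNReal.ofReal_pow (hPA x).1, ← ofReal_norm, Complex.norm_real,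
      Real.norm_of_nonneg (hPA x).1]
  -- outside the large ball the multiplier gains a factor `4ᵐ`
  have hout : energy ψ ≤ ENNReal.ofReal (C₀ * (1 / 4) ^ m) * energy ψ' := by
    have h1 : ∫⁻ x in {x | K₂ < ‖x‖}, ‖ft ψ x‖ₑ ^ 2 ≤ ENNReal.ofReal ((1 / 4) ^ m) * energy ψ' := by
      rw [energy, ← lintegral_const_mul _ (by fun_prop)]
      refine (setLIntegral_mono' (hmeas K₂) fun x hx ↦ ?_).trans (setLIntegral_le_lintegral _ _)
      rw [hnorm, ← mul_assoc, ← ENNReal.ofReal_mul (by positivity)]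
      refine le_mul_of_one_le_left (zero_le) ?_
      rw [ENNReal.one_le_ofReal]
      calc 1 = (1 / 4 : ℝ) ^ m * (2 ^ m) ^ 2 := by
            rw [← pow_mul, mul_comm m 2, pow_mul, ← mul_pow]; norm_num
        _ ≤ _ := by gcongr; exact hPhigh x hx
    calc _ ≤ _ := hC₀ ψ hψ
      _ ≤ C₀ * (ENNReal.ofReal ((1 / 4) ^ m) * energy ψ') := by gcongr
      _ = _ := by
        rw [← mul_assoc, ENNReal.ofReal_mul C₀.coe_nonneg, ENNReal.ofReal_coe_nnreal]
  have hlow : ∫⁻ x in {x | K < ‖x‖}ᶜ, ‖ft ψ' x‖ₑ ^ 2 ≤ ENNReal.ofReal ε * energy ψ' := by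
    calc _ ≤ ∫⁻ x in {x | K < ‖x‖}ᶜ, ‖ft ψ x‖ₑ ^ 2 := by
          refine setLIntegral_mono' (hmeas K).compl fun x hx ↦ ?_
          rw [hnorm]
          refine mul_le_of_le_one_left (zero_le) ?_
          rw [ENNReal.ofReal_le_one]
          exact pow_le_one₀ (hPA x).1 (hPlow x (not_lt.1 hx))
      _ ≤ energy ψ := setLIntegral_le_lintegral _ _
      _ ≤ _ := hout.trans (by gcongr)
  have hhigh : ∫⁻ x in {x | K < ‖x‖}, ‖ft ψ' x‖ₑ ^ 2 ≤
      ENNReal.ofReal ((1 + κ⁻¹) * A ^ 2) * (∫⁻ x in {x | K < ‖x‖}, sampleMean F h (ft ψ) x) +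
        ENNReal.ofReal ((1 + κ) * q ^ 2) * energy ψ' := by
    calc _ ≤ ∫⁻ x in {x | K < ‖x‖}, (ENNReal.ofReal ((1 + κ⁻¹) * A ^ 2) *
          sampleMean F h (ft ψ) x + ENNReal.ofReal (1 + κ) * taylorMajorant h ψ' x ^ 2) := by
          refine setLIntegral_mono' (hmeas K) fun x hx ↦ ?_
          refine (hψ'.enorm_sq_le_sampleMean (hF x hx).1 (hF x hx).2 hκ0).trans
            (add_le_add ?_ le_rfl)
          rw [ENNReal.ofReal_mul (by positivity), mul_assoc]
          gcongr
          rw [sampleMean, sampleMean, mul_left_comm,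
            ← lintegral_const_mul (ENNReal.ofReal (A ^ 2)) (by fun_prop)]
          gcongr with y
          rw [hnorm]
          gcongr
          · exact (hPA y).1
          · exact (hPA y).2
      _ = ENNReal.ofReal ((1 + κ⁻¹) * A ^ 2) * (∫⁻ x in {x | K < ‖x‖}, sampleMean F h (ft ψ) x) +
          ENNReal.ofReal (1 + κ) * ∫⁻ x in {x | K < ‖x‖}, taylorMajorant h ψ' x ^ 2 := by
        have hmt := hψ'.measurable_taylorMajorant (h := h)
        rw [lintegral_add_right _ (by fun_prop), lintegral_const_mul' _ _ ENNReal.ofReal_ne_top,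
          lintegral_const_mul' _ _ ENNReal.ofReal_ne_top]
      _ ≤ _ := by
        refine add_le_add le_rfl ?_
        rw [ENNReal.ofReal_mul (by positivity), mul_assoc, ENNReal.ofReal_pow hq0]
        gcongr
        exact (setLIntegral_le_lintegral _ _).trans
          (hψ'.lintegral_taylorMajorant_sq_le (hR.trans hRR').le hh.le)
  have htot : energy ψ' ≤ ENNReal.ofReal θ * energy ψ' +
      ENNReal.ofReal ((1 + κ⁻¹) * A ^ 2) * (∫⁻ x in {x | K < ‖x‖}, sampleMean F h (ft ψ) x) := by
    calc energy ψ' = (∫⁻ x in {x | K < ‖x‖}, ‖ft ψ' x‖ₑ ^ 2) +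
          ∫⁻ x in {x | K < ‖x‖}ᶜ, ‖ft ψ' x‖ₑ ^ 2 := (lintegral_add_compl _ (hmeas K)).symm
      _ ≤ _ := add_le_add hhigh hlow
      _ = _ := by
        rw [hθdef, ENNReal.ofReal_add hε0.le (by positivity)]
        ring
  have hfin := ennreal_le_of_le_mul_self_add hψ'.energy_ne_top (by positivity) hθ htot
  calc energy ψ ≤ ENNReal.ofReal (C₀ * (1 / 4) ^ m) * energy ψ' := hout
    _ ≤ C₀ * energy ψ' := by
      rw [← ENNReal.ofReal_coe_nnreal]
      gcongr
      exact mul_le_of_le_one_right C₀.coe_nonneg (pow_le_one₀ (by norm_num) (by norm_num))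
    _ ≤ _ := mul_le_mul' le_rfl hfin
    _ = _ := by
      rw [← mul_assoc, ← mul_assoc, ENNReal.coe_mul, mul_assoc (C₀ : ENNReal),
        ← ENNReal.ofReal_mul (by rw [inv_nonneg]; linarith)]
      rfl

/-! ### The anisotropic metric -/

lemma rho_nonneg (H : Fin N → ℝ) (s t : EuclideanSpace ℝ (Fin N)) : 0 ≤ rho H s t :=
  Finset.sum_nonneg fun _ _ ↦ Real.rpow_nonneg (abs_nonneg _) _

lemma rho_zero_left (H : Fin N → ℝ) (x : EuclideanSpace ℝ (Fin N)) :
    rho H 0 x = ∑ j, |x j| ^ H j := by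
  simp [rho]

lemma continuous_rho_zero {H : Fin N → ℝ} (hH : ∀ j, 0 < H j ∧ H j < 1) :
    Continuous fun x : EuclideanSpace ℝ (Fin N) ↦ rho H 0 x := by
  simp_rw [rho_zero_left]
  exact continuous_finsetSum _ fun j _ ↦
    Continuous.rpow_const (by fun_prop) fun x ↦ Or.inr (hH j).1.le

lemma homDim_nonneg {H : Fin N → ℝ} (hH : ∀ j, 0 < H j ∧ H j < 1) : 0 ≤ homDim H :=
  Finset.sum_nonneg fun j _ ↦ inv_nonneg.2 (hH j).1.le

lemma rpow_le_one_add {x p : ℝ} (hx : 0 ≤ x) (hp0 : 0 ≤ p) (hp : p ≤ 1) : x ^ p ≤ 1 + x := by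
  rcases le_total x 1 with h | h
  · linarith [Real.rpow_le_one hx h hp0]
  · calc x ^ p ≤ x ^ (1 : ℝ) := Real.rpow_le_rpow_of_exponent_le h hp
      _ ≤ 1 + x := by rw [Real.rpow_one]; linarith

lemma rho_zero_le {H : Fin N → ℝ} (hH : ∀ j, 0 < H j ∧ H j < 1) (x : EuclideanSpace ℝ (Fin N)) :
    rho H 0 x ≤ N * (1 + ‖x‖) := by
  rw [rho_zero_left]
  calc _ ≤ ∑ _j : Fin N, (1 + ‖x‖) := Finset.sum_le_sum fun j _ ↦
        (rpow_le_one_add (abs_nonneg _) (hH j).1.le (hH j).2.le).trans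
          (by gcongr; exact PiLp.norm_apply_le x j)
    _ = _ := by simp; ring

lemma norm_le_sum_abs (x : EuclideanSpace ℝ (Fin N)) : ‖x‖ ≤ ∑ j, |x j| := by
  rw [EuclideanSpace.norm_eq]
  refine Real.sqrt_le_iff.2 ⟨Finset.sum_nonneg fun _ _ ↦ abs_nonneg _, ?_⟩
  simp only [Real.norm_eq_abs]
  exact Finset.sum_sq_le_sq_sum_of_nonneg fun _ _ ↦ abs_nonneg _

lemma rho_zero_le_of_mem_cube {H : Fin N → ℝ} (hH : ∀ j, 0 < H j ∧ H j < 1) {h : ℝ} (hh : 0 ≤ h)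
    {x y : EuclideanSpace ℝ (Fin N)} (hy : y ∈ cube x h) :
    rho H 0 x ≤ rho H 0 y + N * (1 + h) := by
  rw [rho_zero_left, rho_zero_left]
  calc ∑ j, |x j| ^ H j ≤ ∑ j, (|y j| ^ H j + (1 + h)) := by
        refine Finset.sum_le_sum fun j _ ↦ ?_
        have h1 : |x j| ≤ |y j| + h := by
          have := hy j
          calc |x j| = |y j - (y j - x j)| := by rw [sub_sub_cancel]
            _ ≤ |y j| + |y j - x j| := abs_sub _ _
            _ ≤ _ := by gcongr
        calc |x j| ^ H j ≤ (|y j| + h) ^ H j := by gcongr; exact (hH j).1.le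
          _ ≤ |y j| ^ H j + h ^ H j :=
            Real.rpow_add_le_add_rpow (abs_nonneg _) hh (hH j).1.le (hH j).2.le
          _ ≤ _ := by gcongr; exact rpow_le_one_add hh (hH j).1.le (hH j).2.le
    _ = _ := by simp [Finset.sum_add_distrib]; ring

/-- Points of a cube with distant centre are away from the origin, in both metrics. -/
lemma one_le_rho_of_far {H : Fin N → ℝ} (hH : ∀ j, 0 < H j ∧ H j < 1) {h : ℝ}
    {x y : EuclideanSpace ℝ (Fin N)} (hx : N * (1 + h) < ‖x‖) (hy : y ∈ cube x h) :
    1 ≤ ‖y‖ ∧ 1 ≤ rho H 0 y := by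
  obtain ⟨j, hj⟩ : ∃ j, 1 ≤ |y j| := by
    by_contra! hcon
    have h1 : ‖x‖ ≤ N * (1 + h) := by
      calc ‖x‖ ≤ ∑ j, |x j| := norm_le_sum_abs x
        _ ≤ ∑ _j : Fin N, (1 + h) := by
          refine Finset.sum_le_sum fun j _ ↦ ?_
          calc |x j| = |y j - (y j - x j)| := by rw [sub_sub_cancel]
            _ ≤ |y j| + |y j - x j| := abs_sub _ _
            _ ≤ _ := add_le_add (hcon j).le (hy j)
        _ = _ := by simp; ring
    linarith
  refine ⟨hj.trans (PiLp.norm_apply_le y j), ?_⟩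
  rw [rho_zero_left]
  calc 1 ≤ |y j| ^ H j := Real.one_le_rpow hj (hH j).1.le
    _ ≤ _ := Finset.single_le_sum (f := fun j ↦ |y j| ^ H j)
      (fun _ _ ↦ Real.rpow_nonneg (abs_nonneg _) _) (Finset.mem_univ j)

/-! ### Two-sided bounds for the spectral measure of cubes -/

lemma SpectralCondition.exists_bounds {H : Fin N → ℝ} {F : Measure (EuclideanSpace ℝ (Fin N))}
    {h : ℝ} (hF : SpectralCondition H F h) : ∃ (K : ℝ) (c C : ℝ≥0), 0 < K ∧ 0 < c ∧
      ∀ x : EuclideanSpace ℝ (Fin N), K < ‖x‖ →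
        c ≤ ENNReal.ofReal (rho H 0 x ^ (homDim H + 2)) * F (cube x h) ∧
        ENNReal.ofReal (rho H 0 x ^ (homDim H + 2)) * F (cube x h) ≤ C := by
  obtain ⟨hF1, hF2⟩ := hF
  obtain ⟨c, hc0, hc⟩ := ENNReal.lt_iff_exists_nnreal_btwn.1 hF1
  obtain ⟨C, hC, -⟩ := ENNReal.lt_iff_exists_nnreal_btwn.1 hF2
  have h1 := (Filter.eventually_lt_of_lt_liminf hc).and (Filter.eventually_lt_of_limsup_lt hC)
  rw [Filter.eventually_comap] at h1
  obtain ⟨K, hK⟩ := Filter.eventually_atTop.1 h1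
  refine ⟨max K 1, c, C, by positivity, by exact_mod_cast hc0, fun x hx ↦ ?_⟩
  have := hK ‖x‖ ((le_max_left _ _).trans hx.le) x rfl
  exact ⟨this.1.le, this.2.le⟩

lemma IsSpectralMeasure.measure_one_le_norm_lt_top {Ω : Type*} [MeasurableSpace Ω]
    {X : EuclideanSpace ℝ (Fin N) → Ω → ℝ} {P : Measure Ω}
    {F : Measure (EuclideanSpace ℝ (Fin N))} (hF : IsSpectralMeasure X P F) :
    F {y | 1 ≤ ‖y‖} < ⊤ := by
  have h1 := meas_ge_le_lintegral_div (μ := F) (ε := ENNReal.ofReal (1 / 2))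
    (f := fun ξ ↦ ENNReal.ofReal (‖ξ‖ ^ 2 / (1 + ‖ξ‖ ^ 2))) (by fun_prop) (by simp)
    ENNReal.ofReal_ne_top
  refine lt_of_le_of_lt (measure_mono fun y (hy : 1 ≤ ‖y‖) ↦ ?_)
    (h1.trans_lt (ENNReal.div_lt_top hF.finite_integral.ne (by simp)))
  refine ENNReal.ofReal_le_ofReal ?_
  rw [div_le_div_iff₀ (by norm_num) (by positivity)]
  nlinarith

/-- Tonelli's theorem turns the integral of the means into a weighted integral against `F`. The set
`B` of finite measure is there because `F` need not be finite near the origin. -/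
lemma lintegral_sampleMean_le {F : Measure (EuclideanSpace ℝ (Fin N))} {h K : ℝ}
    {B : Set (EuclideanSpace ℝ (Fin N))} (hFB : F B < ⊤)
    {W : EuclideanSpace ℝ (Fin N) → ENNReal} (hWm : Measurable W)
    (hW : ∀ x : EuclideanSpace ℝ (Fin N), K < ‖x‖ → ∀ y ∈ cube x h,
      y ∈ B ∧ (F (cube x h))⁻¹ ≤ W y)
    {G : EuclideanSpace ℝ (Fin N) → ℂ} (hG : Measurable G) :
    ∫⁻ x in {x | K < ‖x‖}, sampleMean F h G x ≤
      ENNReal.ofReal (2 * h) ^ N * ∫⁻ y in B, W y * ‖G y‖ₑ ^ 2 ∂F := by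
  have : IsFiniteMeasure (F.restrict B) := ⟨by simpa using hFB⟩
  have hS := measurableSet_mem_cube (N := N) h
  set f : EuclideanSpace ℝ (Fin N) → EuclideanSpace ℝ (Fin N) → ENNReal := fun x y ↦
    {p : EuclideanSpace ℝ (Fin N) × EuclideanSpace ℝ (Fin N) | p.2 ∈ cube p.1 h}.indicator
      (fun p ↦ W p.2 * ‖G p.2‖ₑ ^ 2) (x, y) with hf
  have hfm : Measurable (Function.uncurry f) :=
    Measurable.indicator (by fun_prop) hS
  calc ∫⁻ x in {x | K < ‖x‖}, sampleMean F h G x ≤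
        ∫⁻ x in {x | K < ‖x‖}, ∫⁻ y in B, f x y ∂F := by
        refine setLIntegral_mono' (measurableSet_lt measurable_const measurable_norm)
          fun x hx ↦ ?_
        have hsub : cube x h ⊆ B := fun y hy ↦ (hW x hx y hy).1
        rw [sampleMean, ← lintegral_const_mul _ (by fun_prop)]
        calc _ ≤ ∫⁻ y in cube x h, f x y ∂F := by
              refine setLIntegral_mono' (measurableSet_cube x h) fun y hy ↦ ?_
              have : f x y = W y * ‖G y‖ₑ ^ 2 := Set.indicator_of_mem (s := {p :
                EuclideanSpace ℝ (Fin N) × EuclideanSpace ℝ (Fin N) | p.2 ∈ cube p.1 h}) hy _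
              rw [this]
              gcongr
              exact (hW x hx y hy).2
          _ ≤ _ := lintegral_mono_set hsub
    _ ≤ ∫⁻ x, ∫⁻ y in B, f x y ∂F := setLIntegral_le_lintegral _ _
    _ = ∫⁻ y in B, (∫⁻ x, f x y) ∂F :=
      lintegral_lintegral_swap (μ := volume) (ν := F.restrict B) hfm.aemeasurable
    _ = ∫⁻ y in B, ENNReal.ofReal (2 * h) ^ N * (W y * ‖G y‖ₑ ^ 2) ∂F := by
      refine lintegral_congr fun y ↦ ?_
      have : (fun x ↦ f x y) = (cube y h).indicator fun _ ↦ W y * ‖G y‖ₑ ^ 2 := by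
        ext x
        by_cases hx : y ∈ cube x h
        · simp [hf, Set.indicator, hx, mem_cube_comm.1 hx]
        · simp [hf, Set.indicator, hx, mt mem_cube_comm.2 hx]
      rw [this, lintegral_indicator_const (measurableSet_cube y h), volume_cube, mul_comm]
    _ = _ := lintegral_const_mul _ (by fun_prop)

/-! ### Anisotropic scaling -/

/-- The diagonal map `ξ ↦ (aⱼ ξⱼ)ⱼ`. -/
noncomputable def scaleMap (a : Fin N → ℝ) :
    EuclideanSpace ℝ (Fin N) →ₗ[ℝ] EuclideanSpace ℝ (Fin N) :=
  Matrix.toEuclideanLin (Matrix.diagonal a)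

@[simp] lemma scaleMap_apply (a : Fin N → ℝ) (ξ : EuclideanSpace ℝ (Fin N)) (j : Fin N) :
    scaleMap a ξ j = a j * ξ j := by
  simp [scaleMap, Matrix.toLpLin_apply, Matrix.mulVec_diagonal]

lemma continuous_scaleMap (a : Fin N → ℝ) : Continuous (scaleMap a) :=
  LinearMap.continuous_of_finiteDimensional _

lemma inner_scaleMap (a : Fin N → ℝ) (x ξ : EuclideanSpace ℝ (Fin N)) :
    inner ℝ (scaleMap a x) ξ = inner ℝ x (scaleMap a ξ) := by
  simp only [PiLp.inner_apply, scaleMap_apply]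
  refine Finset.sum_congr rfl fun j _ ↦ ?_
  simp
  ring

lemma det_scaleMap (a : Fin N → ℝ) : LinearMap.det (scaleMap a) = ∏ j, a j := by
  rw [scaleMap, Matrix.toEuclideanLin_eq_toLin_orthonormal, LinearMap.det_toLin,
    Matrix.det_diagonal]

lemma map_scaleMap {a : Fin N → ℝ} (ha : ∀ j, 0 < a j) :
    Measure.map (scaleMap a) volume =
      ENNReal.ofReal (∏ j, a j)⁻¹ • (volume : Measure (EuclideanSpace ℝ (Fin N))) := by
  have hpos : 0 < ∏ j, a j := Finset.prod_pos fun j _ ↦ ha j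
  rw [Measure.map_linearMap_addHaar_eq_smul_addHaar _ (by rw [det_scaleMap]; exact hpos.ne'),
    det_scaleMap, abs_of_pos (by positivity)]

/-! ### Localised test functions -/

/-- The bump density rescaled to the box with half-sides `aⱼ`. -/
noncomputable def scaledBump (a : Fin N → ℝ) (ξ : EuclideanSpace ℝ (Fin N)) : ℂ :=
  (density (scaleMap (fun j ↦ (a j)⁻¹) ξ) : ℂ)

lemma contDiff_scaledBump (a : Fin N → ℝ) : ContDiff ℝ ∞ (scaledBump a) :=
  Complex.ofRealCLM.contDiff.comp
    (contDiff_density.comp (LinearMap.toContinuousLinearMap (scaleMap _)).contDiff)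

lemma abs_lt_of_scaledBump_ne_zero {a : Fin N → ℝ} (ha : ∀ j, 0 < a j)
    {ξ : EuclideanSpace ℝ (Fin N)} (h : scaledBump a ξ ≠ 0) (j : Fin N) : |ξ j| < a j := by
  have h1 := (density_ne_zero_iff _).1 (Complex.ofReal_ne_zero.1 h)
  have h2 := (PiLp.norm_apply_le _ j).trans_lt h1
  rwa [scaleMap_apply, norm_mul, norm_inv, Real.norm_of_nonneg (ha j).le, inv_mul_lt_one₀ (ha j)]
    at h2

lemma scaleMap_inv_scaleMap {a : Fin N → ℝ} (ha : ∀ j, 0 < a j) (ξ : EuclideanSpace ℝ (Fin N)) :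
    scaleMap a (scaleMap (fun j ↦ (a j)⁻¹) ξ) = ξ := by
  ext j
  simp [mul_inv_cancel_left₀ (ha j).ne']

lemma ft_scaledBump {a : Fin N → ℝ} (ha : ∀ j, 0 < a j) (x : EuclideanSpace ℝ (Fin N)) :
    ft (scaledBump a) x = (∏ j, a j : ℝ) * ft (fun ξ ↦ (density ξ : ℂ)) (scaleMap a x) := by
  have hpos : 0 < ∏ j, a j := Finset.prod_pos fun j _ ↦ ha j
  have h1 := map_scaleMap (a := fun j ↦ (a j)⁻¹) fun j ↦ inv_pos.2 (ha j)
  have h2 := integral_map (μ := volume) (φ := scaleMap fun j ↦ (a j)⁻¹)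
    (f := fun ξ : EuclideanSpace ℝ (Fin N) ↦
      Complex.exp (Complex.I * (inner ℝ (scaleMap a x) ξ : ℝ)) * (density ξ : ℂ))
    (continuous_scaleMap _).aemeasurable (Continuous.aestronglyMeasurable (by
      have := (contDiff_density (N := N)).continuous
      fun_prop))
  rw [h1, integral_smul_measure] at h2
  rw [ft, ft]
  simp only [inner_scaleMap, scaleMap_inv_scaleMap ha] at h2 ⊢
  rw [show (fun ξ ↦ Complex.exp (Complex.I * (inner ℝ x ξ : ℝ)) * scaledBump a ξ) =
    fun ξ ↦ Complex.exp (Complex.I * (inner ℝ x ξ : ℝ)) *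
      (density (scaleMap (fun j ↦ (a j)⁻¹) ξ) : ℂ) from rfl, ← h2]
  rw [Finset.prod_inv_distrib, inv_inv, ENNReal.toReal_ofReal hpos.le, Complex.real_smul]

lemma lintegral_scaledBump {a : Fin N → ℝ} (ha : ∀ j, 0 < a j) :
    ∫⁻ ξ, ‖scaledBump a ξ‖ₑ ^ 2 =
      ENNReal.ofReal (∏ j, a j) * ∫⁻ ξ : EuclideanSpace ℝ (Fin N), ‖(density ξ : ℂ)‖ₑ ^ 2 := by
  have h1 := map_scaleMap (a := fun j ↦ (a j)⁻¹) fun j ↦ inv_pos.2 (ha j)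
  have h2 := lintegral_map (μ := volume) (g := scaleMap fun j ↦ (a j)⁻¹)
    (f := fun ξ : EuclideanSpace ℝ (Fin N) ↦ ‖(density ξ : ℂ)‖ₑ ^ 2)
    (by have := (contDiff_density (N := N)).continuous.measurable
        fun_prop) (continuous_scaleMap _).measurable
  rw [h1, lintegral_smul_measure, Finset.prod_inv_distrib, inv_inv] at h2
  exact h2.symm

/-- The exponential sum `e^{i⟨x,u⟩} - ∑ₖ cₖ e^{i⟨x,tₖ⟩}`. -/
noncomputable def expSum {ι : Type*} [Fintype ι] (u : EuclideanSpace ℝ (Fin N))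
    (t : ι → EuclideanSpace ℝ (Fin N)) (c : ι → ℂ) (x : EuclideanSpace ℝ (Fin N)) : ℂ :=
  Complex.exp (Complex.I * (inner ℝ x u : ℝ)) -
    ∑ k, c k * Complex.exp (Complex.I * (inner ℝ x (t k) : ℝ))

/-- The function whose transform is the exponential sum times the transform of a bump. -/
noncomputable def testFun {ι : Type*} [Fintype ι] (a : Fin N → ℝ) (u : EuclideanSpace ℝ (Fin N))
    (t : ι → EuclideanSpace ℝ (Fin N)) (c : ι → ℂ) (ξ : EuclideanSpace ℝ (Fin N)) : ℂ :=
  scaledBump a (ξ - u) - ∑ k, c k * scaledBump a (ξ - t k)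

section testFun

variable {ι : Type*} [Fintype ι] {a : Fin N → ℝ}
  {u : EuclideanSpace ℝ (Fin N)} {t : ι → EuclideanSpace ℝ (Fin N)}

lemma isBand_scaledBump_translate (ha : ∀ j, 0 < a j) {T η : ℝ} (hη : ∀ j, a j ≤ η)
    (hu : u ∈ cube 0 T) :
    IsBand (T + η) fun ξ ↦ scaledBump a (ξ - u) := by
  refine ⟨(contDiff_scaledBump a).comp (contDiff_id.sub contDiff_const), fun ξ hξ ↦
    mem_cube_zero.2 fun j ↦ ?_⟩
  have h1 := (abs_lt_of_scaledBump_ne_zero ha hξ j).le.trans (hη j)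
  have h2 := mem_cube_zero.1 hu j
  rw [PiLp.sub_apply] at h1
  calc |ξ j| = |u j + (ξ j - u j)| := by rw [add_sub_cancel]
    _ ≤ |u j| + |ξ j - u j| := abs_add_le _ _
    _ ≤ _ := add_le_add h2 h1

lemma isBand_testFun (ha : ∀ j, 0 < a j) (c : ι → ℂ) {T η : ℝ} (hη : ∀ j, a j ≤ η)
    (hu : u ∈ cube 0 T) (ht : ∀ k, t k ∈ cube 0 T) : IsBand (T + η) (testFun a u t c) := by
  have hbu := isBand_scaledBump_translate ha hη hu
  have hbt (k : ι) := isBand_scaledBump_translate ha hη (ht k)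
  refine ⟨hbu.contDiff.sub (ContDiff.sum fun k _ ↦ contDiff_const.mul (hbt k).contDiff),
    fun ξ hξ ↦ ?_⟩
  by_contra hcon
  refine hξ ?_
  have h0 : scaledBump a (ξ - u) = 0 := by
    by_contra h; exact hcon (hbu.supp ξ h)
  have h1 (k : ι) : scaledBump a (ξ - t k) = 0 := by
    by_contra h; exact hcon ((hbt k).supp ξ h)
  simp [testFun, h0, h1]

lemma integrable_scaledBump (ha : ∀ j, 0 < a j) : Integrable (scaledBump a) := by
  have h := isBand_scaledBump_translate ha (u := 0) (T := 0) (η := ∑ j, a j)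
    (fun j ↦ Finset.single_le_sum (f := a) (fun i _ ↦ (ha i).le) (Finset.mem_univ j))
    (by simp [mem_cube_zero])
  simpa using h.integrable

lemma ft_scaledBump_translate (v x : EuclideanSpace ℝ (Fin N)) :
    ft (fun ξ ↦ scaledBump a (ξ - v)) x =
      Complex.exp (Complex.I * (inner ℝ x v : ℝ)) * ft (scaledBump a) x := by
  rw [ft, ft, ← integral_const_mul, ← integral_add_right_eq_self _ v]
  congr 1 with ξ
  rw [add_sub_cancel_right, inner_add_right, Complex.ofReal_add, mul_add, Complex.exp_add]
  ring

lemma ft_testFun (ha : ∀ j, 0 < a j) (c : ι → ℂ) (x : EuclideanSpace ℝ (Fin N)) :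
    ft (testFun a u t c) x = expSum u t c x * ft (scaledBump a) x := by
  have hint (v : EuclideanSpace ℝ (Fin N)) := integrable_expInner_mul
    ((integrable_scaledBump ha).comp_sub_right v) x
  have h1 : ft (testFun a u t c) x = ft (fun ξ ↦ scaledBump a (ξ - u)) x -
      ∑ k, c k * ft (fun ξ ↦ scaledBump a (ξ - t k)) x := by
    simp only [ft, ← integral_const_mul]
    rw [← integral_finsetSum _ fun k _ ↦ (hint (t k)).const_mul _,
      ← integral_sub (hint u) (integrable_finsetSum _ fun k _ ↦ (hint (t k)).const_mul _)]
    congr 1 with ξ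
    rw [testFun, mul_sub, Finset.mul_sum]
    congr 1
    refine Finset.sum_congr rfl fun k _ ↦ ?_
    ring
  rw [h1, expSum, sub_mul, Finset.sum_mul, ft_scaledBump_translate]
  congr 1
  refine Finset.sum_congr rfl fun k _ ↦ ?_
  rw [ft_scaledBump_translate, mul_assoc]

/-- If every `tₖ` leaves the box of half-sides `2 aⱼ` around `u`, the bumps at `tₖ` do not meet the
bump at `u`, whose norm is thus a lower bound for the energy. -/
lemma le_energy_testFun (ha : ∀ j, 0 < a j) (c : ι → ℂ) {T η : ℝ} (hη : ∀ j, a j ≤ η)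
    (hu : u ∈ cube 0 T) (ht : ∀ k, t k ∈ cube 0 T) (hsep : ∀ k, ∃ j, 2 * a j ≤ |u j - t k j|) :
    ENNReal.ofReal ((2 * Real.pi) ^ N * ∏ j, a j) *
      ∫⁻ ξ : EuclideanSpace ℝ (Fin N), ‖(density ξ : ℂ)‖ₑ ^ 2 ≤ energy (testFun a u t c) := by
  rw [(isBand_testFun ha c hη hu ht).energy_eq, ENNReal.ofReal_mul (by positivity), mul_assoc,
    ← lintegral_scaledBump ha, ← lintegral_sub_right_eq_self _ u]
  gcongr with ξ
  by_cases h0 : scaledBump a (ξ - u) = 0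
  · simp [h0]
  · have h1 (k : ι) : scaledBump a (ξ - t k) = 0 := by
      by_contra h
      obtain ⟨j, hj⟩ := hsep k
      have h2 := abs_lt_of_scaledBump_ne_zero ha h0 j
      have h3 := abs_lt_of_scaledBump_ne_zero ha h j
      simp only [PiLp.sub_apply] at h2 h3
      have h4 : |u j - t k j| ≤ |ξ j - t k j| + |ξ j - u j| := by
        calc |u j - t k j| = |(ξ j - t k j) - (ξ j - u j)| := by ring_nf
          _ ≤ _ := abs_sub _ _
      linarith
    simp [testFun, h1]

end testFun

lemma lintegral_density_sq_pos :
    0 < ∫⁻ ξ : EuclideanSpace ℝ (Fin N), ‖(density ξ : ℂ)‖ₑ ^ 2 := by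
  have hc := (contDiff_density (N := N)).continuous
  rw [lintegral_pos_iff_support (by have := hc.measurable; fun_prop)]
  refine IsOpen.measure_pos _ ?_ ⟨0, ?_⟩
  · have : (Function.support fun ξ : EuclideanSpace ℝ (Fin N) ↦ ‖(density ξ : ℂ)‖ₑ ^ 2) =
        {ξ | density ξ ≠ 0} := by
      ext ξ; simp
    rw [this]
    exact isOpen_ne_fun hc continuous_const
  · have := (density_ne_zero_iff (0 : EuclideanSpace ℝ (Fin N))).2 (by simp)
    simpa using this

/-- The transform of the density is a Schwartz function. -/
lemma exists_decay_density (k : ℕ) : ∃ C : ℝ, 0 < C ∧ ∀ z : EuclideanSpace ℝ (Fin N),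
    (1 + ‖z‖) ^ k * ‖ft (fun ξ ↦ (density ξ : ℂ)) z‖ ≤ C := by
  have hb := isBand_density (N := N)
  set f := 𝓕 (hb.hasCompactSupport.toSchwartzMap hb.contDiff)
  obtain ⟨C₀, hC₀, h0⟩ := f.decay 0 0
  obtain ⟨C₁, hC₁, h1⟩ := f.decay k 0
  refine ⟨2 ^ k * (C₀ + (2 * Real.pi) ^ k * C₁), by positivity, fun z ↦ ?_⟩
  have h2 : ft (fun ξ ↦ (density ξ : ℂ)) z = f (-(2 * Real.pi)⁻¹ • z) := by
    rw [ft_eq_fourier]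
    simp only [f, SchwartzMap.fourier_coe]
    rfl
  have h3 := h0 (-(2 * Real.pi)⁻¹ • z)
  have h4 := h1 (-(2 * Real.pi)⁻¹ • z)
  simp only [pow_zero, one_mul, norm_iteratedFDeriv_zero, ← h2] at h3 h4
  rw [norm_smul, norm_neg, norm_inv, Real.norm_of_nonneg (by positivity), mul_pow, inv_pow,
    mul_assoc, inv_mul_le_iff₀ (by positivity)] at h4
  set n := ‖ft (fun ξ ↦ (density ξ : ℂ)) z‖
  have h5 : (1 + ‖z‖) ^ k ≤ 2 ^ k * (1 + ‖z‖ ^ k) := by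
    rcases le_total 1 ‖z‖ with h | h
    · calc (1 + ‖z‖) ^ k ≤ (2 * ‖z‖) ^ k := by gcongr; linarith
        _ = 2 ^ k * ‖z‖ ^ k := mul_pow _ _ _
        _ ≤ _ := by gcongr; linarith
    · calc (1 + ‖z‖) ^ k ≤ 2 ^ k := by gcongr; linarith
        _ ≤ _ := le_mul_of_one_le_right (by positivity) (by linarith [pow_nonneg (norm_nonneg z) k])
  calc (1 + ‖z‖) ^ k * n ≤ 2 ^ k * (1 + ‖z‖ ^ k) * n := by gcongr
    _ = 2 ^ k * (n + ‖z‖ ^ k * n) := by ring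
    _ ≤ _ := by gcongr

lemma exists_rho_mul_decay_density {H : Fin N → ℝ} (hH : ∀ j, 0 < H j ∧ H j < 1) (j₀ : Fin N) :
    ∃ C : ℝ, 0 < C ∧ ∀ z : EuclideanSpace ℝ (Fin N),
      rho H 0 z ^ (homDim H + 2) * ‖ft (fun ξ ↦ (density ξ : ℂ)) z‖ ^ 2 ≤ C := by
  obtain ⟨k, hk⟩ := exists_nat_ge (homDim H + 2)
  obtain ⟨C, hC, h⟩ := exists_decay_density (N := N) k
  have hN : (1 : ℝ) ≤ N := by exact_mod_cast j₀.pos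
  have hQ := homDim_nonneg hH
  refine ⟨N ^ (2 * k) * C ^ 2, by positivity, fun z ↦ ?_⟩
  have h1 : (1 : ℝ) ≤ N * (1 + ‖z‖) := by nlinarith [norm_nonneg z]
  have h2 : rho H 0 z ^ (homDim H + 2) ≤ (N * (1 + ‖z‖)) ^ (2 * k) := by
    calc rho H 0 z ^ (homDim H + 2) ≤ (N * (1 + ‖z‖)) ^ (homDim H + 2) := by
          gcongr
          · exact rho_nonneg _ _ _
          · exact rho_zero_le hH z
      _ ≤ (N * (1 + ‖z‖)) ^ ((2 * k : ℕ) : ℝ) := by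
        refine Real.rpow_le_rpow_of_exponent_le h1 ?_
        push_cast
        linarith
      _ = _ := Real.rpow_natCast _ _
  calc _ ≤ (N * (1 + ‖z‖)) ^ (2 * k) * ‖ft (fun ξ ↦ (density ξ : ℂ)) z‖ ^ 2 := by gcongr
    _ = N ^ (2 * k) * ((1 + ‖z‖) ^ k * ‖ft (fun ξ ↦ (density ξ : ℂ)) z‖) ^ 2 := by
      rw [mul_pow]; ring
    _ ≤ _ := by gcongr; exact h z

/-! ### The spectral lower bound -/

lemma rho_scaleMap {H : Fin N → ℝ} (hH : ∀ j, 0 < H j ∧ H j < 1) {r : ℝ} (hr : 0 < r)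
    (y : EuclideanSpace ℝ (Fin N)) :
    rho H 0 (scaleMap (fun j ↦ r ^ (H j)⁻¹) y) = r * rho H 0 y := by
  rw [rho_zero_left, rho_zero_left, Finset.mul_sum]
  refine Finset.sum_congr rfl fun j _ ↦ ?_
  rw [scaleMap_apply, abs_mul, Real.mul_rpow (abs_nonneg _) (abs_nonneg _),
    abs_of_pos (Real.rpow_pos_of_pos hr _), ← Real.rpow_mul hr.le,
    inv_mul_cancel₀ (hH j).1.ne', Real.rpow_one]

lemma rho_le_of_mem_cube {H : Fin N → ℝ} (hH : ∀ j, 0 < H j ∧ H j < 1) {T : ℝ}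
    {s t : EuclideanSpace ℝ (Fin N)} (hs : s ∈ cube 0 T) (ht : t ∈ cube 0 T) :
    rho H s t ≤ ∑ j, (2 * T) ^ H j := by
  refine Finset.sum_le_sum fun j _ ↦ Real.rpow_le_rpow (abs_nonneg _) ?_ (hH j).1.le
  linarith [abs_sub (s j) (t j), mem_cube_zero.1 hs j, mem_cube_zero.1 ht j]

/-- Points at distance `ρ ≥ 2 N r` are separated by `2 r^{1/Hⱼ}` in some coordinate `j`, so that the
boxes with half-sides `r^{1/Hⱼ}` around them are disjoint. -/
lemma exists_two_mul_le_abs_sub {H : Fin N → ℝ} (hH : ∀ j, 0 < H j ∧ H j < 1) (j₀ : Fin N)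
    {r : ℝ} (hr : 0 < r) {u t : EuclideanSpace ℝ (Fin N)} (h : 2 * N * r ≤ rho H u t) :
    ∃ j, 2 * r ^ (H j)⁻¹ ≤ |u j - t j| := by
  by_contra! hcon
  have : rho H u t < ∑ _j : Fin N, 2 * r := by
    refine Finset.sum_lt_sum_of_nonempty ⟨j₀, Finset.mem_univ _⟩ fun j _ ↦ ?_
    calc |u j - t j| ^ H j < (2 * r ^ (H j)⁻¹) ^ H j :=
          Real.rpow_lt_rpow (abs_nonneg _) (hcon j) (hH j).1
      _ = 2 ^ H j * r := by
        rw [Real.mul_rpow (by norm_num) (by positivity), ← Real.rpow_mul hr.le,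
          inv_mul_cancel₀ (hH j).1.ne', Real.rpow_one]
      _ ≤ 2 ^ (1 : ℝ) * r := by
        gcongr
        · norm_num
        · exact (hH j).2.le
      _ = 2 * r := by rw [Real.rpow_one]
  simp at this
  linarith

/-- The energy of the test function at scale `r` is at most a constant multiple of
`r^{Q-2} ∫ ‖expSum‖² dF`. -/
lemma lintegral_weight_mul_ft_testFun_le {H : Fin N → ℝ} (hH : ∀ j, 0 < H j ∧ H j < 1)
    {F : Measure (EuclideanSpace ℝ (Fin N))} {B : Set (EuclideanSpace ℝ (Fin N))}
    {A C r : ℝ} (hA : 0 ≤ A) (hr : 0 < r)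
    (hC : ∀ z : EuclideanSpace ℝ (Fin N),
      rho H 0 z ^ (homDim H + 2) * ‖ft (fun ξ ↦ (density ξ : ℂ)) z‖ ^ 2 ≤ C)
    {ι : Type*} [Fintype ι] (u : EuclideanSpace ℝ (Fin N)) (t : ι → EuclideanSpace ℝ (Fin N))
    (c : ι → ℂ) :
    ∫⁻ y in B, ENNReal.ofReal (A * rho H 0 y ^ (homDim H + 2)) *
        ‖ft (testFun (fun j ↦ r ^ (H j)⁻¹) u t c) y‖ₑ ^ 2 ∂F ≤
      ENNReal.ofReal (A * C * r ^ (homDim H - 2)) * ∫⁻ y, ‖expSum u t c y‖ₑ ^ 2 ∂F := by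
  have ha (j : Fin N) : 0 < r ^ (H j)⁻¹ := Real.rpow_pos_of_pos hr _
  rw [← lintegral_const_mul' _ _ ENNReal.ofReal_ne_top]
  refine (lintegral_mono fun y ↦ ?_).trans (setLIntegral_le_lintegral _ _)
  have hprod : ∏ j, r ^ (H j)⁻¹ = r ^ homDim H := by
    rw [homDim, Real.rpow_sum_of_pos hr]
  rw [ft_testFun ha, ft_scaledBump ha, hprod, enorm_mul, mul_pow, mul_comm (‖expSum u t c y‖ₑ ^ 2),
    ← mul_assoc]
  gcongr
  set z := scaleMap (fun j ↦ r ^ (H j)⁻¹) y with hz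
  rw [← ofReal_norm, ← ENNReal.ofReal_pow (norm_nonneg _), ← ENNReal.ofReal_mul
    (mul_nonneg hA (Real.rpow_nonneg (rho_nonneg _ _ _) _))]
  refine ENNReal.ofReal_le_ofReal ?_
  rw [norm_mul, Complex.norm_real, Real.norm_of_nonneg (by positivity)]
  have h1 : rho H 0 z ^ (homDim H + 2) = r ^ (homDim H + 2) * rho H 0 y ^ (homDim H + 2) := by
    rw [hz, rho_scaleMap hH hr, Real.mul_rpow hr.le (rho_nonneg _ _ _)]
  have h2 : (r ^ homDim H) ^ 2 = r ^ (homDim H - 2) * r ^ (homDim H + 2) := by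
    rw [← Real.rpow_add hr, ← Real.rpow_natCast, ← Real.rpow_mul hr.le]
    congr 1
    push_cast; ring
  calc A * rho H 0 y ^ (homDim H + 2) *
        (r ^ homDim H * ‖ft (fun ξ ↦ (density ξ : ℂ)) z‖) ^ 2 =
      A * r ^ (homDim H - 2) *
        (rho H 0 z ^ (homDim H + 2) * ‖ft (fun ξ ↦ (density ξ : ℂ)) z‖ ^ 2) := by
        rw [mul_pow, h1, h2]; ring
    _ ≤ A * r ^ (homDim H - 2) * C := by gcongr; exact hC z
    _ = _ := by ring

/-- The lower spectral bound, with the weight `ρ(0,x)^{Q+2}` moved from the centre of the cube to an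
arbitrary point of it. -/
lemma SpectralCondition.exists_inv_le {H : Fin N → ℝ} (hH : ∀ j, 0 < H j ∧ H j < 1)
    {F : Measure (EuclideanSpace ℝ (Fin N))} {h : ℝ} (hh : 0 < h) (hF : SpectralCondition H F h) :
    ∃ K A : ℝ, 0 < K ∧ 0 < A ∧ ∀ x : EuclideanSpace ℝ (Fin N), K < ‖x‖ →
      F (cube x h) ≠ 0 ∧ F (cube x h) ≠ ⊤ ∧ ∀ y ∈ cube x h, 1 ≤ ‖y‖ ∧
        (F (cube x h))⁻¹ ≤ ENNReal.ofReal (A * rho H 0 y ^ (homDim H + 2)) := by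
  obtain ⟨K, c, C, hK, hc, hb⟩ := hF.exists_bounds
  have hQ := homDim_nonneg hH
  refine ⟨max K (N * (1 + h)), c⁻¹ * (1 + N * (1 + h)) ^ (homDim H + 2), by positivity,
    by positivity, fun x hx ↦ ?_⟩
  obtain ⟨h1, h2⟩ := hb x ((le_max_left _ _).trans_lt hx)
  have hfar := (le_max_right _ _).trans_lt hx
  have hρx := (one_le_rho_of_far hH hfar (show x ∈ cube x h by simp [cube, hh.le])).2
  have hpos : ENNReal.ofReal (rho H 0 x ^ (homDim H + 2)) ≠ 0 := by
    simp only [ne_eq, ENNReal.ofReal_eq_zero, not_le]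
    exact Real.rpow_pos_of_pos (by linarith) _
  have hne0 : F (cube x h) ≠ 0 := by
    intro h0
    rw [h0, mul_zero, nonpos_iff_eq_zero, ENNReal.coe_eq_zero] at h1
    exact hc.ne' h1
  have hnetop : F (cube x h) ≠ ⊤ := by
    intro h0
    rw [h0, ENNReal.mul_top hpos] at h2
    exact absurd h2 (by simp)
  refine ⟨hne0, hnetop, fun y hy ↦ ?_⟩
  obtain ⟨hy1, hy2⟩ := one_le_rho_of_far hH hfar hy
  refine ⟨hy1, ?_⟩
  have h3 : rho H 0 x ≤ (1 + N * (1 + h)) * rho H 0 y := by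
    have h4 : (0 : ℝ) ≤ N * (1 + h) := by positivity
    nlinarith [rho_zero_le_of_mem_cube hH hh.le hy]
  calc (F (cube x h))⁻¹ ≤ (c : ENNReal)⁻¹ * ENNReal.ofReal (rho H 0 x ^ (homDim H + 2)) := by
        rw [ENNReal.inv_le_iff_inv_le, ENNReal.mul_inv (Or.inr ENNReal.ofReal_ne_top) (Or.inr hpos),
          inv_inv, ← div_eq_mul_inv]
        refine ENNReal.div_le_of_le_mul ?_
        rwa [mul_comm]
    _ = ENNReal.ofReal (c⁻¹ * rho H 0 x ^ (homDim H + 2)) := by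
      rw [ENNReal.ofReal_mul (by positivity), ENNReal.ofReal_coe_nnreal, ENNReal.coe_inv hc.ne']
    _ ≤ _ := by
      refine ENNReal.ofReal_le_ofReal ?_
      rw [mul_assoc, ← Real.mul_rpow (by positivity) (rho_nonneg _ _ _)]
      gcongr

/-- The quantitative form of strong local nondeterminism, on the spectral side: the exponential
`e^{i⟨·,u⟩}` stays at `L²(F)`-distance at least `const · s` from every combination of exponentials
`e^{i⟨·,tₖ⟩}` with `ρ(u,tₖ) ≥ s`. -/
theorem exists_le_lintegral_expSum (j₀ : Fin N) {H : Fin N → ℝ} (hH : ∀ j, 0 < H j ∧ H j < 1)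
    {F : Measure (EuclideanSpace ℝ (Fin N))} (hF : F {y | 1 ≤ ‖y‖} < ⊤)
    {h T : ℝ} (hh : 0 < h) (hFh : SpectralCondition H F h) (hT : 0 < T)
    (hThN : T * h * N < Real.log 2) :
    ∃ C : ℝ, 0 < C ∧ ∀ (n : ℕ) (t : Fin (n + 1) → EuclideanSpace ℝ (Fin N))
      (u : EuclideanSpace ℝ (Fin N)) (c : Fin (n + 1) → ℂ) (s : ℝ), u ∈ cube 0 T →
      (∀ k, t k ∈ cube 0 T) → 0 ≤ s → (∀ k, s ≤ rho H u (t k)) →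
      ENNReal.ofReal (C * s ^ 2) ≤ ∫⁻ x, ‖expSum u t c x‖ₑ ^ 2 ∂F := by
  have hN : (0 : ℝ) < N := by exact_mod_cast j₀.pos
  obtain ⟨K, A, hK, hA, hKA⟩ := hFh.exists_inv_le hH hh
  obtain ⟨C₃, hC₃, hdecay⟩ := exists_rho_mul_decay_density hH j₀
  -- the bumps must fit into a slightly larger band `T + η`
  obtain ⟨η, hη0, hη1, hη⟩ : ∃ η > 0, η ≤ 1 ∧ (T + η) * h * N < Real.log 2 := by
    refine ⟨min 1 ((Real.log 2 - T * h * N) / (2 * (h * N))), ?_, min_le_left _ _, ?_⟩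
    · have : 0 < Real.log 2 - T * h * N := by linarith
      positivity
    · calc (T + min 1 ((Real.log 2 - T * h * N) / (2 * (h * N)))) * h * N ≤
            (T + (Real.log 2 - T * h * N) / (2 * (h * N))) * h * N := by
            gcongr; exact min_le_right _ _
        _ = (T * h * N + Real.log 2) / 2 := by field_simp; ring
        _ < _ := by linarith
  obtain ⟨C₀, hC₀⟩ := exists_energy_le_sampleMean j₀ (R := T + η) hh (by linarith) hK hη
    fun x hx ↦ ⟨(hKA x hx).1, (hKA x hx).2.1⟩
  obtain ⟨d, hd0, hd⟩ := ENNReal.lt_iff_exists_nnreal_btwn.1 (lintegral_density_sq_pos (N := N))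
  have hd0' : 0 < d := by exact_mod_cast hd0
  -- `D` bounds `ρ` on the cube; the scale `r = lam * s` of the bumps keeps them disjoint
  -- (`2 N r ≤ s`) and inside the band `T + η` (`r ≤ η`)
  set D : ℝ := 1 + ∑ j, (2 * T) ^ H j with hD
  have hD0 : 0 < D := by positivity
  set lam : ℝ := min (1 / (2 * N)) (η / D) with hlam
  have hlam0 : 0 < lam := by positivity
  set E : ℝ := (C₀ + 1) * (2 * h) ^ N * (A * C₃) with hE
  have hE0 : 0 < E := by positivity
  refine ⟨(2 * Real.pi) ^ N * d * lam ^ 2 / E, by positivity, fun n t u c s hu ht hs hst ↦ ?_⟩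
  rcases hs.eq_or_lt with rfl | hs
  · simp
  set r := lam * s with hr
  have hr0 : 0 < r := by positivity
  have hrη : r ≤ η := by
    have h1 : s ≤ D := (hst 0).trans ((rho_le_of_mem_cube hH hu (ht 0)).trans (by linarith))
    calc r ≤ η / D * D := by rw [hr]; gcongr; exact min_le_right _ _
      _ = η := by field_simp
  have hrs : 2 * N * r ≤ s := by
    calc 2 * N * r ≤ 2 * N * (1 / (2 * N) * s) := by rw [hr]; gcongr; exact min_le_left _ _
      _ = s := by field_simp
  have ha (j : Fin N) : 0 < r ^ (H j)⁻¹ := Real.rpow_pos_of_pos hr0 _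
  have haη (j : Fin N) : r ^ (H j)⁻¹ ≤ η := by
    refine le_trans ?_ hrη
    calc r ^ (H j)⁻¹ ≤ r ^ (1 : ℝ) := Real.rpow_le_rpow_of_exponent_ge hr0 (hrη.trans hη1)
          (one_le_inv_iff₀.2 ⟨(hH j).1, (hH j).2.le⟩)
      _ = r := Real.rpow_one r
  have hprod : ∏ j, r ^ (H j)⁻¹ = r ^ homDim H := by
    rw [homDim, Real.rpow_sum_of_pos hr0]
  have hlow := le_energy_testFun ha c haη hu ht fun k ↦
    exists_two_mul_le_abs_sub hH j₀ hr0 (hrs.trans (hst k))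
  have hband := isBand_testFun ha c haη hu ht
  have hup := hC₀ _ hband
  have hsample := lintegral_sampleMean_le (K := K) (h := h) (F := F) hF
    (W := fun y ↦ ENNReal.ofReal (A * rho H 0 y ^ (homDim H + 2)))
    (by
      have hQ := homDim_nonneg hH
      have := (continuous_rho_zero hH).measurable
      fun_prop)
    (fun x hx y hy ↦ (hKA x hx).2.2 y hy) hband.continuous_ft.measurable
  have hweight := lintegral_weight_mul_ft_testFun_le hH (F := F) (B := {y | 1 ≤ ‖y‖}) hA.le hr0
    hdecay u t c
  have hfinal : ENNReal.ofReal ((2 * Real.pi) ^ N * r ^ homDim H * d) ≤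
      ENNReal.ofReal (E * r ^ (homDim H - 2)) * ∫⁻ x, ‖expSum u t c x‖ₑ ^ 2 ∂F := by
    calc _ = ENNReal.ofReal ((2 * Real.pi) ^ N * ∏ j, r ^ (H j)⁻¹) * d := by
          rw [hprod, ENNReal.ofReal_mul (by positivity), ENNReal.ofReal_coe_nnreal]
      _ ≤ _ := mul_le_mul' le_rfl hd.le
      _ ≤ _ := hlow
      _ ≤ _ := hup
      _ ≤ _ := mul_le_mul' le_rfl (hsample.trans (mul_le_mul' le_rfl hweight))
      _ = ENNReal.ofReal (C₀ * (2 * h) ^ N * (A * C₃ * r ^ (homDim H - 2))) *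
          ∫⁻ x, ‖expSum u t c x‖ₑ ^ 2 ∂F := by
        rw [mul_assoc (C₀ : ℝ), ENNReal.ofReal_mul C₀.coe_nonneg, ENNReal.ofReal_coe_nnreal,
          ENNReal.ofReal_mul (p := (2 * h) ^ N) (by positivity),
          ENNReal.ofReal_pow (by positivity)]
        ring
      _ ≤ _ := by
        refine mul_le_mul' (ENNReal.ofReal_le_ofReal ?_) le_rfl
        calc _ ≤ (C₀ + 1) * (2 * h) ^ N * (A * C₃ * r ^ (homDim H - 2)) := by
              gcongr; linarith
          _ = _ := by rw [hE]; ring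
  have hy : 0 < E * r ^ (homDim H - 2) := by positivity
  have hsplit : (2 * Real.pi) ^ N * d * lam ^ 2 / E * s ^ 2 =
      (2 * Real.pi) ^ N * r ^ homDim H * d / (E * r ^ (homDim H - 2)) := by
    have h1 : r ^ homDim H = r ^ (homDim H - 2) * (lam * s) ^ 2 := by
      rw [← hr, ← Real.rpow_natCast r 2, ← Real.rpow_add hr0]
      congr 1
      push_cast; ring
    rw [h1]
    field_simp
  rw [hsplit, ENNReal.ofReal_div_of_pos hy]
  exact ENNReal.div_le_of_le_mul' hfinal

/-! ### The spectral upper bound -/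

lemma summable_dyadic {p : ℝ} (hp : 2 < p) :
    Summable fun m : ℤ ↦ min 1 (((2 : ℝ) ^ (m + 1)) ^ p) * ((2 : ℝ) ^ m) ^ (-2 : ℝ) := by
  refine Summable.of_nat_of_neg ?_ ?_
  · refine Summable.of_nonneg_of_le (fun n ↦ by positivity) (fun n ↦ ?_)
      (summable_geometric_of_lt_one (r := (1 / 4 : ℝ)) (by norm_num) (by norm_num))
    have h1 : ((2 : ℝ) ^ (n : ℤ)) ^ (-2 : ℝ) = (1 / 4) ^ n := by
      rw [zpow_natCast, Real.rpow_neg (by positivity), Real.rpow_two, ← pow_mul, mul_comm, pow_mul,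
        one_div, inv_pow]
      norm_num
    rw [h1]
    exact mul_le_of_le_one_left (by positivity) (min_le_left _ _)
  · have hr : (2 : ℝ) ^ (2 - p) < 1 := Real.rpow_lt_one_of_one_lt_of_neg (by norm_num) (by linarith)
    refine Summable.of_nonneg_of_le (fun n ↦ by positivity) (fun n ↦ ?_)
      ((summable_geometric_of_lt_one (by positivity) hr).mul_left ((2 : ℝ) ^ p))
    refine (mul_le_mul_of_nonneg_right (min_le_right _ _) (by positivity)).trans (le_of_eq ?_)
    rw [← Real.rpow_intCast, ← Real.rpow_intCast, ← Real.rpow_natCast,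
      ← Real.rpow_mul (by norm_num), ← Real.rpow_mul (by norm_num), ← Real.rpow_mul (by norm_num),
      ← Real.rpow_add (by norm_num),
      ← Real.rpow_add (by norm_num)]
    congr 1
    push_cast
    ring

/-- If the dyadic shells `{R ≤ g < 2R}` have mass at most `C R⁻²`, then
`∫ min(1, (a g)^p) ≤ const · a²` for `p > 2`. -/
lemma exists_lintegral_min_rpow_le {α : Type*} [MeasurableSpace α] {μ : Measure α} {g : α → ℝ}
    (hg : Measurable g) (hg0 : ∀ᵐ x ∂μ, 0 < g x) {C : ℝ} (hC0 : 0 ≤ C)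
    (hC : ∀ R > 0, μ {x | R ≤ g x ∧ g x < 2 * R} ≤ ENNReal.ofReal (C * R ^ (-2 : ℝ)))
    {p : ℝ} (hp : 2 < p) :
    ∃ B : ℝ, 0 ≤ B ∧ ∀ a > 0,
      ∫⁻ x, ENNReal.ofReal (min 1 ((a * g x) ^ p)) ∂μ ≤ ENNReal.ofReal (B * a ^ 2) := by
  set f : ℤ → ℝ := fun m ↦ min 1 (((2 : ℝ) ^ (m + 1)) ^ p) * ((2 : ℝ) ^ m) ^ (-2 : ℝ) with hf
  have hf0 (m : ℤ) : 0 ≤ f m := by positivity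
  have hfs : Summable f := summable_dyadic hp
  refine ⟨C * ∑' m, f m, mul_nonneg hC0 (tsum_nonneg hf0), fun a ha ↦ ?_⟩
  set S : ℤ → Set α := fun m ↦ {x | 2 ^ m / a ≤ g x ∧ g x < 2 * (2 ^ m / a)} with hS
  have hSm (m : ℤ) : MeasurableSet (S m) :=
    (measurableSet_le measurable_const hg).inter (measurableSet_lt hg measurable_const)
  have hcover : ∀ᵐ x ∂μ, x ∈ ⋃ m, S m := by
    filter_upwards [hg0] with x hx
    obtain ⟨m, hm1, hm2⟩ := exists_mem_Ico_zpow (x := a * g x) (y := (2 : ℝ)) (by positivity)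
      (by norm_num)
    refine Set.mem_iUnion.2 ⟨m, ?_, ?_⟩
    · rw [div_le_iff₀ ha]; linarith
    · rw [mul_div_assoc', lt_div_iff₀ ha]
      rw [zpow_add_one₀ (by norm_num)] at hm2
      linarith
  calc ∫⁻ x, ENNReal.ofReal (min 1 ((a * g x) ^ p)) ∂μ =
        ∫⁻ x in ⋃ m, S m, ENNReal.ofReal (min 1 ((a * g x) ^ p)) ∂μ := by
        rw [Measure.restrict_eq_self_of_ae_mem hcover]
    _ ≤ ∑' m, ∫⁻ x in S m, ENNReal.ofReal (min 1 ((a * g x) ^ p)) ∂μ := lintegral_iUnion_le _ _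
    _ ≤ ∑' m, ENNReal.ofReal (C * a ^ 2 * f m) := by
      refine ENNReal.tsum_le_tsum fun m ↦ ?_
      calc _ ≤ ∫⁻ x in S m, ENNReal.ofReal (min 1 (((2 : ℝ) ^ (m + 1)) ^ p)) ∂μ := by
            refine setLIntegral_mono' (hSm m) fun x hx ↦ ENNReal.ofReal_le_ofReal ?_
            have h0 : 0 ≤ g x := le_trans (by positivity) hx.1
            gcongr
            have := hx.2
            rw [mul_div_assoc', lt_div_iff₀ ha] at this
            rw [zpow_add_one₀ (by norm_num)]
            linarith
        _ = ENNReal.ofReal (min 1 (((2 : ℝ) ^ (m + 1)) ^ p)) * μ (S m) := setLIntegral_const _ _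
        _ ≤ ENNReal.ofReal (min 1 (((2 : ℝ) ^ (m + 1)) ^ p)) *
            ENNReal.ofReal (C * (2 ^ m / a) ^ (-2 : ℝ)) := by
          gcongr
          exact hC _ (by positivity)
        _ = _ := by
          rw [← ENNReal.ofReal_mul (by positivity)]
          congr 1
          rw [hf, Real.div_rpow (by positivity) ha.le, Real.rpow_neg ha.le, Real.rpow_two]
          field_simp
    _ = ENNReal.ofReal (∑' m, C * a ^ 2 * f m) :=
      (ENNReal.ofReal_tsum_of_nonneg (fun m ↦ mul_nonneg (by positivity) (hf0 m))
        (hfs.mul_left _)).symm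
    _ = _ := by rw [tsum_mul_left]; ring_nf

lemma abs_le_of_rho_le {H : Fin N → ℝ} (hH : ∀ j, 0 < H j ∧ H j < 1) {R : ℝ}
    {x : EuclideanSpace ℝ (Fin N)} (hx : rho H 0 x ≤ R) (j : Fin N) : |x j| ≤ R ^ (H j)⁻¹ := by
  have h1 : |x j| ^ H j ≤ R := by
    refine le_trans ?_ hx
    rw [rho_zero_left]
    exact Finset.single_le_sum (f := fun j ↦ |x j| ^ H j)
      (fun _ _ ↦ Real.rpow_nonneg (abs_nonneg _) _) (Finset.mem_univ j)
  calc |x j| = (|x j| ^ H j) ^ (H j)⁻¹ := by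
        rw [← Real.rpow_mul (abs_nonneg _), mul_inv_cancel₀ (hH j).1.ne', Real.rpow_one]
    _ ≤ _ := by
      have := (hH j).1
      gcongr

lemma volume_rho_le {H : Fin N → ℝ} (hH : ∀ j, 0 < H j ∧ H j < 1) {R : ℝ} (hR : 0 < R) :
    volume {x : EuclideanSpace ℝ (Fin N) | rho H 0 x ≤ R} ≤
      ENNReal.ofReal (2 ^ N * R ^ homDim H) := by
  have ha (j : Fin N) : 0 < R ^ (H j)⁻¹ := Real.rpow_pos_of_pos hR _
  have h1 := map_scaleMap (a := fun j ↦ (R ^ (H j)⁻¹)⁻¹) fun j ↦ inv_pos.2 (ha j)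
  have h2 : volume (scaleMap (fun j ↦ (R ^ (H j)⁻¹)⁻¹) ⁻¹' cube 0 1) =
      ENNReal.ofReal (2 ^ N * R ^ homDim H) := by
    rw [← Measure.map_apply (continuous_scaleMap _).measurable (measurableSet_cube _ _), h1,
      Measure.smul_apply, volume_cube, Finset.prod_inv_distrib, inv_inv, homDim,
      Real.rpow_sum_of_pos hR, smul_eq_mul, mul_comm, mul_one,
      ENNReal.ofReal_mul (p := 2 ^ N) (by positivity), ENNReal.ofReal_pow (by norm_num)]
  rw [← h2]
  refine measure_mono fun x hx ↦ mem_cube_zero.2 fun j ↦ ?_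
  rw [scaleMap_apply, abs_mul, abs_of_pos (inv_pos.2 (ha j)), inv_mul_le_one₀ (ha j)]
  exact abs_le_of_rho_le hH hx j

/-- Averaging the masses of the cubes `C(x,h)` over `x` near `S` controls the mass of `S`. -/
lemma measure_le_lintegral_cube {F : Measure (EuclideanSpace ℝ (Fin N))} {h : ℝ}
    {S S' : Set (EuclideanSpace ℝ (Fin N))} (hS : MeasurableSet S) (hS' : MeasurableSet S')
    (hFS : F S < ⊤) (hSS' : ∀ y ∈ S, cube y h ⊆ S') :
    ENNReal.ofReal (2 * h) ^ N * F S ≤ ∫⁻ x in S', F (cube x h) := by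
  have : IsFiniteMeasure (F.restrict S) := ⟨by simpa using hFS⟩
  have hE := measurableSet_mem_cube (N := N) h
  have h1 := Measure.prod_apply (μ := F.restrict S) (ν := volume) hE
  have h2 := Measure.prod_apply_symm (μ := F.restrict S) (ν := volume) hE
  rw [h1] at h2
  have h3 : ENNReal.ofReal (2 * h) ^ N * F S =
      ∫⁻ y in S, volume (Prod.mk y ⁻¹' {p : EuclideanSpace ℝ (Fin N) × EuclideanSpace ℝ (Fin N) |
        p.2 ∈ cube p.1 h}) ∂F := by
    rw [← setLIntegral_const]
    exact setLIntegral_congr_fun hS fun y _ ↦ (volume_cube y h).symm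
  rw [h3, h2, ← lintegral_indicator hS']
  refine lintegral_mono fun x ↦ ?_
  by_cases hx : x ∈ S'
  · rw [Set.indicator_of_mem hx]
    refine (Measure.restrict_apply_le _ _).trans (measure_mono fun y hy ↦ ?_)
    exact mem_cube_comm.2 hy
  · rw [Set.indicator_of_notMem hx, nonpos_iff_eq_zero, Measure.restrict_apply
      (measurable_prodMk_right hE)]
    convert measure_empty (μ := F)
    ext y
    simp only [Set.mem_inter_iff, Set.mem_preimage, Set.mem_ofPred_eq, Set.mem_empty_iff_false,
      iff_false, not_and]
    exact fun hy hyS ↦ hx (hSS' y hyS hy)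

/-- Far from the origin, the shell `{R ≤ ρ(0,·) < 2R}` has mass at most `C R⁻²`: its volume is of
order `R^Q`, and cubes centred in it have mass of order `R^{-(Q+2)}`. -/
lemma SpectralCondition.exists_shell_le (j₀ : Fin N) {H : Fin N → ℝ}
    (hH : ∀ j, 0 < H j ∧ H j < 1)
    {F : Measure (EuclideanSpace ℝ (Fin N))} (hF : F {y | 1 ≤ ‖y‖} < ⊤) {h : ℝ} (hh : 0 < h)
    (hFh : SpectralCondition H F h) :
    ∃ R₀ C : ℝ, 1 ≤ R₀ ∧ 0 ≤ C ∧ ∀ R ≥ R₀,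
      F {x | R ≤ rho H 0 x ∧ rho H 0 x < 2 * R} ≤ ENNReal.ofReal (C * R ^ (-2 : ℝ)) := by
  have hN : (1 : ℝ) ≤ N := by exact_mod_cast j₀.pos
  obtain ⟨K, c, C, hK, hc, hb⟩ := hFh.exists_bounds
  have hQ := homDim_nonneg hH
  set Q := homDim H with hQdef
  set L : ℝ := N * (1 + h) with hL
  have hL1 : 1 ≤ L := by nlinarith
  refine ⟨2 * (L + N * (2 + K)), (2 * h)⁻¹ ^ N * (C * 2 ^ N * 3 ^ Q * 2 ^ (Q + 2)), by nlinarith,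
    by positivity, fun R hR ↦ ?_⟩
  have hR1 : 1 ≤ R := by nlinarith
  have hR0 : 0 < R := by linarith
  have hρm := (continuous_rho_zero hH).measurable
  set S : Set (EuclideanSpace ℝ (Fin N)) := {x | R ≤ rho H 0 x ∧ rho H 0 x < 2 * R} with hS
  have hSm : MeasurableSet S :=
    (measurableSet_le measurable_const hρm).inter (measurableSet_lt hρm measurable_const)
  have hfar (x : EuclideanSpace ℝ (Fin N)) (hx : R / 2 ≤ rho H 0 x) : 1 + K < ‖x‖ := by
    have h1 := rho_zero_le hH x
    by_contra! hcon
    have : (N : ℝ) * (1 + ‖x‖) ≤ N * (2 + K) :=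
      mul_le_mul_of_nonneg_left (by linarith) (by linarith)
    nlinarith
  set S' : Set (EuclideanSpace ℝ (Fin N)) := {x | R / 2 ≤ rho H 0 x ∧ rho H 0 x ≤ 3 * R} with hS'
  have hSm' : MeasurableSet S' :=
    (measurableSet_le measurable_const hρm).inter (measurableSet_le hρm measurable_const)
  have hFS : F S < ⊤ := lt_of_le_of_lt (measure_mono fun x hx ↦ by
    have := hfar x (by linarith [hx.1])
    show 1 ≤ ‖x‖
    linarith) hF
  have hsub : ∀ y ∈ S, cube y h ⊆ S' := by
    intro y hy x hx
    have hyx : y ∈ cube x h := fun j ↦ by rw [abs_sub_comm]; exact hx j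
    have h1 := rho_zero_le_of_mem_cube hH hh.le hx
    have h2 := rho_zero_le_of_mem_cube hH hh.le hyx
    have h3 : L ≤ R / 2 := by nlinarith
    exact ⟨by linarith [hy.1], by linarith [hy.2]⟩
  have hcube : ∀ x ∈ S', F (cube x h) ≤ ENNReal.ofReal (C * (R / 2) ^ (-(Q + 2))) := by
    intro x hx
    have hρ : 0 < rho H 0 x := by linarith [hx.1]
    have hpow : 0 < rho H 0 x ^ (Q + 2) := Real.rpow_pos_of_pos hρ _
    have h1 := (hb x (by linarith [hfar x hx.1])).2
    calc F (cube x h) ≤ C / ENNReal.ofReal (rho H 0 x ^ (Q + 2)) := by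
          rw [ENNReal.le_div_iff_mul_le (Or.inl (by simpa using hpow))
            (Or.inl ENNReal.ofReal_ne_top), mul_comm]
          exact h1
      _ = ENNReal.ofReal (C / rho H 0 x ^ (Q + 2)) := by
        rw [ENNReal.ofReal_div_of_pos hpow, ENNReal.ofReal_coe_nnreal]
      _ ≤ _ := by
        refine ENNReal.ofReal_le_ofReal ?_
        rw [Real.rpow_neg (by positivity), div_eq_mul_inv]
        have := hx.1
        gcongr
  have hmain : ENNReal.ofReal (2 * h) ^ N * F S ≤
      ENNReal.ofReal (C * (R / 2) ^ (-(Q + 2)) * (2 ^ N * (3 * R) ^ Q)) := by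
    calc _ ≤ ∫⁻ x in S', F (cube x h) := measure_le_lintegral_cube hSm hSm' hFS hsub
      _ ≤ ∫⁻ x in S', ENNReal.ofReal (C * (R / 2) ^ (-(Q + 2))) := setLIntegral_mono' hSm' hcube
      _ = ENNReal.ofReal (C * (R / 2) ^ (-(Q + 2))) * volume S' := setLIntegral_const _ _
      _ ≤ ENNReal.ofReal (C * (R / 2) ^ (-(Q + 2))) * ENNReal.ofReal (2 ^ N * (3 * R) ^ Q) := by
        gcongr
        exact (measure_mono fun x hx ↦ hx.2).trans (volume_rho_le hH (by positivity))
      _ = _ := (ENNReal.ofReal_mul (by positivity)).symm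
  have hval : C * (R / 2) ^ (-(Q + 2)) * (2 ^ N * (3 * R) ^ Q) =
      C * 2 ^ N * 3 ^ Q * 2 ^ (Q + 2) * R ^ (-2 : ℝ) := by
    rw [Real.rpow_neg (by positivity), Real.div_rpow hR0.le (by norm_num),
      Real.mul_rpow (by norm_num) hR0.le, Real.rpow_add hR0, Real.rpow_neg hR0.le]
    field_simp
  rw [hval, ← ENNReal.ofReal_pow (by positivity)] at hmain
  have h2h : 0 < (2 * h) ^ N := by positivity
  have := ENNReal.le_div_iff_mul_le (a := F S) (b := ENNReal.ofReal ((2 * h) ^ N))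
    (c := ENNReal.ofReal (C * 2 ^ N * 3 ^ Q * 2 ^ (Q + 2) * R ^ (-2 : ℝ)))
    (Or.inl (by simpa using h2h)) (Or.inl ENNReal.ofReal_ne_top)
  rw [mul_comm] at hmain
  refine (this.2 hmain).trans (le_of_eq ?_)
  rw [← ENNReal.ofReal_div_of_pos h2h]
  congr 1
  rw [inv_pow]
  field_simp

/-- The restriction of `F` to `{ρ(0,·) ≥ R₀}` has shells of mass at most `C R⁻²` at every scale. -/
lemma SpectralCondition.exists_restrict_shell_le (j₀ : Fin N) {H : Fin N → ℝ}
    (hH : ∀ j, 0 < H j ∧ H j < 1)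
    {F : Measure (EuclideanSpace ℝ (Fin N))} (hF : F {y | 1 ≤ ‖y‖} < ⊤) {h : ℝ} (hh : 0 < h)
    (hFh : SpectralCondition H F h) :
    ∃ R₀ C : ℝ, 1 ≤ R₀ ∧ 0 ≤ C ∧ ∀ R > 0,
      F.restrict {x | R₀ ≤ rho H 0 x} {x | R ≤ rho H 0 x ∧ rho H 0 x < 2 * R} ≤
        ENNReal.ofReal (C * R ^ (-2 : ℝ)) := by
  obtain ⟨R₀, C, hR₀, hC, hsh⟩ := hFh.exists_shell_le j₀ hH hF hh
  refine ⟨R₀, C, hR₀, hC, fun R hR ↦ ?_⟩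
  have hρm := (continuous_rho_zero hH).measurable
  rw [Measure.restrict_apply' (measurableSet_le measurable_const hρm)]
  rcases le_or_gt R₀ R with h | h
  · exact (measure_mono Set.inter_subset_left).trans (hsh R h)
  · refine (measure_mono (t := {x | R₀ ≤ rho H 0 x ∧ rho H 0 x < 2 * R₀}) fun x hx ↦
      ⟨hx.2, hx.1.2.trans (by linarith)⟩).trans ((hsh R₀ le_rfl).trans ?_)
    refine ENNReal.ofReal_le_ofReal (mul_le_mul_of_nonneg_left ?_ hC)
    exact Real.rpow_le_rpow_of_nonpos hR h.le (by norm_num)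

lemma norm_exp_sub_exp_le (a b : ℝ) :
    ‖Complex.exp (Complex.I * a) - Complex.exp (Complex.I * b)‖ ≤ min 2 |a - b| := by
  refine le_min ?_ ?_
  · calc _ ≤ ‖Complex.exp (Complex.I * a)‖ + ‖Complex.exp (Complex.I * b)‖ := norm_sub_le _ _
      _ = 2 := by rw [norm_exp_I_mul_ofReal, norm_exp_I_mul_ofReal]; norm_num
  · have h : Complex.exp (Complex.I * a) - Complex.exp (Complex.I * b) =
        Complex.exp (Complex.I * b) * (Complex.exp (Complex.I * ((a - b : ℝ) : ℂ)) - 1) := by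
      rw [mul_sub, ← Complex.exp_add, mul_one]
      congr 2
      push_cast; ring
    rw [h, norm_mul, norm_exp_I_mul_ofReal, one_mul]
    exact Real.norm_exp_I_mul_ofReal_sub_one_le

lemma abs_inner_le_sum (x τ : EuclideanSpace ℝ (Fin N)) :
    |(inner ℝ x τ : ℝ)| ≤ ∑ j, |τ j| * |x j| := by
  rw [PiLp.inner_apply]
  refine (Finset.abs_sum_le_sum_abs _ _).trans (le_of_eq ?_)
  refine Finset.sum_congr rfl fun j _ ↦ ?_
  rw [← abs_mul]
  simp

lemma rho_eq_sub (H : Fin N → ℝ) (u t : EuclideanSpace ℝ (Fin N)) :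
    rho H u t = rho H 0 (u - t) := by
  simp [rho, abs_sub_comm]

/-- For `ρ(0,τ) ρ(0,x) ≤ 1` the phase `⟨x,τ⟩` is at most `N (ρ(0,τ) ρ(0,x))^β` with `β > 1`. -/
lemma abs_inner_le_rpow {H : Fin N → ℝ} (hH : ∀ j, 0 < H j ∧ H j < 1) {β : ℝ}
    (hβ : ∀ j, β ≤ (H j)⁻¹) {x τ : EuclideanSpace ℝ (Fin N)} (hle : rho H 0 τ * rho H 0 x ≤ 1)
    (hpos : 0 < rho H 0 τ * rho H 0 x) :
    |(inner ℝ x τ : ℝ)| ≤ N * (rho H 0 τ * rho H 0 x) ^ β := by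
  have hsingle (y : EuclideanSpace ℝ (Fin N)) (j : Fin N) : |y j| ^ H j ≤ rho H 0 y := by
    rw [rho_zero_left]
    exact Finset.single_le_sum (f := fun j ↦ |y j| ^ H j)
      (fun _ _ ↦ Real.rpow_nonneg (abs_nonneg _) _) (Finset.mem_univ j)
  calc |(inner ℝ x τ : ℝ)| ≤ ∑ j, |τ j| * |x j| := abs_inner_le_sum x τ
    _ ≤ ∑ _j : Fin N, (rho H 0 τ * rho H 0 x) ^ β := by
      refine Finset.sum_le_sum fun j _ ↦ ?_
      have hj := (hH j).1
      calc |τ j| * |x j| = (|τ j| ^ H j * |x j| ^ H j) ^ (H j)⁻¹ := by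
            rw [← Real.mul_rpow (abs_nonneg _) (abs_nonneg _), ← Real.rpow_mul (by positivity),
              mul_inv_cancel₀ hj.ne', Real.rpow_one]
        _ ≤ (rho H 0 τ * rho H 0 x) ^ (H j)⁻¹ := by
          gcongr
          · exact rho_nonneg _ _ _
          · exact hsingle τ j
          · exact hsingle x j
        _ ≤ _ := Real.rpow_le_rpow_of_exponent_ge hpos hle (hβ j)
    _ = _ := by simp

/-- On bounded sets the Euclidean norm is dominated by `ρ`, because all `Hⱼ` are at most `1`. -/
lemma norm_le_mul_rho {H : Fin N → ℝ} (hH : ∀ j, 0 < H j ∧ H j < 1) {T : ℝ} (hT : 0 < T)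
    {τ : EuclideanSpace ℝ (Fin N)} (hτ : ∀ j, |τ j| ≤ 2 * T) :
    ‖τ‖ ≤ (1 + 2 * T) * rho H 0 τ := by
  rw [rho_zero_left, Finset.mul_sum]
  refine (norm_le_sum_abs τ).trans (Finset.sum_le_sum fun j _ ↦ ?_)
  rcases (abs_nonneg (τ j)).eq_or_lt with h | h
  · rw [← h]; positivity
  calc |τ j| = |τ j| ^ (1 - H j) * |τ j| ^ H j := by
        rw [← Real.rpow_add h, sub_add_cancel, Real.rpow_one]
    _ ≤ _ := by
      gcongr
      exact (rpow_le_one_add (abs_nonneg _) (by linarith [(hH j).2]) (by linarith [(hH j).1])).trans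
        (by linarith [hτ j])

/-- The `L²(F)`-distance between `e^{i⟨·,u⟩}` and `e^{i⟨·,t⟩}` is at most `const · ρ(u,t)`. Low
frequencies contribute `O(‖u - t‖²)` by integrability; high frequencies are summed over dyadic
shells, which converges because all `1 / Hⱼ` exceed `1`. -/
theorem exists_lintegral_exp_sub_le (j₀ : Fin N) {H : Fin N → ℝ} (hH : ∀ j, 0 < H j ∧ H j < 1)
    {F : Measure (EuclideanSpace ℝ (Fin N))} (hF : F {y | 1 ≤ ‖y‖} < ⊤)
    (hFint : ∫⁻ ξ, ENNReal.ofReal (‖ξ‖ ^ 2 / (1 + ‖ξ‖ ^ 2)) ∂F < ⊤)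
    {h T : ℝ} (hh : 0 < h) (hFh : SpectralCondition H F h) (hT : 0 < T) :
    ∃ C : ℝ, 0 ≤ C ∧ ∀ u ∈ cube 0 T, ∀ t ∈ cube 0 T,
      ∫⁻ x, ‖Complex.exp (Complex.I * (inner ℝ x u : ℝ)) -
        Complex.exp (Complex.I * (inner ℝ x t : ℝ))‖ₑ ^ 2 ∂F ≤
          ENNReal.ofReal (C * rho H u t ^ 2) := by
  obtain ⟨R₀, C₁, hR₀, hC₁, hsh⟩ := hFh.exists_restrict_shell_le j₀ hH hF hh
  have hρm := (continuous_rho_zero hH).measurable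
  have hρc := continuous_rho_zero hH
  -- an exponent `β > 1` below all `1 / H j`
  obtain ⟨β, hβ1, hβ⟩ : ∃ β : ℝ, 1 < β ∧ ∀ j, β ≤ (H j)⁻¹ := by
    obtain ⟨j, -, hj⟩ := Finset.exists_max_image Finset.univ H ⟨j₀, Finset.mem_univ _⟩
    refine ⟨(H j)⁻¹, (one_lt_inv₀ (hH j).1).2 (hH j).2, fun i ↦ ?_⟩
    exact inv_anti₀ (hH i).1 (hj i (Finset.mem_univ i))
  set S : Set (EuclideanSpace ℝ (Fin N)) := {x | R₀ ≤ rho H 0 x} with hS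
  have hSm : MeasurableSet S := measurableSet_le measurable_const hρm
  obtain ⟨B, hB0, hB⟩ := exists_lintegral_min_rpow_le (μ := F.restrict S) hρm
    ((ae_restrict_mem hSm).mono fun x (hx : R₀ ≤ rho H 0 x) ↦ by linarith) hC₁ hsh
    (p := 2 * β) (by linarith)
  set I := (∫⁻ ξ, ENNReal.ofReal (‖ξ‖ ^ 2 / (1 + ‖ξ‖ ^ 2)) ∂F).toReal with hI
  have hI0 : 0 ≤ I := ENNReal.toReal_nonneg
  set M : ℝ := ∑ j, R₀ ^ (H j)⁻¹ with hM
  refine ⟨(1 + M ^ 2) * (1 + 2 * T) ^ 2 * I + (4 + N ^ 2) * B, by positivity, fun u hu t ht ↦ ?_⟩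
  set τ := u - t with hτ
  set a := rho H u t with ha
  have haτ : rho H 0 τ = a := (rho_eq_sub H u t).symm
  have hτT (j : Fin N) : |τ j| ≤ 2 * T := by
    have := abs_sub (u j) (t j)
    simp only [hτ, PiLp.sub_apply]
    linarith [mem_cube_zero.1 hu j, mem_cube_zero.1 ht j]
  have hτnorm : ‖τ‖ ≤ (1 + 2 * T) * a := haτ ▸ norm_le_mul_rho hH hT hτT
  have ha0 : 0 ≤ a := rho_nonneg _ _ _
  set f : EuclideanSpace ℝ (Fin N) → ℝ := fun x ↦ ‖Complex.exp (Complex.I * (inner ℝ x u : ℝ)) -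
        Complex.exp (Complex.I * (inner ℝ x t : ℝ))‖ with hf
  have hfle (x) : f x ≤ min 2 |(inner ℝ x τ : ℝ)| := by
    rw [hτ, inner_sub_right]; exact norm_exp_sub_exp_le _ _
  have hfe (x) : ‖Complex.exp (Complex.I * (inner ℝ x u : ℝ)) -
      Complex.exp (Complex.I * (inner ℝ x t : ℝ))‖ₑ ^ 2 = ENNReal.ofReal (f x ^ 2) := by
    rw [← ofReal_norm, ENNReal.ofReal_pow (norm_nonneg _)]
  simp_rw [hfe]
  have hf0 (x) : 0 ≤ f x := norm_nonneg _
  -- low frequencies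
  have hlow : ∫⁻ x in Sᶜ, ENNReal.ofReal (f x ^ 2) ∂F ≤
      ENNReal.ofReal ((1 + M ^ 2) * (1 + 2 * T) ^ 2 * I * a ^ 2) := by
    calc _ ≤ ∫⁻ x in Sᶜ, ENNReal.ofReal ((1 + M ^ 2) * ((1 + 2 * T) * a) ^ 2) *
          ENNReal.ofReal (‖x‖ ^ 2 / (1 + ‖x‖ ^ 2)) ∂F := by
          refine setLIntegral_mono' hSm.compl fun x hx ↦ ?_
          rw [← ENNReal.ofReal_mul (by positivity)]
          refine ENNReal.ofReal_le_ofReal ?_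
          have hxR : rho H 0 x ≤ R₀ := (not_le.1 (show ¬ R₀ ≤ rho H 0 x from hx)).le
          have hxM : ‖x‖ ≤ M := (norm_le_sum_abs x).trans
            (Finset.sum_le_sum fun j _ ↦ abs_le_of_rho_le hH hxR j)
          have h1 : f x ≤ ‖x‖ * ((1 + 2 * T) * a) :=
            ((hfle x).trans (min_le_right _ _)).trans ((abs_real_inner_le_norm x τ).trans
              (by gcongr))
          calc f x ^ 2 ≤ (‖x‖ * ((1 + 2 * T) * a)) ^ 2 := pow_le_pow_left₀ (hf0 x) h1 2
            _ = ((1 + ‖x‖ ^ 2) * ((1 + 2 * T) * a) ^ 2) * (‖x‖ ^ 2 / (1 + ‖x‖ ^ 2)) := by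
              field_simp
            _ ≤ _ := by gcongr
      _ ≤ ENNReal.ofReal ((1 + M ^ 2) * ((1 + 2 * T) * a) ^ 2) *
          ∫⁻ x, ENNReal.ofReal (‖x‖ ^ 2 / (1 + ‖x‖ ^ 2)) ∂F := by
        rw [lintegral_const_mul' _ _ ENNReal.ofReal_ne_top]
        gcongr
        exact Measure.restrict_le_self
      _ = _ := by
        rw [← ENNReal.ofReal_toReal hFint.ne, ← ENNReal.ofReal_mul (by positivity)]
        congr 1
        ring
  -- high frequencies
  have hhigh : ∫⁻ x in S, ENNReal.ofReal (f x ^ 2) ∂F ≤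
      ENNReal.ofReal ((4 + N ^ 2) * B * a ^ 2) := by
    rcases ha0.eq_or_lt with h0 | hapos
    · have hτ0 : τ = 0 := norm_le_zero_iff.1 (by rw [← h0, mul_zero] at hτnorm; exact hτnorm)
      have : ∀ x, f x = 0 := fun x ↦ le_antisymm
        ((hfle x).trans ((min_le_right _ _).trans (by simp [hτ0]))) (hf0 x)
      simp [this]
    calc _ ≤ ∫⁻ x in S, ENNReal.ofReal (4 + N ^ 2) *
          ENNReal.ofReal (min 1 ((a * rho H 0 x) ^ (2 * β))) ∂F := by
          refine setLIntegral_mono' hSm fun x (hx : R₀ ≤ rho H 0 x) ↦ ?_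
          rw [← ENNReal.ofReal_mul (by positivity)]
          refine ENNReal.ofReal_le_ofReal ?_
          have hρ : 0 < rho H 0 x := by linarith
          have hpos : 0 < a * rho H 0 x := by positivity
          rcases le_total (a * rho H 0 x) 1 with h1 | h1
          · rw [min_eq_right (Real.rpow_le_one hpos.le h1 (by linarith))]
            have h2 := abs_inner_le_rpow hH hβ (x := x) (τ := τ) (by rwa [haτ]) (by rwa [haτ])
            rw [haτ] at h2
            have h3 := (hfle x).trans ((min_le_right _ _).trans h2)
            calc f x ^ 2 ≤ (N * (a * rho H 0 x) ^ β) ^ 2 := pow_le_pow_left₀ (hf0 x) h3 2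
              _ = N ^ 2 * (a * rho H 0 x) ^ (2 * β) := by
                rw [mul_pow, ← Real.rpow_natCast _ 2, ← Real.rpow_natCast (_ ^ β) 2,
                  ← Real.rpow_mul hpos.le]
                push_cast
                rw [mul_comm β]
              _ ≤ _ := by gcongr; linarith
          · rw [min_eq_left (Real.one_le_rpow h1 (by linarith))]
            have h3 := (hfle x).trans (min_le_left _ _)
            nlinarith [hf0 x, sq_nonneg (N : ℝ)]
      _ ≤ ENNReal.ofReal (4 + N ^ 2) * ENNReal.ofReal (B * a ^ 2) := by
        rw [lintegral_const_mul' _ _ ENNReal.ofReal_ne_top]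
        gcongr
        exact hB a hapos
      _ = _ := by
        rw [← ENNReal.ofReal_mul (by positivity)]
        congr 1
        ring
  calc _ = (∫⁻ x in S, ENNReal.ofReal (f x ^ 2) ∂F) + ∫⁻ x in Sᶜ, ENNReal.ofReal (f x ^ 2) ∂F :=
        (lintegral_add_compl _ hSm).symm
    _ ≤ _ := add_le_add hhigh hlow
    _ = _ := by
      rw [← ENNReal.ofReal_add (by positivity) (by positivity)]
      congr 1
      ring

end Spectral

section Gaussian

variable {N : ℕ}

/-! ### Conditional variance in a Gaussian field -/

/-- Orthogonal projection onto the span of finitely many square-integrable variables. -/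
lemma exists_forall_integral_sub_sum_mul_eq_zero {Ω ι : Type*} [MeasurableSpace Ω] [Fintype ι]
    {P : Measure Ω} {U : Ω → ℝ} {Y : ι → Ω → ℝ} (hU : MemLp U 2 P) (hY : ∀ i, MemLp (Y i) 2 P) :
    ∃ a : ι → ℝ, ∀ k, ∫ ω, (U ω - ∑ i, a i * Y i ω) * Y k ω ∂P = 0 := by
  set e : ι → Lp ℝ 2 P := fun i ↦ (hY i).toLp with he
  set v : Lp ℝ 2 P := hU.toLp with hv
  set K : Submodule ℝ (Lp ℝ 2 P) := Submodule.span ℝ (Set.range e) with hK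
  have : FiniteDimensional ℝ K := FiniteDimensional.span_of_finite ℝ (Set.finite_range e)
  obtain ⟨a, ha⟩ := (Submodule.mem_span_range_iff_exists_fun ℝ).1
    (K.starProjection_apply_mem v)
  have hinner {f g : Ω → ℝ} (hf : MemLp f 2 P) (hg : MemLp g 2 P) :
      inner ℝ hf.toLp hg.toLp = ∫ ω, f ω * g ω ∂P := by
    rw [L2.inner_def]
    refine integral_congr_ae ?_
    filter_upwards [hf.coeFn_toLp, hg.coeFn_toLp] with ω h1 h2
    rw [h1, h2]
    simp [mul_comm]
  refine ⟨a, fun k ↦ ?_⟩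
  have h0 := Submodule.starProjection_inner_eq_zero (K := K) v (e k)
    (Submodule.subset_span ⟨k, rfl⟩)
  rw [← ha, inner_sub_left, sum_inner, hv, hinner hU (hY k)] at h0
  simp_rw [inner_smul_left, he, hinner (hY _) (hY k)] at h0
  have hUk : Integrable (fun ω ↦ U ω * Y k ω) P := hU.integrable_mul (hY k)
  have hik (i : ι) : Integrable (fun ω ↦ a i * (Y i ω * Y k ω)) P :=
    ((hY i).integrable_mul (hY k)).const_mul _
  simp_rw [sub_mul, Finset.sum_mul, mul_assoc]
  rw [integral_sub hUk (integrable_finsetSum _ fun i _ ↦ hik i),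
    integral_finsetSum _ fun i _ ↦ hik i]
  simp_rw [integral_const_mul]
  simpa using h0

/-- If `U = Z + W` with `W` measurable for `m` and `Z` centered and independent of `m`, then the
conditional variance of `U` given `m` is the constant `E Z²`. -/
lemma condVar_ae_eq_of_indep {Ω : Type*} {m mΩ : MeasurableSpace Ω} {P : Measure Ω}
    [IsProbabilityMeasure P] (hm : m ≤ mΩ) {W Z : Ω → ℝ} (hW : Measurable[m] W)
    (hWi : Integrable W P) (hZ : Measurable Z) (hZi : Integrable Z P) (hZ0 : ∫ ω, Z ω ∂P = 0)
    (hindep : Indep (MeasurableSpace.comap Z inferInstance) m P) :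
    condVar m (Z + W) P =ᵐ[P] fun _ ↦ ∫ ω, Z ω ^ 2 ∂P := by
  have hcond : P[Z + W | m] =ᵐ[P] W := by
    have h1 : P[Z | m] =ᵐ[P] fun _ ↦ ∫ ω, Z ω ∂P := condExp_indep_eq hZ.comap_le hm
      (comap_measurable Z).stronglyMeasurable hindep
    have h2 := condExp_add hZi hWi m
    rw [condExp_of_stronglyMeasurable hm hW.stronglyMeasurable hWi] at h2
    filter_upwards [h1, h2] with ω h1 h2
    rw [h2, Pi.add_apply, h1, hZ0, zero_add]
  have hsq : (Z + W - P[Z + W | m]) ^ 2 =ᵐ[P] fun ω ↦ Z ω ^ 2 := by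
    filter_upwards [hcond] with ω h
    simp [h]
  exact (condExp_congr_ae hsq).trans (condExp_indep_eq hZ.comap_le hm
    ((comap_measurable Z).pow_const 2).stronglyMeasurable hindep)

/-- In a centered Gaussian process the conditional variance of `X u` given finitely many values
is deterministic, and is the mean square of `X u` minus a linear predictor. The residual is
uncorrelated with, hence independent of, the conditioning variables. -/
lemma exists_condVar_ae_eq {Ω S : Type*} [MeasurableSpace Ω] {P : Measure Ω}
    {X : S → Ω → ℝ} (hXm : ∀ s, Measurable (X s)) (hX : IsGaussianProcess X P)
    (hX0 : ∀ s, ∫ ω, X s ω ∂P = 0) {ι : Type*} [Fintype ι] (t : ι → S) (u : S) :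
    ∃ a : ι → ℝ, condVar (⨆ i, MeasurableSpace.comap (X (t i)) inferInstance) (X u) P =ᵐ[P]
      fun _ ↦ ∫ ω, (X u ω - ∑ i, a i * X (t i) ω) ^ 2 ∂P := by
  classical
  have := hX.isProbabilityMeasure
  have hL (s : S) : MemLp (X s) 2 P := (hX.hasGaussianLaw_eval s).memLp_two
  obtain ⟨a, ha⟩ := exists_forall_integral_sub_sum_mul_eq_zero (hL u) fun i ↦ hL (t i)
  refine ⟨a, ?_⟩
  set W : Ω → ℝ := fun ω ↦ ∑ i, a i * X (t i) ω with hW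
  set Z : Ω → ℝ := fun ω ↦ X u ω - W ω with hZ
  have hWL : MemLp W 2 P := memLp_finsetSum _ fun i _ ↦ (hL (t i)).const_mul (a i)
  have hZL : MemLp Z 2 P := (hL u).sub hWL
  have hWm : Measurable[⨆ i, MeasurableSpace.comap (X (t i)) inferInstance] W :=
    Finset.measurable_sum _ fun i _ ↦ Measurable.const_mul ((comap_measurable (X (t i))).mono
      (le_iSup (fun i ↦ MeasurableSpace.comap (X (t i)) inferInstance) i) le_rfl) _
  have hZm : Measurable Z := (hXm u).sub (by fun_prop)
  have hZ0 : ∫ ω, Z ω ∂P = 0 := by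
    rw [hZ, integral_sub ((hL u).integrable one_le_two) (hWL.integrable one_le_two), hX0, hW,
      integral_finsetSum _ fun i _ ↦ ((hL (t i)).const_mul (a i)).integrable one_le_two]
    simp [integral_const_mul, hX0]
  have hG : IsGaussianProcess (Sum.elim (fun _ : Unit ↦ Z) fun i ↦ X (t i)) P := by
    refine hX.of_isGaussianProcess ?_
    rintro (_ | i)
    · have hmem (i : ι) : t i ∈ insert u (Finset.univ.image t) := by simp
      refine ⟨insert u (Finset.univ.image t),
        ContinuousLinearMap.proj (⟨u, Finset.mem_insert_self _ _⟩ :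
          {x // x ∈ insert u (Finset.univ.image t)}) - ∑ i, a i •
          ContinuousLinearMap.proj (⟨t i, hmem i⟩ :
            {x // x ∈ insert u (Finset.univ.image t)}), fun ω ↦ ?_⟩
      simp [hZ, hW]
    · exact ⟨{t i}, ContinuousLinearMap.proj (⟨t i, Finset.mem_singleton_self _⟩ :
        {x // x ∈ ({t i} : Finset S)}), fun ω ↦ by simp⟩
  have hindep := (hG.indepFun_of_covariance_eq_zero (fun _ ↦ hZm.aemeasurable)
    (fun i ↦ (hXm (t i)).aemeasurable) fun _ k ↦ by
      rw [covariance_eq_sub hZL (hL (t k)), hZ0, zero_mul, sub_zero]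
      exact ha k).comp (measurable_pi_apply ()) measurable_id
  have hpi : MeasurableSpace.comap (fun ω i ↦ X (t i) ω) MeasurableSpace.pi =
      ⨆ i, MeasurableSpace.comap (X (t i)) inferInstance := by
    rw [MeasurableSpace.pi, MeasurableSpace.comap_iSup]
    simp_rw [MeasurableSpace.comap_comp]
    rfl
  have hmain := condVar_ae_eq_of_indep (P := P) (iSup_le fun i ↦ (hXm (t i)).comap_le) hWm
    (hWL.integrable one_le_two) hZm (hZL.integrable one_le_two) hZ0
    (hpi ▸ (IndepFun_iff_Indep _ _ _).1 hindep)
  have hXu : Z + W = X u := by ext ω; simp [hZ]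
  rwa [hXu] at hmain

/-! ### Second moments through the spectral measure -/

/-- Both `‖e^{i⟨x,v⟩} - 1‖² ≤ 4` and `≤ ‖x‖² ‖v‖²` are used, so that the weight
`‖x‖² / (1 + ‖x‖²)` suffices. -/
lemma IsSpectralMeasure.memLp_exp_sub_one {Ω : Type*} [MeasurableSpace Ω]
    {X : EuclideanSpace ℝ (Fin N) → Ω → ℝ} {P : Measure Ω}
    {F : Measure (EuclideanSpace ℝ (Fin N))} (hF : IsSpectralMeasure X P F)
    (v : EuclideanSpace ℝ (Fin N)) :
    MemLp (fun x ↦ Complex.exp (Complex.I * (inner ℝ x v : ℝ)) - 1) 2 F := by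
  have hc : Continuous fun x ↦ Complex.exp (Complex.I * (inner ℝ x v : ℝ)) - 1 := by fun_prop
  rw [memLp_two_iff_integrable_sq_norm hc.aestronglyMeasurable]
  have hI : Integrable (fun x : EuclideanSpace ℝ (Fin N) ↦ ‖x‖ ^ 2 / (1 + ‖x‖ ^ 2)) F := by
    refine ⟨Measurable.aestronglyMeasurable (by fun_prop), ?_⟩
    rw [hasFiniteIntegral_iff_ofReal (Filter.Eventually.of_forall fun x ↦ by positivity)]
    exact hF.finite_integral
  refine (hI.const_mul (‖v‖ ^ 2 + 4)).mono' (hc.norm.pow 2).aestronglyMeasurable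
    (Filter.Eventually.of_forall fun x ↦ ?_)
  rw [Real.norm_of_nonneg (by positivity)]
  have h1 := norm_exp_sub_exp_le (inner ℝ x v) 0
  simp only [Complex.ofReal_zero, mul_zero, Complex.exp_zero, sub_zero] at h1
  set A := ‖Complex.exp (Complex.I * (inner ℝ x v : ℝ)) - 1‖
  have h2 : A ^ 2 ≤ 2 ^ 2 := pow_le_pow_left₀ (norm_nonneg _) (h1.trans (min_le_left _ _)) 2
  have h3 : A ^ 2 ≤ (‖x‖ * ‖v‖) ^ 2 := pow_le_pow_left₀ (norm_nonneg _)
    (h1.trans ((min_le_right _ _).trans (abs_real_inner_le_norm x v))) 2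
  rw [mul_div_assoc', le_div_iff₀ (by positivity)]
  nlinarith [sq_nonneg ‖x‖, mul_le_mul_of_nonneg_right h2 (sq_nonneg ‖x‖)]

/-- The second moment of a linear combination of values of the field, as the sum of its energy in
the spectral measure and of the contribution of the linear part of the field. -/
lemma IsSpectralMeasure.exists_ofReal_integral_sq_eq {Ω : Type*} [MeasurableSpace Ω]
    {X : EuclideanSpace ℝ (Fin N) → Ω → ℝ} {P : Measure Ω} (hX : ∀ t, MemLp (X t) 2 P)
    {F : Measure (EuclideanSpace ℝ (Fin N))} (hF : IsSpectralMeasure X P F) :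
    ∃ M : Matrix (Fin N) (Fin N) ℝ, M.PosSemidef ∧
      ∀ (n : ℕ) (v : Fin n → EuclideanSpace ℝ (Fin N)) (b : Fin n → ℝ),
        ENNReal.ofReal (∫ ω, (∑ i, b i * X (v i) ω) ^ 2 ∂P) =
          (∫⁻ x, ‖∑ i, (b i : ℂ) *
            (Complex.exp (Complex.I * (inner ℝ x (v i) : ℝ)) - 1)‖ₑ ^ 2 ∂F) +
          ENNReal.ofReal ((∑ i, b i • v i).ofLp ⬝ᵥ M.mulVec (∑ i, b i • v i).ofLp) := by
  obtain ⟨M, hM, hrep⟩ := hF.representation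
  refine ⟨M, hM, fun n v b ↦ ?_⟩
  set z : Fin n → EuclideanSpace ℝ (Fin N) → ℂ := fun i x ↦
    Complex.exp (Complex.I * (inner ℝ x (v i) : ℝ)) - 1 with hz
  have hzL (i : Fin n) : MemLp (z i) 2 F := hF.memLp_exp_sub_one (v i)
  have hYL : MemLp (fun x ↦ ∑ i, (b i : ℂ) * z i x) 2 F :=
    memLp_finsetSum _ fun i _ ↦ (hzL i).const_mul _
  have hq : 0 ≤ (∑ i, b i • v i).ofLp ⬝ᵥ M.mulVec (∑ i, b i • v i).ofLp := by
    simpa using hM.dotProduct_mulVec_nonneg (∑ i, b i • v i).ofLp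
  have hsq := (memLp_two_iff_integrable_sq_norm hYL.aestronglyMeasurable).1 hYL
  have hlin : ∫⁻ x, ‖∑ i, (b i : ℂ) * z i x‖ₑ ^ 2 ∂F =
      ENNReal.ofReal (∫ x, ‖∑ i, (b i : ℂ) * z i x‖ ^ 2 ∂F) := by
    rw [ofReal_integral_eq_lintegral_ofReal hsq
      (Filter.Eventually.of_forall fun x ↦ by positivity)]
    refine lintegral_congr fun x ↦ ?_
    rw [← ofReal_norm, ENNReal.ofReal_pow (norm_nonneg _)]
  rw [hlin, ← ENNReal.ofReal_add (integral_nonneg fun x ↦ by positivity) hq]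
  congr 1
  have hij (i j : Fin n) : Integrable (fun x ↦ z i x * (starRingEnd ℂ) (z j x)) F :=
    (hzL i).integrable_mul (hzL j).star
  have hstar (j : Fin n) (x : EuclideanSpace ℝ (Fin N)) : (starRingEnd ℂ) (z j x) =
      Complex.exp (-(Complex.I * (inner ℝ (v j) x : ℝ))) - 1 := by
    simp [hz, ← Complex.exp_conj, real_inner_comm]
  have hcov (i j : Fin n) : ((∫ ω, X (v i) ω * X (v j) ω ∂P : ℝ) : ℂ) =
      (∫ x, z i x * (starRingEnd ℂ) (z j x) ∂F) +
        (((v i).ofLp ⬝ᵥ M.mulVec (v j).ofLp : ℝ) : ℂ) := by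
    simp_rw [hrep (v i) (v j), hstar, hz, real_inner_comm]
  have hL : ∫ ω, (∑ i, b i * X (v i) ω) ^ 2 ∂P =
      ∑ i, ∑ j, b i * b j * ∫ ω, X (v i) ω * X (v j) ω ∂P := by
    have hint (i j : Fin n) : Integrable (fun ω ↦ b i * b j * (X (v i) ω * X (v j) ω)) P :=
      ((hX (v i)).integrable_mul (hX (v j))).const_mul _
    simp_rw [← integral_const_mul]
    simp_rw [← integral_finsetSum _ fun j _ ↦ hint _ j]
    rw [← integral_finsetSum _ fun i _ ↦ integrable_finsetSum _ fun j _ ↦ hint i j]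
    refine integral_congr_ae (Filter.Eventually.of_forall fun ω ↦ ?_)
    simp only [sq, Finset.sum_mul_sum]
    exact Finset.sum_congr rfl fun i _ ↦ Finset.sum_congr rfl fun j _ ↦ by ring
  have hR : ((∫ x, ‖∑ i, (b i : ℂ) * z i x‖ ^ 2 ∂F : ℝ) : ℂ) =
      ∑ i, ∑ j, (b i : ℂ) * b j * ∫ x, z i x * (starRingEnd ℂ) (z j x) ∂F := by
    have hint (i j : Fin n) : Integrable
        (fun x ↦ (b i : ℂ) * b j * (z i x * (starRingEnd ℂ) (z j x))) F := (hij i j).const_mul _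
    simp_rw [← integral_const_mul]
    simp_rw [← integral_finsetSum _ fun j _ ↦ hint _ j]
    rw [← integral_finsetSum _ fun i _ ↦ integrable_finsetSum _ fun j _ ↦ hint i j,
      ← integral_complex_ofReal]
    refine integral_congr_ae (Filter.Eventually.of_forall fun x ↦ ?_)
    simp only [← Complex.normSq_eq_norm_sq, ← Complex.mul_conj, map_sum, map_mul,
      Complex.conj_ofReal, Finset.sum_mul_sum]
    exact Finset.sum_congr rfl fun i _ ↦ Finset.sum_congr rfl fun j _ ↦ by ring
  have hQ : (∑ i, b i • v i).ofLp ⬝ᵥ M.mulVec (∑ i, b i • v i).ofLp =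
      ∑ i, ∑ j, b i * b j * ((v i).ofLp ⬝ᵥ M.mulVec (v j).ofLp) := by
    simp only [WithLp.ofLp_sum, WithLp.ofLp_smul, Matrix.mulVec_sum, sum_dotProduct,
      dotProduct_sum, Matrix.mulVec_smul, smul_dotProduct, dotProduct_smul, smul_eq_mul,
      Finset.mul_sum]
    rw [Finset.sum_comm]
    exact Finset.sum_congr rfl fun i _ ↦ Finset.sum_congr rfl fun j _ ↦ by ring
  have : ((∫ ω, (∑ i, b i * X (v i) ω) ^ 2 ∂P : ℝ) : ℂ) =
      ((∫ x, ‖∑ i, (b i : ℂ) * z i x‖ ^ 2 ∂F : ℝ) : ℂ) +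
      (((∑ i, b i • v i).ofLp ⬝ᵥ M.mulVec (∑ i, b i • v i).ofLp : ℝ) : ℂ) := by
    rw [hR, hL, hQ]
    push_cast
    simp_rw [hcov, mul_add, Finset.sum_add_distrib]
  exact_mod_cast this

lemma dotProduct_mulVec_le (M : Matrix (Fin N) (Fin N) ℝ) (w : EuclideanSpace ℝ (Fin N)) :
    w.ofLp ⬝ᵥ M.mulVec w.ofLp ≤ (∑ i, ∑ j, |M i j|) * ‖w‖ ^ 2 := by
  simp only [dotProduct, Matrix.mulVec, Finset.mul_sum, Finset.sum_mul]
  refine Finset.sum_le_sum fun i _ ↦ Finset.sum_le_sum fun j _ ↦ ?_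
  have hi : |w i| ≤ ‖w‖ := PiLp.norm_apply_le w i
  have hj : |w j| ≤ ‖w‖ := PiLp.norm_apply_le w j
  calc w i * (M i j * w j) ≤ |w i * (M i j * w j)| := le_abs_self _
    _ = |M i j| * (|w i| * |w j|) := by rw [abs_mul, abs_mul]; ring
    _ ≤ _ := by rw [sq]; gcongr

/-! ### The two conditions -/

/-- The lower bound is strong local nondeterminism with the single point `t`. In the upper bound the
linear part of the field adds at most a multiple of `‖s - t‖²`. -/
theorem conditionC1_of_spectralCondition (j₀ : Fin N) {H : Fin N → ℝ}
    (hH : ∀ j, 0 < H j ∧ H j < 1) {Ω : Type*} [MeasurableSpace Ω] {P : Measure Ω}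
    {X : EuclideanSpace ℝ (Fin N) → Ω → ℝ} (hX : ∀ t, MemLp (X t) 2 P)
    {F : Measure (EuclideanSpace ℝ (Fin N))} (hF : IsSpectralMeasure X P F)
    {h T : ℝ} (hh : 0 < h) (hFh : SpectralCondition H F h) (hT : 0 < T)
    (hThN : T * h * N < Real.log 2) : ConditionC1 H X P (cube 0 T) := by
  obtain ⟨M, hM, hsq⟩ := hF.exists_ofReal_integral_sq_eq hX
  obtain ⟨c, hc, hlow⟩ :=
    exists_le_lintegral_expSum j₀ hH hF.measure_one_le_norm_lt_top hh hFh hT hThN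
  obtain ⟨C, hC, hup⟩ := exists_lintegral_exp_sub_le j₀ hH hF.measure_one_le_norm_lt_top
    hF.finite_integral hh hFh hT
  set K : ℝ := ∑ i, ∑ j, |M i j| with hK
  have hK0 : 0 ≤ K := Finset.sum_nonneg fun i _ ↦ Finset.sum_nonneg fun j _ ↦ abs_nonneg _
  refine ⟨1 + c⁻¹ + (C + K * (1 + 2 * T) ^ 2), ?_, fun s hs t ht ↦ ?_⟩
  · have : 0 < c⁻¹ := inv_pos.2 hc
    have : 0 ≤ C + K * (1 + 2 * T) ^ 2 := by positivity
    linarith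
  have hkey := hsq 2 ![s, t] ![1, -1]
  simp only [Fin.sum_univ_two, Matrix.cons_val_zero, Matrix.cons_val_one, one_mul,
    Complex.ofReal_one, Complex.ofReal_neg, neg_mul, one_smul, neg_smul, ← sub_eq_add_neg,
    sub_sub_sub_cancel_right] at hkey
  have hρ := rho_nonneg H s t
  have hV : 0 ≤ ∫ ω, (X s ω - X t ω) ^ 2 ∂P := integral_nonneg fun ω ↦ sq_nonneg _
  constructor
  · have h1 := hlow 0 (fun _ ↦ t) s (fun _ ↦ 1) (rho H s t) hs (fun _ ↦ ht) hρ fun _ ↦ le_rfl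
    have hexp (x : EuclideanSpace ℝ (Fin N)) : expSum s (fun _ : Fin (0 + 1) ↦ t) (fun _ ↦ 1) x =
        Complex.exp (Complex.I * (inner ℝ x s : ℝ)) -
          Complex.exp (Complex.I * (inner ℝ x t : ℝ)) := by simp [expSum]
    simp_rw [hexp] at h1
    have h2 : ENNReal.ofReal (c * rho H s t ^ 2) ≤
        ENNReal.ofReal (∫ ω, (X s ω - X t ω) ^ 2 ∂P) := by
      rw [hkey]
      exact h1.trans le_self_add
    refine le_trans ?_ ((ENNReal.ofReal_le_ofReal_iff hV).1 h2)
    gcongr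
    refine inv_le_of_inv_le₀ hc ?_
    have : 0 ≤ C + K * (1 + 2 * T) ^ 2 := by positivity
    linarith
  · have hτ (j : Fin N) : |(s - t) j| ≤ 2 * T := by
      have := abs_sub (s j) (t j)
      simp only [PiLp.sub_apply]
      linarith [mem_cube_zero.1 hs j, mem_cube_zero.1 ht j]
    have hn : ‖s - t‖ ≤ (1 + 2 * T) * rho H s t := by
      rw [rho_eq_sub]; exact norm_le_mul_rho hH hT hτ
    have hq : (s - t).ofLp ⬝ᵥ M.mulVec (s - t).ofLp ≤ K * ((1 + 2 * T) * rho H s t) ^ 2 :=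
      (dotProduct_mulVec_le M (s - t)).trans (by gcongr)
    have h2 : ENNReal.ofReal (∫ ω, (X s ω - X t ω) ^ 2 ∂P) ≤
        ENNReal.ofReal (C * rho H s t ^ 2 + K * ((1 + 2 * T) * rho H s t) ^ 2) := by
      rw [hkey, ENNReal.ofReal_add (by positivity) (by positivity)]
      exact add_le_add (hup s hs t ht) (ENNReal.ofReal_le_ofReal hq)
    refine ((ENNReal.ofReal_le_ofReal_iff (by positivity)).1 h2).trans ?_
    have : 0 ≤ (1 + c⁻¹) * rho H s t ^ 2 := by positivity
    linarith

/-- The residual of the best linear predictor is `X u - ∑ aᵢ X tᵢ`. Since `X` vanishes at the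
origin, its spectral energy is that of `e^{i⟨·,u⟩} - ∑ aᵢ e^{i⟨·,tᵢ⟩} - (1 - ∑ aᵢ)`, a combination
in which `t⁰ = 0` takes part. -/
theorem conditionC2_of_spectralCondition (j₀ : Fin N) {H : Fin N → ℝ}
    (hH : ∀ j, 0 < H j ∧ H j < 1) {Ω : Type*} [MeasurableSpace Ω] {P : Measure Ω}
    {X : EuclideanSpace ℝ (Fin N) → Ω → ℝ} (hX : IsCenteredGaussianFieldSI X P)
    {F : Measure (EuclideanSpace ℝ (Fin N))} (hF : IsSpectralMeasure X P F)
    {h T : ℝ} (hh : 0 < h) (hFh : SpectralCondition H F h) (hT : 0 < T)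
    (hThN : T * h * N < Real.log 2) : ConditionC2 H X P (cube 0 T) := by
  have hXL (t) : MemLp (X t) 2 P := (hX.gaussian.hasGaussianLaw_eval t).memLp_two
  obtain ⟨M, hM, hsq⟩ := hF.exists_ofReal_integral_sq_eq hXL
  obtain ⟨c, hc, hlow⟩ :=
    exists_le_lintegral_expSum j₀ hH hF.measure_one_le_norm_lt_top hh hFh hT hThN
  refine ⟨c, hc, fun n _ u hu t ht ↦ ?_⟩
  obtain ⟨a, ha⟩ := exists_condVar_ae_eq hX.measurable hX.gaussian hX.centered t u
  filter_upwards [ha] with ω hω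
  rw [hω]
  set t' : Fin (n + 1) → EuclideanSpace ℝ (Fin N) := Fin.cons 0 t with ht'
  obtain ⟨k₀, hk₀⟩ := exists_eq_ciInf_of_finite (f := fun k ↦ rho H u (t' k) ^ 2)
  rw [← hk₀]
  have ht'T (k : Fin (n + 1)) : t' k ∈ cube 0 T := by
    refine Fin.cases ?_ (fun i ↦ ?_) k
    · simpa [ht', mem_cube_zero] using fun _ ↦ hT.le
    · simpa [ht'] using ht i
  have hmin (k : Fin (n + 1)) : rho H u (t' k₀) ≤ rho H u (t' k) := by
    refine (sq_le_sq₀ (rho_nonneg _ _ _) (rho_nonneg _ _ _)).1 ?_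
    rw [hk₀]
    exact ciInf_le (Set.finite_range _).bddBelow k
  have h1 := hlow n t' u (Fin.cons ((1 - ∑ i, a i : ℝ) : ℂ) fun i ↦ (a i : ℂ)) _ hu ht'T
    (rho_nonneg H u (t' k₀)) hmin
  have hkey := hsq (n + 1) (Fin.cons u t) (Fin.cons 1 fun i ↦ -a i)
  have hV : 0 ≤ ∫ ω, (X u ω - ∑ i, a i * X (t i) ω) ^ 2 ∂P := integral_nonneg fun ω ↦ sq_nonneg _
  have hexp (x : EuclideanSpace ℝ (Fin N)) :
      expSum u t' (Fin.cons ((1 - ∑ i, a i : ℝ) : ℂ) fun i ↦ (a i : ℂ)) x =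
      ∑ i, (((Fin.cons 1 fun i ↦ -a i : Fin (n + 1) → ℝ) i : ℝ) : ℂ) *
        (Complex.exp (Complex.I * (inner ℝ x ((Fin.cons u t : Fin (n + 1) → _) i) : ℝ)) - 1) := by
    simp [expSum, ht', Fin.sum_univ_succ, mul_sub, Finset.sum_sub_distrib]
    ring
  have hfun (ω : Ω) : ∑ i, (Fin.cons 1 fun i ↦ -a i : Fin (n + 1) → ℝ) i *
      X ((Fin.cons u t : Fin (n + 1) → _) i) ω = X u ω - ∑ i, a i * X (t i) ω := by
    simp [Fin.sum_univ_succ, sub_eq_add_neg]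
  simp_rw [hfun, ← hexp] at hkey
  refine (ENNReal.ofReal_le_ofReal_iff hV).1 ?_
  rw [hkey]
  exact h1.trans le_self_add

end Gaussian

end SLND

theorem theorem2p1 {N : ℕ} (H : Fin N → ℝ) (hH : ∀ j, 0 < H j ∧ H j < 1)
    {Ω : Type*} [MeasurableSpace Ω] (P : Measure Ω) [IsProbabilityMeasure P]
    (X : EuclideanSpace ℝ (Fin N) → Ω → ℝ) (hX : SLND.IsCenteredGaussianFieldSI X P)
    (F : Measure (EuclideanSpace ℝ (Fin N))) (hF : SLND.IsSpectralMeasure X P F)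
    (h : ℝ) (hh : 0 < h) (hFh : SLND.SpectralCondition H F h)
    (T : ℝ) (hT : 0 < T) (hThN : T * h * N < Real.log 2) :
    SLND.ConditionC1 H X P (SLND.cube 0 T) ∧ SLND.ConditionC2 H X P (SLND.cube 0 T) := by
  rcases Nat.eq_zero_or_pos N with rfl | hN
  · -- in dimension zero `ρ` vanishes identically
    refine ⟨⟨1, le_rfl, fun s _ t _ ↦ ?_⟩, ⟨1, one_pos, fun n _ u _ t _ ↦ ?_⟩⟩
    · simp [SLND.rho, Subsingleton.elim s t]
    · have : 0 ≤ᵐ[P] condVar (⨆ i, MeasurableSpace.comap (X (t i)) inferInstance) (X u) P :=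
        condExp_nonneg (Filter.Eventually.of_forall fun ω ↦ sq_nonneg _)
      filter_upwards [this] with ω hω
      simpa [SLND.rho] using hω
  · exact ⟨SLND.conditionC1_of_spectralCondition ⟨0, hN⟩ hH
      (fun t ↦ (hX.gaussian.hasGaussianLaw_eval t).memLp_two) hF hh hFh hT hThN,
      SLND.conditionC2_of_spectralCondition ⟨0, hN⟩ hH hX hF hh hFh hT hThN⟩
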